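/- Let $k\ge 3$, $m\ge 4$ and $0<\alpha<1$. For a $k$-uniform hypergraph $\mathcal H$ on $n$ vertices let $\mathcal A_\alpha(\mathcal H)=\alpha\mathcal D(\mathcal H)+(1-\alpha)\mathcal A(\mathcal H)$, where $\mathcal D(\mathcal H)$ is the diagonal tensor of the vertex degrees and $\mathcal A(\mathcal H)$ is the adjacency tensor (order $k$, dimension $n$, with entry $\frac{1}{(k-1)!}$ at $(i_1,\dots,i_k)$ if $\{i_1,\dots,i_k\}$ is a hyperedge and $0$ otherwise). The $d$-th order trace of a tensor $\mathcal T=(t_{i_1\cdots i_k})$ of order $k$ and dimension $n$ is $$\mathrm{Tr}_d(\mathcal T)=(k-1)^{n-1}\sum_{d_1+\cdots+d_n=d}\ \prod_{i=1}^n\frac{1}{(d_i(k-1))!}\Big(\sum_{\beta\in[n]^{k-1}}t_{i\beta}\frac{\partial}{\partial a_{i\beta}}\Big)^{d_i}\mathrm{tr}\big(A^{d(k-1)}\big),$$ where $A=(a_{ij})$ is an $n\times n$ matrix of indeterminates, the $d_i$ are nonnegative integers and $\frac{\partial}{\partial a_{i\beta}}=\frac{\partial}{\partial a_{ii_2}}\cdots\frac{\partial}{\partial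 a_{ii_k}}$ for $\beta=i_2\cdots i_k$. For $k$-uniform hypergraphs $\mathcal H_1,\mathcal H_2$ with the same number $n$ of vertices write $\mathcal H_1\prec_\alpha\mathcal H_2$ if for some $1\le d\le n(k-1)^{n-1}-1$ one has $\mathrm{Tr}_t(\mathcal A_\alpha(\mathcal H_1))=\mathrm{Tr}_t(\mathcal A_\alpha(\mathcal H_2))$ for all $0\le t<d$ and $\mathrm{Tr}_d(\mathcal A_\alpha(\mathcal H_1))<\mathrm{Tr}_d(\mathcal A_\alpha(\mathcal H_2))$; write $\mathcal H_1=_\alpha\mathcal H_2$ if these traces agree for all $0\le t\le n(k-1)^{n-1}-1$; and write $\mathcal H_1\preceq_\alpha\mathcal H_2$ if $\mathcal H_1\prec_\alpha\mathcal H_2$ or $\mathcal H_1=_\alpha\mathcal H_2$ ($S_\alpha$-order). A $k$-uniform hypertree is a finite connected $k$-uniform hypergraph without (Berge) cycles. Let $P_m^{(k)}$ be the $k$-uniform hyperpath with $m$ hyperedges, i.e. the hypergraph obtained from the path with edges $e_1,\dots,e_m$ (in this order) by adding $k-2$ new vertices to each edge $e_i$, giving the hyperedge $e_i^{(k)}$.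 Let $F_{m,k}$ be obtained from $P_{m-1}^{(k)}$ by attaching, at a vertex of degree one of its second hyperedge $e_2^{(k)}$, a pendant hyperedge (consisting of that vertex and $k-1$ new vertices). Then, among all $k$-uniform hypertrees with $m$ hyperedges, $F_{m,k}$ is the second in $S_\alpha$-order. That is: $P_m^{(k)}$ and $F_{m,k}$ are $k$-uniform hypertrees with $m$ hyperedges, $P_m^{(k)}\prec_\alpha F_{m,k}$, and every $k$-uniform hypertree $T$ with $m$ hyperedges that is not isomorphic to $P_m^{(k)}$ satisfies $F_{m,k}\preceq_\alpha T$, with $F_{m,k}=_\alpha T$ if and only if $T\cong F_{m,k}$. -/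

import Mathlib

noncomputable section

/-- A real tensor of order `k` (`k ≥ 1`) with indices in `ι`. The entry `a_{i i₂ ⋯ iₖ}` is `A i β`,
where `i` is the first index and `β = (i₂, …, iₖ)` lists the other `k - 1` indices. -/
abbrev HTensor (k : ℕ) (ι : Type*) : Type _ := ι → (Fin (k - 1) → ι) → ℝ

namespace HTensor

/-- The partial derivative `∂/∂a_{ij}`, `p = (i, j)`, as a linear operator on the polynomials in
the entries of an auxiliary matrix `(a_{ij})`. -/
def partialOp {ι : Type*} (p : ι × ι) : Module.End ℝ (MvPolynomial (ι × ι) ℝ) :=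
  (MvPolynomial.pderiv p).toLinearMap

/-- The differential operator `∑_β A_{iβ} ∂/∂a_{iβ}`, where `β` runs over all `(k-1)`-tuples of
indices and `∂/∂a_{iβ} = ∂/∂a_{i i₂} ⋯ ∂/∂a_{i iₖ}` for `β = (i₂, …, iₖ)`. -/
def rowOp {k : ℕ} {ι : Type*} [Fintype ι] (A : HTensor k ι) (i : ι) :
    Module.End ℝ (MvPolynomial (ι × ι) ℝ) :=
  ∑ β : Fin (k - 1) → ι, A i β • (List.ofFn fun t => partialOp (i, β t)).prod

theorem commute_partialOp {ι : Type*} (p q : ι × ι) : Commute (partialOp p) (partialOp q) := by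
  classical
  let D (r : ι × ι) : Derivation ℝ (MvPolynomial (ι × ι) ℝ) (MvPolynomial (ι × ι) ℝ) :=
    MvPolynomial.pderiv r
  have h : ⁅D p, D q⁆ = 0 := by
    apply MvPolynomial.derivation_ext
    intro r
    simp [D, Derivation.commutator_apply, MvPolynomial.pderiv_X, Pi.single_apply, apply_ite]
  apply LinearMap.ext
  intro f
  have := DFunLike.congr_fun h f
  rw [Derivation.commutator_apply] at this
  exact sub_eq_zero.mp this

theorem commute_rowOp {k : ℕ} {ι : Type*} [Fintype ι] (A : HTensor k ι) (i j : ι) :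
    Commute (rowOp A i) (rowOp A j) := by
  refine Commute.sum_left _ _ _ fun β _ => Commute.sum_right _ _ _ fun γ _ => ?_
  refine Commute.smul_left (Commute.smul_right ?_ _) _
  refine Commute.list_prod_left _ _ fun x hx => Commute.list_prod_right _ _ fun y hy => ?_
  obtain ⟨s, rfl⟩ := (List.mem_ofFn' _ _).mp hx
  obtain ⟨t, rfl⟩ := (List.mem_ofFn' _ _).mp hy
  exact commute_partialOp _ _

/-- The `d`-th order trace of a tensor of order `k` and dimension `n`,
`Tr_d(A) = (k-1)^{n-1} ∑_{d₁+⋯+dₙ=d} ∏ᵢ 1/(dᵢ(k-1))! (∑_β A_{iβ} ∂/∂a_{iβ})^{dᵢ} tr(M^{d(k-1)})`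
with `M = (a_{ij})` the `n × n` matrix of indeterminates. Each summand is a polynomial of degree
`0`, which is read off by its constant coefficient. -/
def trace {k : ℕ} {ι : Type*} [Fintype ι] [DecidableEq ι] (A : HTensor k ι) (d : ℕ) : ℝ :=
  ((k : ℝ) - 1) ^ (Fintype.card ι - 1) *
    ∑ c ∈ Finset.piAntidiag (Finset.univ : Finset ι) d,
      MvPolynomial.constantCoeff
        ((Finset.univ.noncommProd
            (fun i => (1 / ((c i * (k - 1)).factorial : ℝ)) • rowOp A i ^ c i)
            (fun i _ j _ _ => (((commute_rowOp A i j).pow_pow _ _).smul_left _).smul_right _))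
          (Matrix.trace (Matrix.mvPolynomialX ι ι ℝ ^ (d * (k - 1)))))

end HTensor

namespace Hypergraph

/-- Every hyperedge has exactly `k` vertices. -/
def IsUniform {U : Type*} (H : Hypergraph U) (k : ℕ) : Prop :=
  ∀ e ∈ H.edgeSet, e.encard = k

/-- The number of hyperedges that contain the vertex `v`. -/
def degree {U : Type*} (H : Hypergraph U) (v : U) : ℕ :=
  {e ∈ H.edgeSet | v ∈ e}.ncard

/-- The bipartite incidence graph: a vertex is joined to the hyperedges that contain it. -/
def incidenceGraph {U : Type*} (H : Hypergraph U) :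
    SimpleGraph (↥H.vertexSet ⊕ ↥H.edgeSet) where
  Adj
    | .inl v, .inr e => (v : U) ∈ (e : Set U)
    | .inr e, .inl v => (v : U) ∈ (e : Set U)
    | _, _ => False
  symm := ⟨by rintro (v | e) (w | f) h <;> exact h⟩
  loopless := ⟨by rintro (v | e) h <;> exact h⟩

/-- `H` is a `k`-uniform hypertree with `m` hyperedges: it is `k`-uniform, connected and without
(Berge) cycles. Walks and cycles `v₁ e₁ v₂ e₂ ⋯` of `H` are those of its incidence graph. -/
structure IsUniformHypertree {U : Type*} (H : Hypergraph U) (k m : ℕ) : Prop where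
  uniform : H.IsUniform k
  card_edges : H.edgeSet.encard = m
  isTree : H.incidenceGraph.IsTree

/-- Isomorphism of hypergraphs. -/
def IsIsomorphic {U W : Type*} (H : Hypergraph U) (K : Hypergraph W) : Prop :=
  ∃ φ : ↥H.vertexSet ≃ ↥K.vertexSet, ∀ s : Set ↥H.vertexSet,
    (Subtype.val '' s : Set U) ∈ H.edgeSet ↔ (Subtype.val '' (φ '' s) : Set W) ∈ K.edgeSet

/-- The diagonal tensor of vertex degrees, of order `k`. -/
def degreeTensor {U : Type*} (H : Hypergraph U) (k : ℕ) : HTensor k ↥H.vertexSet :=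
  open Classical in fun i β => if ∀ t, β t = i then (H.degree i : ℝ) else 0

/-- The adjacency tensor of a `k`-uniform hypergraph: the entry at `(i₁, …, iₖ)` is `1/(k-1)!` if
`{i₁, …, iₖ}` is a hyperedge and `0` otherwise. -/
def adjacencyTensor {U : Type*} (H : Hypergraph U) (k : ℕ) : HTensor k ↥H.vertexSet :=
  open Classical in fun i β =>
    if insert (i : U) (Set.range fun t => (β t : U)) ∈ H.edgeSet then 1 / ((k - 1).factorial : ℝ) else 0

/-- The tensor `𝒜_a(H) = a 𝒟(H) + (1 - a) 𝒜(H)`. -/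
def alphaTensor {U : Type*} (H : Hypergraph U) (k : ℕ) (a : ℝ) : HTensor k ↥H.vertexSet :=
  a • H.degreeTensor k + (1 - a) • H.adjacencyTensor k

/-- The `d`-th order spectral moment `Tr_d(𝒜_a(H))` of a finite `k`-uniform hypergraph. -/
def alphaMoment {U : Type*} [Finite U] (H : Hypergraph U) (k : ℕ) (a : ℝ) (d : ℕ) : ℝ :=
  open Classical in
  letI : Fintype ↥H.vertexSet := Fintype.ofFinite _
  (H.alphaTensor k a).trace d

/-- `H ≺_a K`: the two `k`-uniform hypergraphs have the same number `n` of vertices, and for some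
`1 ≤ d ≤ n(k-1)^{n-1} - 1` their moments agree below order `d` and that of `H` is smaller at
order `d`. -/
def AlphaLT {U W : Type*} [Finite U] [Finite W] (k : ℕ) (a : ℝ)
    (H : Hypergraph U) (K : Hypergraph W) : Prop :=
  H.vertexSet.ncard = K.vertexSet.ncard ∧
    ∃ d : ℕ, 1 ≤ d ∧ d ≤ H.vertexSet.ncard * (k - 1) ^ (H.vertexSet.ncard - 1) - 1 ∧
      (∀ t < d, H.alphaMoment k a t = K.alphaMoment k a t) ∧
      H.alphaMoment k a d < K.alphaMoment k a d

/-- `H =_a K`: the two `k`-uniform hypergraphs have the same number `n` of vertices and the same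
moments of orders `0, 1, …, n(k-1)^{n-1} - 1`. -/
def AlphaEq {U W : Type*} [Finite U] [Finite W] (k : ℕ) (a : ℝ)
    (H : Hypergraph U) (K : Hypergraph W) : Prop :=
  H.vertexSet.ncard = K.vertexSet.ncard ∧
    ∀ t < H.vertexSet.ncard * (k - 1) ^ (H.vertexSet.ncard - 1),
      H.alphaMoment k a t = K.alphaMoment k a t

/-- `H ⪯_a K`. -/
def AlphaLE {U W : Type*} [Finite U] [Finite W] (k : ℕ) (a : ℝ)
    (H : Hypergraph U) (K : Hypergraph W) : Prop :=
  AlphaLT k a H K ∨ AlphaEq k a H K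

/-- The `i`-th hyperedge (counted from `0`) of the `k`-uniform hyperpath with `m` hyperedges: the
`i`-th edge of the path on the vertices `0, …, m`, enlarged by `k - 2` new vertices. -/
def hyperpathEdge (k m : ℕ) (i : Fin m) : Set (Fin (m + 1) ⊕ Fin m × Fin (k - 2)) :=
  {Sum.inl i.castSucc, Sum.inl i.succ} ∪ Set.range fun j => Sum.inr (i, j)

/-- The `k`-uniform hyperpath with `m` hyperedges (`k ≥ 2`). -/
def hyperpath (k m : ℕ) : Hypergraph (Fin (m + 1) ⊕ Fin m × Fin (k - 2)) where
  vertexSet := Set.univ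
  edgeSet := Set.range (hyperpathEdge k m)
  subset_vertexSet_of_mem_edgeSet' := fun e _ => Set.subset_univ e

/-- The hypergraph obtained from `H` by attaching a pendant hyperedge at the vertex `v`: the new
hyperedge consists of `v` and `k - 1` new vertices. -/
def attachPendant {U : Type*} (k : ℕ) (H : Hypergraph U) (v : U) (hv : v ∈ H.vertexSet) :
    Hypergraph (U ⊕ Fin (k - 1)) where
  vertexSet := Sum.inl '' H.vertexSet ∪ Set.range Sum.inr
  edgeSet := insert (insert (Sum.inl v) (Set.range Sum.inr)) (Set.image Sum.inl '' H.edgeSet)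
  subset_vertexSet_of_mem_edgeSet' := by
    rintro e (rfl | ⟨f, hf, rfl⟩)
    · exact Set.insert_subset (Or.inl ⟨v, hv, rfl⟩) Set.subset_union_right
    · exact (Set.image_mono (H.subset_vertexSet_of_mem_edgeSet hf)).trans Set.subset_union_left

/-- The hypertree `F_{m,k}`: the hyperpath with `m - 1` hyperedges and a pendant hyperedge attached
at a cored vertex (a vertex of degree one) of its second hyperedge. -/
def hypertreeF (k m : ℕ) (hk : 3 ≤ k) (hm : 4 ≤ m) :
    Hypergraph ((Fin (m - 1 + 1) ⊕ Fin (m - 1) × Fin (k - 2)) ⊕ Fin (k - 1)) :=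
  attachPendant k (hyperpath k (m - 1)) (Sum.inr (⟨1, by omega⟩, ⟨0, by omega⟩)) (Set.mem_univ _)

end Hypergraph

end

/-! Expansion of the traces. On polynomials there is a pairing for which `pderiv` and multiplication
by a variable are adjoint. Moving all differential operators across it turns `Tr_d` into a sum over
families of `d` generators (`trace_eq_sum_configTerm`). A generator is a vertex `i` together with
its loop (weight `a` times the degree of `i`, giving `k - 1` arcs `i → i`) or with a hyperedge
through `i` (weight `1 - a`, giving the arcs from `i` to the other vertices of the hyperedge). The
coefficient of a family is a positive multiple of the number of closed walks with exactly these
arcs, so it is nonnegative.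

Localization. In a closed walk every vertex has as many outgoing as incoming arcs. Since the
incidence graph of a hypertree is acyclic, this forces each hyperedge to be used equally often from
each of its `k` vertices (`sum_eq_mul_of_configTerm_ne_zero`). An occurring hyperedge thus costs at
least `k` generators, and below order `3k` only single vertices, single hyperedges and pairs of
adjacent hyperedges contribute (`sum_configTerm_eq`).

Three comparisons. At order `2` the moment is a multiple of the sum of the squared degrees. The
number of vertices and the sum of the degrees are fixed, so a vertex of degree at least three makes
the moment larger than for maximum degree two. Now let all degrees be at most two. The vertices then
contribute a constant, and a hyperedge contributes a function of its number `δ` of vertices of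
degree two. A second difference of this function is a mixed difference in two loop weights; it sees
only families with a loop at both chosen vertices, hence vanishes below order `k + 2` and is
positive at order `k + 2` (`mixedDiff_eq_zero`, `mixedDiff_pos`). As the sum of the `δ` is fixed,
the moment of order `k + 2` grows with the excess, the sum of the `max(δ - 2, 0)`, as soon as one of
the two excesses is at most one. Excess `0` means that the line graph is a path. Excess `1` means
that one central hyperedge has `δ = 3` and no other exceeds `2`. There the first difference comes
from adjacent pairs: their contribution is additive below order `2k + 2` and strictly supermodular
in `(δ, δ')` at this order, so the moment decreases with the number of leaves adjacent to the
central hyperedge. `F` has at least two such leaves, and two of them force the line graph of `F`.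

Rigidity. A hypertree with degrees at most two is determined by its line graph
(`exists_vertex_equiv`), so the extremal cases are isomorphic to the hyperpath and to `F`. -/

set_option linter.unusedSectionVars false

/-! ### Traces as a pairing of polynomials -/

namespace HTensor

open MvPolynomial

/-- The product of the factorials of the exponents of a monomial. -/
noncomputable def expFactorial {σ : Type*} (s : σ →₀ ℕ) : ℝ := s.prod fun _ m => (m.factorial : ℝ)

theorem expFactorial_pos {σ : Type*} (s : σ →₀ ℕ) : 0 < expFactorial s :=
  Finset.prod_pos fun _ _ => by positivity

theorem expFactorial_add_single {σ : Type*} (s : σ →₀ ℕ) (p : σ) :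
    expFactorial (s + Finsupp.single p 1) = (s p + 1) * expFactorial s := by
  classical
  have h : ∀ u : σ →₀ ℕ, u.support ⊆ insert p s.support →
      expFactorial u = ∏ q ∈ insert p s.support, ((u q).factorial : ℝ) := fun u hu =>
    Finsupp.prod_of_support_subset _ hu _ (by simp)
  rw [h s (Finset.subset_insert _ _), h _ (by
    refine Finsupp.support_add.trans ?_
    refine Finset.union_subset (Finset.subset_insert _ _) ?_
    exact Finsupp.support_single_subset.trans (by simp))]
  rw [← Finset.mul_prod_erase _ _ (Finset.mem_insert_self p _),
    ← Finset.mul_prod_erase (insert p s.support) (fun q => ((s q).factorial : ℝ))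
      (Finset.mem_insert_self p _), ← mul_assoc]
  congr 1
  · simp [Nat.factorial_succ]
  · refine Finset.prod_congr rfl fun q hq => ?_
    simp [(Finset.ne_of_mem_erase hq).symm]

/-- The pairing of polynomials for which multiplication by a variable is adjoint to the partial
derivative by this variable. -/
noncomputable def diffPairing {σ : Type*} (Q : MvPolynomial σ ℝ) : MvPolynomial σ ℝ →ₗ[ℝ] ℝ :=
  (MvPolynomial.basisMonomials σ ℝ).constr ℝ fun s => expFactorial s * coeff s Q

theorem diffPairing_monomial {σ : Type*} (Q : MvPolynomial σ ℝ) (s : σ →₀ ℕ) (c : ℝ) :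
    diffPairing Q (monomial s c) = c * (expFactorial s * coeff s Q) := by
  have h : monomial s c = c • (MvPolynomial.basisMonomials σ ℝ) s := by
    simp [MvPolynomial.smul_monomial]
  rw [h, map_smul, diffPairing, Module.Basis.constr_basis, smul_eq_mul]

theorem diffPairing_one {σ : Type*} (Q : MvPolynomial σ ℝ) :
    diffPairing Q 1 = constantCoeff Q := by
  rw [← C_1, C_apply, diffPairing_monomial]
  simp [expFactorial, constantCoeff_eq]

/-- The factor produced by differentiating a monomial is the one by which the product of the
exponent factorials grows. -/
theorem diffPairing_pderiv {σ : Type*} (Q P : MvPolynomial σ ℝ) (p : σ) :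
    diffPairing (pderiv p Q) P = diffPairing Q (P * X p) := by
  induction P using MvPolynomial.induction_on' with
  | monomial s c =>
    rw [X, monomial_mul, diffPairing_monomial, diffPairing_monomial, coeff_pderiv,
      expFactorial_add_single]
    ring
  | add P P' h h' => rw [map_add, add_mul, map_add, h, h']

/-- The operator `D` is the adjoint of the multiplication by `P`. -/
def IsAdjoint {σ : Type*} (D : Module.End ℝ (MvPolynomial σ ℝ)) (P : MvPolynomial σ ℝ) : Prop :=
  ∀ Q P', diffPairing (D Q) P' = diffPairing Q (P' * P)

theorem diffPairing_add_left {σ : Type*} (Q Q' P : MvPolynomial σ ℝ) :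
    diffPairing (Q + Q') P = diffPairing Q P + diffPairing Q' P := by
  induction P using MvPolynomial.induction_on' with
  | monomial s c => simp only [diffPairing_monomial, coeff_add]; ring
  | add P P' h h' => rw [map_add, map_add, map_add, h, h']; ring

theorem diffPairing_smul_left {σ : Type*} (c : ℝ) (Q P : MvPolynomial σ ℝ) :
    diffPairing (c • Q) P = c * diffPairing Q P := by
  induction P using MvPolynomial.induction_on' with
  | monomial s c => simp only [diffPairing_monomial, coeff_smul, smul_eq_mul]; ring
  | add P P' h h' => rw [map_add, map_add, h, h']; ring

namespace IsAdjoint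

variable {σ : Type*} {D D' : Module.End ℝ (MvPolynomial σ ℝ)} {P P' : MvPolynomial σ ℝ}

theorem one : IsAdjoint (1 : Module.End ℝ (MvPolynomial σ ℝ)) 1 := fun Q P' => by simp

theorem mul (h : IsAdjoint D P) (h' : IsAdjoint D' P') : IsAdjoint (D * D') (P * P') :=
  fun Q R => by rw [Module.End.mul_apply, h, h', mul_assoc]

theorem smul (c : ℝ) (h : IsAdjoint D P) : IsAdjoint (c • D) (c • P) :=
  fun Q R => by
    rw [LinearMap.smul_apply, diffPairing_smul_left, h, mul_smul_comm, map_smul, smul_eq_mul]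

theorem add (h : IsAdjoint D P) (h' : IsAdjoint D' P') : IsAdjoint (D + D') (P + P') :=
  fun Q R => by
    rw [LinearMap.add_apply, diffPairing_add_left, h, h', mul_add, map_add]

theorem zero : IsAdjoint (0 : Module.End ℝ (MvPolynomial σ ℝ)) 0 := fun Q P' => by
  have := diffPairing_smul_left 0 (0 : MvPolynomial σ ℝ) P'
  simpa using this

theorem pow (h : IsAdjoint D P) (n : ℕ) : IsAdjoint (D ^ n) (P ^ n) := by
  induction n with
  | zero => simpa using one
  | succ n ih => rw [pow_succ, pow_succ]; exact ih.mul h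

theorem sum {κ : Type*} (s : Finset κ) {D : κ → Module.End ℝ (MvPolynomial σ ℝ)}
    {P : κ → MvPolynomial σ ℝ} (h : ∀ i ∈ s, IsAdjoint (D i) (P i)) :
    IsAdjoint (∑ i ∈ s, D i) (∑ i ∈ s, P i) := by
  classical
  induction s using Finset.induction_on with
  | empty => simpa using zero
  | insert i s hi ih =>
    rw [Finset.sum_insert hi, Finset.sum_insert hi]
    exact (h i (Finset.mem_insert_self _ _)).add
      (ih fun j hj => h j (Finset.mem_insert_of_mem hj))

theorem noncommProd {κ : Type*} (s : Finset κ) {D : κ → Module.End ℝ (MvPolynomial σ ℝ)}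
    {P : κ → MvPolynomial σ ℝ} (comm) (h : ∀ i ∈ s, IsAdjoint (D i) (P i)) :
    IsAdjoint (s.noncommProd D comm) (∏ i ∈ s, P i) := by
  classical
  induction s using Finset.induction_on with
  | empty => simpa using one
  | insert i s hi ih =>
    rw [Finset.noncommProd_insert_of_notMem _ _ _ _ hi, Finset.prod_insert hi]
    exact (h i (Finset.mem_insert_self _ _)).mul
      (ih _ fun j hj => h j (Finset.mem_insert_of_mem hj))

theorem listProd (l : List (Module.End ℝ (MvPolynomial σ ℝ) × MvPolynomial σ ℝ))
    (h : ∀ x ∈ l, IsAdjoint x.1 x.2) :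
    IsAdjoint (l.map Prod.fst).prod (l.map Prod.snd).prod := by
  induction l with
  | nil => simpa using one
  | cons x l ih =>
    simp only [List.map_cons, List.prod_cons]
    exact (h x (by simp)).mul (ih fun y hy => h y (by simp [hy]))

end IsAdjoint

/-- The polynomial `∑_β A_{iβ} x_{iβ}` of a row of a tensor. -/
noncomputable def rowPoly {k : ℕ} {ι : Type*} [Fintype ι] (A : HTensor k ι) (i : ι) :
    MvPolynomial (ι × ι) ℝ :=
  ∑ β : Fin (k - 1) → ι, A i β • ∏ t, X (i, β t)

theorem isAdjoint_rowOp {k : ℕ} {ι : Type*} [Fintype ι] (A : HTensor k ι) (i : ι) :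
    IsAdjoint (rowOp A i) (rowPoly A i) := by
  refine IsAdjoint.sum _ fun β _ => IsAdjoint.smul _ ?_
  have := IsAdjoint.listProd
    (List.ofFn fun t => (partialOp (i, β t), (X (i, β t) : MvPolynomial (ι × ι) ℝ))) (by
      intro x hx
      obtain ⟨t, rfl⟩ := (List.mem_ofFn' _ _).mp hx
      exact fun Q P' => diffPairing_pderiv Q P' _)
  rw [List.map_ofFn, List.map_ofFn, List.prod_ofFn (f := Prod.snd ∘ _)] at this
  exact this

/-- A constant coefficient is the pairing with `1`. By adjointness the operators become a product of
row polynomials in the other argument, and differentiation disappears. -/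
theorem trace_eq_sum_diffPairing {k : ℕ} {ι : Type*} [Fintype ι] [DecidableEq ι]
    (A : HTensor k ι) (d : ℕ) :
    A.trace d = ((k : ℝ) - 1) ^ (Fintype.card ι - 1) *
      ∑ c ∈ Finset.piAntidiag (Finset.univ : Finset ι) d,
        diffPairing (Matrix.trace (Matrix.mvPolynomialX ι ι ℝ ^ (d * (k - 1))))
          (∏ i, (1 / ((c i * (k - 1)).factorial : ℝ)) • rowPoly A i ^ c i) := by
  rw [trace]
  congr 1
  refine Finset.sum_congr rfl fun c _ => ?_
  rw [← diffPairing_one]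
  refine (IsAdjoint.noncommProd _ _
    (fun i _ => ((isAdjoint_rowOp A i).pow (c i)).smul _) _ _).trans ?_
  rw [one_mul]

end HTensor

/-! ### Euler trails and the counting of closed walks -/

section

open MvPolynomial

/-- `EulerTrail μ i j`: some walk from `i` to `j` traverses every arc `p` exactly `μ p` times. -/
inductive EulerTrail {ι : Type*} (i : ι) : (ι × ι →₀ ℕ) → ι → Prop
  | nil : EulerTrail i 0 i
  | snoc {μ : ι × ι →₀ ℕ} {l : ι} (j : ι) (h : EulerTrail i μ l) :
      EulerTrail i (μ + Finsupp.single (l, j) 1) j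

namespace EulerTrail

variable {ι : Type*} {i j l : ι} {μ ν : ι × ι →₀ ℕ}

theorem arc (i j : ι) : EulerTrail i (Finsupp.single (i, j) 1) j := by
  simpa using EulerTrail.snoc j (EulerTrail.nil (i := i))

theorem trans (h : EulerTrail i μ j) (h' : EulerTrail j ν l) : EulerTrail i (μ + ν) l := by
  induction h' with
  | nil => simpa using h
  | snoc l' _ ih => rw [← add_assoc]; exact ih.snoc l'

theorem loops (i : ι) (n : ℕ) : EulerTrail i (Finsupp.single (i, i) n) i := by
  induction n with
  | zero => simpa using EulerTrail.nil (i := i)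
  | succ n ih => rw [Finsupp.single_add]; exact ih.snoc i

/-- A closed walk is spliced in at a visit of `w`; `w` is visited because it is the start or the
tail of an arc. If `w` becomes visited only by the last arc, the splice goes right before this arc.
-/
theorem insert_closed {w : ι} (h : EulerTrail i μ j) (hw : w = i ∨ ∃ u, μ (w, u) ≠ 0)
    (h' : EulerTrail w ν w) : EulerTrail i (μ + ν) j := by
  classical
  induction h with
  | nil =>
    obtain rfl : w = i := by simpa using hw
    simpa using h'
  | @snoc μ l j h ih =>
    rw [add_right_comm]
    by_cases hw' : w = i ∨ ∃ u, μ (w, u) ≠ 0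
    · exact (ih hw').snoc j
    · push Not at hw'
      obtain ⟨u, hu⟩ := hw.resolve_left hw'.1
      rw [Finsupp.add_apply, hw'.2 u, zero_add, Finsupp.single_apply] at hu
      obtain ⟨rfl, rfl⟩ : l = w ∧ j = u := by simpa using hu
      exact (h.trans h').snoc j

theorem insert_closed_sum {κ : Type*} (s : Finset κ) (w : κ → ι) (ν : κ → ι × ι →₀ ℕ)
    (h : EulerTrail i μ j) (hw : ∀ c ∈ s, w c = i ∨ ∃ u, μ (w c, u) ≠ 0)
    (h' : ∀ c ∈ s, EulerTrail (w c) (ν c) (w c)) : EulerTrail i (μ + ∑ c ∈ s, ν c) j := by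
  classical
  induction s using Finset.induction_on with
  | empty => simpa using h
  | insert c s hc ih =>
    rw [Finset.sum_insert hc, add_comm (ν c), ← add_assoc]
    refine insert_closed (ih (fun a ha => hw a (Finset.mem_insert_of_mem ha))
      (fun a ha => h' a (Finset.mem_insert_of_mem ha))) ?_ (h' c (Finset.mem_insert_self _ _))
    refine (hw c (Finset.mem_insert_self _ _)).imp_right fun ⟨u, hu⟩ => ⟨u, ?_⟩
    rw [Finsupp.add_apply]
    omega

theorem balanced [Fintype ι] [DecidableEq ι] (h : EulerTrail i μ j) (v : ι) :
    ∑ u, μ (v, u) + (if v = j then 1 else 0) = ∑ u, μ (u, v) + (if v = i then 1 else 0) := by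
  induction h with
  | nil => simp
  | @snoc μ l j h ih =>
    have h1 : ∑ u, (Finsupp.single (l, j) 1 : ι × ι →₀ ℕ) (v, u) = if v = l then 1 else 0 := by
      simp only [Finsupp.single_apply, Prod.mk.injEq, eq_comm (a := l)]
      split_ifs with h <;> simp [h]
    have h2 : ∑ u, (Finsupp.single (l, j) 1 : ι × ι →₀ ℕ) (u, v) = if v = j then 1 else 0 := by
      simp only [Finsupp.single_apply, Prod.mk.injEq, eq_comm (a := j)]
      split_ifs with h <;> simp [h]
    simp only [Finsupp.add_apply, Finset.sum_add_distrib, h1, h2]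
    omega

/-- If no arc crosses the boundary of `S`, the walk stays on the side where it starts. -/
theorem mem_iff_mem {S : Set ι} (h : EulerTrail i μ j)
    (hS : ∀ p, μ p ≠ 0 → (p.1 ∈ S ↔ p.2 ∈ S)) :
    (j ∈ S ↔ i ∈ S) ∧ ∀ p, μ p ≠ 0 → (p.1 ∈ S ↔ i ∈ S) := by
  classical
  induction h with
  | nil => simp
  | @snoc μ l j h ih =>
    obtain ⟨h1, h2⟩ := ih fun p hp => hS p (by rw [Finsupp.add_apply]; omega)
    have h3 : l ∈ S ↔ j ∈ S := hS (l, j) (by simp)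
    refine ⟨h3.symm.trans h1, fun p hp => ?_⟩
    by_cases hp' : μ p = 0
    · rw [Finsupp.add_apply, hp', zero_add, Finsupp.single_apply] at hp
      obtain rfl : (l, j) = p := by simpa using hp
      exact h1
    · exact h2 p hp'

theorem exists_start (h : EulerTrail i μ j) (hμ : μ ≠ 0) : ∃ u, μ (i, u) ≠ 0 := by
  classical
  suffices (μ = 0 ∧ j = i) ∨ ∃ u, μ (i, u) ≠ 0 from this.resolve_left fun h => hμ h.1
  clear hμ
  induction h with
  | nil => exact Or.inl ⟨rfl, rfl⟩
  | @snoc μ l j h ih =>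
    rcases ih with ⟨rfl, rfl⟩ | ⟨u, hu⟩
    · exact Or.inr ⟨j, by simp⟩
    · exact Or.inr ⟨u, by rw [Finsupp.add_apply]; omega⟩

end EulerTrail

/-- Every arc between two different elements of `s`, once. -/
noncomputable def completeArcs {ι : Type*} [DecidableEq ι] (s : Finset ι) : ι × ι →₀ ℕ :=
  ∑ i ∈ s, ∑ j ∈ s.erase i, Finsupp.single (i, j) 1

theorem completeArcs_insert {ι : Type*} [DecidableEq ι] {s : Finset ι} {v : ι} (hv : v ∉ s) :
    completeArcs (insert v s) = completeArcs s +
      ∑ j ∈ s, (Finsupp.single (j, v) 1 + Finsupp.single (v, j) 1) := by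
  have h : ∀ i ∈ s, ∑ j ∈ (insert v s).erase i, Finsupp.single (i, j) 1 =
      ∑ j ∈ s.erase i, Finsupp.single (i, j) 1 + (Finsupp.single (i, v) 1 : ι × ι →₀ ℕ) := by
    intro i hi
    have hne : v ≠ i := fun h => hv (h ▸ hi)
    rw [Finset.erase_insert_of_ne hne, Finset.sum_insert (by simp [hv]), add_comm]
  rw [completeArcs, Finset.sum_insert hv, Finset.erase_insert hv, Finset.sum_congr rfl h,
    Finset.sum_add_distrib, Finset.sum_add_distrib, completeArcs]
  abel

theorem completeArcs_apply_ne_zero {ι : Type*} [DecidableEq ι] {s : Finset ι} {i j : ι}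
    (hi : i ∈ s) (hj : j ∈ s) (hij : i ≠ j) : completeArcs s (i, j) ≠ 0 := by
  rw [completeArcs, Finsupp.finsetSum_apply]
  refine (Finset.sum_pos' (fun _ _ => Nat.zero_le _) ⟨i, hi, ?_⟩).ne'
  rw [Finsupp.finsetSum_apply]
  exact Finset.sum_pos' (fun _ _ => Nat.zero_le _) ⟨j, by simp [hj, hij.symm], by simp⟩

/-- Induction on the set. A new vertex `v` is reached by detours `j → v → j` spliced in at each old
`j`. If the trail has to start at the new vertex, one such detour is opened up to enclose the old
trail, and the others are spliced in at the start. -/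
theorem eulerTrail_completeArcs {ι : Type*} [DecidableEq ι] {s : Finset ι} {r : ι} (hr : r ∈ s) :
    EulerTrail r (completeArcs s) r := by
  induction s using Finset.induction_on generalizing r with
  | empty => simp at hr
  | insert v s hv ih =>
    have key : ∀ r ∈ s, EulerTrail r (completeArcs (insert v s)) r := fun r hr => by
      rw [completeArcs_insert hv]
      refine EulerTrail.insert_closed_sum s (fun j => j) _ (ih hr) (fun c hc => ?_)
        fun c _ => (EulerTrail.arc c v).trans (EulerTrail.arc v c)
      by_cases h : c = r
      · exact Or.inl h
      · exact Or.inr ⟨r, completeArcs_apply_ne_zero hc hr h⟩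
    rcases Finset.mem_insert.mp hr with rfl | hr
    · rcases s.eq_empty_or_nonempty with rfl | ⟨t, ht⟩
      · simpa [completeArcs] using EulerTrail.nil (i := r)
      · rw [completeArcs_insert hv, ← Finset.add_sum_erase s _ ht]
        have h1 := ((EulerTrail.arc r t).trans (ih ht)).trans (EulerTrail.arc t r)
        have h2 := EulerTrail.insert_closed_sum (s.erase t) (fun _ => r)
          (fun j => Finsupp.single (j, r) 1 + Finsupp.single (r, j) 1) h1 (fun _ _ => Or.inl rfl)
          (fun c _ => by rw [add_comm]; exact (EulerTrail.arc r c).trans (EulerTrail.arc c r))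
        convert h2 using 1
        abel
    · exact key r hr

/-- The number of walks of length `N` from `i` to `j` that traverse every arc `p` exactly `μ p`
times. -/
noncomputable def walkCoeff {ι : Type*} [Fintype ι] [DecidableEq ι] (N : ℕ) (i j : ι)
    (μ : ι × ι →₀ ℕ) : ℝ :=
  coeff μ ((Matrix.mvPolynomialX ι ι ℝ ^ N) i j)

section walkCoeff

variable {ι : Type*} [Fintype ι] [DecidableEq ι]

theorem walkCoeff_zero (i j : ι) (μ : ι × ι →₀ ℕ) :
    walkCoeff 0 i j μ = if i = j ∧ μ = 0 then 1 else 0 := by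
  rw [walkCoeff, pow_zero, Matrix.one_apply]
  by_cases h : i = j
  · simp [h, coeff_one, eq_comm]
  · simp [h]

theorem walkCoeff_succ (N : ℕ) (i j : ι) (μ : ι × ι →₀ ℕ) :
    walkCoeff (N + 1) i j μ = ∑ l, if (l, j) ∈ μ.support then
      walkCoeff N i l (μ - Finsupp.single (l, j) 1) else 0 := by
  rw [walkCoeff, pow_succ, Matrix.mul_apply, coeff_sum]
  refine Finset.sum_congr rfl fun l _ => ?_
  rw [Matrix.mvPolynomialX_apply, coeff_mul_X']
  rfl

theorem walkCoeff_nonneg (N : ℕ) (i j : ι) (μ : ι × ι →₀ ℕ) : 0 ≤ walkCoeff N i j μ := by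
  induction N generalizing j μ with
  | zero => rw [walkCoeff_zero]; split_ifs <;> norm_num
  | succ N ih =>
    rw [walkCoeff_succ]
    refine Finset.sum_nonneg fun l _ => ?_
    split_ifs
    · exact ih _ _
    · exact le_rfl

theorem eulerTrail_of_walkCoeff_ne_zero {N : ℕ} {i j : ι} {μ : ι × ι →₀ ℕ}
    (h : walkCoeff N i j μ ≠ 0) : EulerTrail i μ j ∧ μ.degree = N := by
  induction N generalizing j μ with
  | zero =>
    rw [walkCoeff_zero] at h
    obtain ⟨rfl, rfl⟩ : i = j ∧ μ = 0 := by simpa using h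
    exact ⟨EulerTrail.nil, by simp⟩
  | succ N ih =>
    rw [walkCoeff_succ] at h
    obtain ⟨l, -, hl⟩ := Finset.exists_ne_zero_of_sum_ne_zero h
    obtain ⟨h1, h2⟩ : (l, j) ∈ μ.support ∧ walkCoeff N i l (μ - Finsupp.single (l, j) 1) ≠ 0 := by
      simpa only [ne_eq, ite_eq_right_iff, Classical.not_imp] using hl
    obtain ⟨h3, h4⟩ := ih h2
    have h5 : μ - Finsupp.single (l, j) 1 + Finsupp.single (l, j) 1 = μ :=
      tsub_add_cancel_of_le (by
        rw [Finsupp.single_le_iff]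
        exact Nat.one_le_iff_ne_zero.mpr (Finsupp.mem_support_iff.mp h1))
    refine ⟨h5 ▸ h3.snoc j, ?_⟩
    rw [← h5, map_add, h4, Finsupp.degree_single]

theorem walkCoeff_pos {i j : ι} {μ : ι × ι →₀ ℕ} (h : EulerTrail i μ j) :
    0 < walkCoeff μ.degree i j μ := by
  induction h with
  | nil => rw [map_zero, walkCoeff_zero]; simp
  | @snoc μ l j h ih =>
    rw [map_add, Finsupp.degree_single, walkCoeff_succ]
    refine Finset.sum_pos' (fun l' _ => ?_) ⟨l, Finset.mem_univ _, ?_⟩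
    · split_ifs
      · exact walkCoeff_nonneg _ _ _ _
      · exact le_rfl
    · rw [if_pos (by simp), add_tsub_cancel_right]
      exact ih

/-- All prescribed arcs lie in the image of `f`, so a walk realizing them never uses a vertex
outside this image. -/
theorem walkCoeff_mapDomain {κ : Type*} [Fintype κ] [DecidableEq κ] {f : ι → κ}
    (hf : Function.Injective f) (N : ℕ) (i j : ι) (μ : ι × ι →₀ ℕ) :
    walkCoeff N (f i) (f j) (μ.mapDomain (Prod.map f f)) = walkCoeff N i j μ := by
  have hff : Function.Injective (Prod.map f f) := hf.prodMap hf
  induction N generalizing j μ with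
  | zero =>
    rw [walkCoeff_zero, walkCoeff_zero]
    refine if_congr (and_congr hf.eq_iff ?_) rfl rfl
    rw [← Finsupp.mapDomain_zero (f := Prod.map f f), (Finsupp.mapDomain_injective hff).eq_iff]
  | succ N ih =>
    rw [walkCoeff_succ, walkCoeff_succ]
    symm
    refine Fintype.sum_of_injective f hf _ _ (fun l hl => ?_) fun l => ?_
    · rw [if_neg]
      rw [Finsupp.mem_support_iff, not_not]
      refine Finsupp.mapDomain_of_notMem_range _ _ ?_
      rintro ⟨⟨a, b⟩, hab⟩
      exact hl ⟨a, congrArg Prod.fst hab⟩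
    · have h1 : (f l, f j) = Prod.map f f (l, j) := rfl
      have h3 : (l, j) ∈ μ.support ↔ (f l, f j) ∈ (μ.mapDomain (Prod.map f f)).support := by
        rw [Finsupp.mem_support_iff, Finsupp.mem_support_iff, h1, Finsupp.mapDomain_apply hff]
      by_cases h : (l, j) ∈ μ.support
      · rw [if_pos h, if_pos (h3.mp h), ← ih]
        congr 1
        rw [Finsupp.mem_support_iff] at h
        have h2 : μ - Finsupp.single (l, j) 1 + Finsupp.single (l, j) 1 = μ :=
          tsub_add_cancel_of_le (by
            rw [Finsupp.single_le_iff]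
            exact Nat.one_le_iff_ne_zero.mpr h)
        conv_rhs => rw [← h2]
        rw [Finsupp.mapDomain_add, Finsupp.mapDomain_single, h1, add_tsub_cancel_right]
      · rw [if_neg h, if_neg (mt h3.mpr h)]

/-- The number of closed walks of length `N` that traverse every arc `p` exactly `μ p` times. -/
noncomputable def closedCoeff (N : ℕ) (μ : ι × ι →₀ ℕ) : ℝ :=
  coeff μ (Matrix.trace (Matrix.mvPolynomialX ι ι ℝ ^ N))

theorem closedCoeff_eq_sum (N : ℕ) (μ : ι × ι →₀ ℕ) :
    closedCoeff N μ = ∑ i, walkCoeff N i i μ := by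
  rw [closedCoeff, Matrix.trace, coeff_sum]
  rfl

theorem closedCoeff_nonneg (N : ℕ) (μ : ι × ι →₀ ℕ) : 0 ≤ closedCoeff N μ := by
  rw [closedCoeff_eq_sum]
  exact Finset.sum_nonneg fun i _ => walkCoeff_nonneg _ _ _ _

theorem closedCoeff_pos {i : ι} {μ : ι × ι →₀ ℕ} {N : ℕ} (h : EulerTrail i μ i)
    (hN : μ.degree = N) : 0 < closedCoeff N μ := by
  rw [closedCoeff_eq_sum]
  exact Finset.sum_pos' (fun i _ => walkCoeff_nonneg _ _ _ _)
    ⟨i, Finset.mem_univ _, hN ▸ walkCoeff_pos h⟩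

theorem exists_eulerTrail {N : ℕ} {μ : ι × ι →₀ ℕ} (h : closedCoeff N μ ≠ 0) :
    ∃ i, EulerTrail i μ i := by
  rw [closedCoeff_eq_sum] at h
  obtain ⟨i, -, hi⟩ := Finset.exists_ne_zero_of_sum_ne_zero h
  exact ⟨i, (eulerTrail_of_walkCoeff_ne_zero hi).1⟩

theorem sum_out_eq_sum_in {N : ℕ} {μ : ι × ι →₀ ℕ} (h : closedCoeff N μ ≠ 0) (v : ι) :
    ∑ u, μ (v, u) = ∑ u, μ (u, v) := by
  obtain ⟨i, hi⟩ := exists_eulerTrail h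
  have := hi.balanced v
  omega

theorem mem_iff_mem_of_closedCoeff_ne_zero {N : ℕ} {μ : ι × ι →₀ ℕ} (h : closedCoeff N μ ≠ 0)
    {S : Set ι} (hS : ∀ p, μ p ≠ 0 → (p.1 ∈ S ↔ p.2 ∈ S)) {p q : ι × ι} (hp : μ p ≠ 0)
    (hq : μ q ≠ 0) : p.1 ∈ S ↔ q.1 ∈ S := by
  obtain ⟨i, hi⟩ := exists_eulerTrail h
  rw [(hi.mem_iff_mem hS).2 p hp, (hi.mem_iff_mem hS).2 q hq]

/-- For `N = 0` the coefficient at `μ = 0` counts all vertices and is not invariant. For `N ≠ 0` a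
closed walk leaves its starting vertex along a prescribed arc, so it starts in the image. -/
theorem closedCoeff_mapDomain {κ : Type*} [Fintype κ] [DecidableEq κ] {f : ι → κ}
    (hf : Function.Injective f) {N : ℕ} (hN : N ≠ 0) (μ : ι × ι →₀ ℕ) :
    closedCoeff N (μ.mapDomain (Prod.map f f)) = closedCoeff N μ := by
  rw [closedCoeff_eq_sum, closedCoeff_eq_sum]
  symm
  refine Fintype.sum_of_injective f hf _ _ (fun i hi => ?_)
    fun i => (walkCoeff_mapDomain hf N i i μ).symm
  by_contra h
  obtain ⟨h1, h2⟩ := eulerTrail_of_walkCoeff_ne_zero h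
  obtain ⟨u, hu⟩ := h1.exists_start (by rintro h0; rw [h0] at h2; simp at h2; exact hN h2.symm)
  refine hu (Finsupp.mapDomain_of_notMem_range _ _ ?_)
  rintro ⟨⟨a, b⟩, hab⟩
  exact hi ⟨a, congrArg Prod.fst hab⟩

end walkCoeff

end

/-! ### Expansion of the trace over families of generators -/

section

open MvPolynomial HTensor

/-- The arcs of a generator of row `i`: `k - 1` loops at `i`, or the arcs from `i` to the other
elements of an edge. -/
noncomputable def optArcs {V E : Type*} [DecidableEq V] (k : ℕ) (ed : E → Finset V) :
    V × Option E → (V × V →₀ ℕ)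
  | (i, none) => Finsupp.single (i, i) (k - 1)
  | (i, some e) => ∑ j ∈ (ed e).erase i, Finsupp.single (i, j) 1

/-- The weight of a generator of row `i`: `x i` for the loop, `y` for an edge that contains `i`. -/
noncomputable def optWeight {V E : Type*} [DecidableEq V] (ed : E → Finset V) (x : V → ℝ) (y : ℝ) :
    V × Option E → ℝ
  | (i, none) => x i
  | (i, some e) => if i ∈ ed e then y else 0

section

variable {V E : Type*} [Fintype V] [DecidableEq V] [Fintype E] [DecidableEq E]

/-- The arcs of a family of generators. -/
noncomputable def configArcs (k : ℕ) (ed : E → Finset V) (n : V × Option E → ℕ) : V × V →₀ ℕ :=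
  ∑ p, n p • optArcs k ed p

/-- The coefficient of a family of generators in the trace. -/
noncomputable def configCoeff (k : ℕ) (ed : E → Finset V) (n : V × Option E → ℕ) : ℝ :=
  (∏ i, ((∑ o, n (i, o)).factorial : ℝ) / (((∑ o, n (i, o)) * (k - 1)).factorial : ℝ)) *
    (∏ p, 1 / ((n p).factorial : ℝ)) *
      (expFactorial (configArcs k ed n) *
        closedCoeff ((∑ p, n p) * (k - 1)) (configArcs k ed n))

/-- The contribution of a family of generators to the trace. -/
noncomputable def configTerm (k : ℕ) (ed : E → Finset V) (x : V → ℝ) (y : ℝ)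
    (n : V × Option E → ℕ) : ℝ :=
  configCoeff k ed n * ∏ p, optWeight ed x y p ^ n p

end

theorem prod_monomial {σ κ : Type*} (s : Finset κ) (f : κ → σ →₀ ℕ) (g : κ → ℝ) :
    ∏ i ∈ s, monomial (f i) (g i) = monomial (∑ i ∈ s, f i) (∏ i ∈ s, g i) := by
  classical
  induction s using Finset.induction_on with
  | empty => simp
  | insert i s hi ih =>
    rw [Finset.prod_insert hi, ih, monomial_mul, Finset.sum_insert hi, Finset.prod_insert hi]

theorem sum_monomial_pow {σ κ : Type*} [Fintype κ] [DecidableEq κ] (f : κ → σ →₀ ℕ) (w : κ → ℝ)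
    (c : ℕ) : (∑ o, monomial (f o) (w o)) ^ c = ∑ m ∈ Finset.piAntidiag Finset.univ c,
      monomial (∑ o, m o • f o)
        (((c.factorial : ℝ) * ∏ o, 1 / ((m o).factorial : ℝ)) * ∏ o, w o ^ m o) := by
  rw [Finset.sum_pow_eq_sum_piAntidiag]
  refine Finset.sum_congr rfl fun m hm => ?_
  simp only [monomial_pow]
  rw [prod_monomial, ← map_natCast (C (R := ℝ) (σ := σ)), C_mul_monomial]
  congr 2
  have h := Nat.multinomial_spec Finset.univ m
  rw [(Finset.mem_piAntidiag.mp hm).1] at h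
  rw [← h]
  push_cast
  rw [mul_right_comm, ← Finset.prod_mul_distrib, Finset.prod_congr rfl (g := fun _ => (1 : ℝ))]
  · simp
  · intro o _
    field_simp

/-- The multinomial theorem expands each power of a row polynomial. The exponents `c i` in the
definition of the trace are the row sums of the family, so summing over `c` and then over the rows
runs once through all families of size `d`. -/
theorem HTensor.trace_eq_sum_configTerm {V E : Type*} [Fintype V] [DecidableEq V] [Fintype E]
    [DecidableEq E] {k : ℕ} (A : HTensor k V) (ed : E → Finset V) (x : V → ℝ) (y : ℝ)
    (hA : ∀ i, rowPoly A i = ∑ o, monomial (optArcs k ed (i, o)) (optWeight ed x y (i, o)))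
    (d : ℕ) : A.trace d = ((k : ℝ) - 1) ^ (Fintype.card V - 1) *
      ∑ n ∈ Finset.piAntidiag Finset.univ d, configTerm k ed x y n := by
  rw [trace_eq_sum_diffPairing]
  congr 1
  have hrow : ∀ c : V → ℕ, ∏ i, (1 / ((c i * (k - 1)).factorial : ℝ)) • rowPoly A i ^ c i =
      ∑ n ∈ Fintype.piFinset fun i => Finset.piAntidiag (Finset.univ : Finset (Option E)) (c i),
        monomial (configArcs k ed (Function.uncurry n))
          ((∏ i, ((∑ o, n i o).factorial : ℝ) / (((∑ o, n i o) * (k - 1)).factorial : ℝ)) *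
            (∏ p, 1 / ((Function.uncurry n p).factorial : ℝ)) *
              ∏ p, optWeight ed x y p ^ Function.uncurry n p) := by
    intro c
    simp only [hA, sum_monomial_pow, Finset.smul_sum, smul_monomial, smul_eq_mul]
    rw [Finset.prod_univ_sum]
    refine Finset.sum_congr rfl fun n hn => ?_
    rw [prod_monomial]
    congr 1
    · rw [configArcs, Fintype.sum_prod_type]
      rfl
    · rw [Fintype.prod_prod_type, Fintype.prod_prod_type, ← Finset.prod_mul_distrib,
        ← Finset.prod_mul_distrib]
      refine Finset.prod_congr rfl fun i _ => ?_
      rw [(Finset.mem_piAntidiag.mp (Fintype.mem_piFinset.mp hn i)).1]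
      simp only [Function.uncurry_apply_pair]
      ring
  simp only [hrow, map_sum, diffPairing_monomial]
  rw [Finset.sum_sigma']
  refine Finset.sum_nbij' (fun a => Function.uncurry a.2)
    (fun n => ⟨fun i => ∑ o, n (i, o), Function.curry n⟩) ?_ ?_ ?_ ?_ ?_
  · rintro ⟨c, n⟩ h
    simp only [Finset.mem_sigma, Finset.mem_piAntidiag, Fintype.mem_piFinset] at h
    simp only [Finset.mem_piAntidiag, Fintype.sum_prod_type, Function.uncurry_apply_pair]
    refine ⟨?_, by simp⟩
    rw [← h.1.1]
    exact Finset.sum_congr rfl fun i _ => (h.2 i).1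
  · intro n h
    simp only [Finset.mem_piAntidiag, Fintype.sum_prod_type] at h
    simp [-Fintype.sum_option, Finset.mem_sigma, Finset.mem_piAntidiag, Fintype.mem_piFinset, h.1]
    exact fun _ => rfl
  · rintro ⟨c, n⟩ h
    simp only [Finset.mem_sigma, Finset.mem_piAntidiag, Fintype.mem_piFinset] at h
    have hc : (fun i => ∑ o, n i o) = c := funext fun i => (h.2 i).1
    simp [-Fintype.sum_option, hc]
  · intro n _
    simp
  · rintro ⟨c, n⟩ h
    simp only [Finset.mem_sigma, Finset.mem_piAntidiag, Fintype.mem_piFinset] at h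
    have hd : ∑ p, Function.uncurry n p = d := by
      rw [Fintype.sum_prod_type, ← h.1.1]
      exact Finset.sum_congr rfl fun i _ => (h.2 i).1
    rw [configTerm, configCoeff, hd, closedCoeff]
    simp only [Function.uncurry_apply_pair]
    ring

end

/-! ### Row polynomials of the tensor of a hypergraph -/

section

open MvPolynomial HTensor

namespace Hypergraph

variable {U : Type*} [Finite U]

/-- The set of the vertices of a hyperedge, as a finset of vertices. -/
noncomputable def edgeVerts (H : Hypergraph U) (e : ↥H.edgeSet) : Finset ↥H.vertexSet :=
  (Set.toFinite {v : ↥H.vertexSet | (v : U) ∈ (e : Set U)}).toFinset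

@[simp]
theorem mem_edgeVerts {H : Hypergraph U} {e : ↥H.edgeSet} {v : ↥H.vertexSet} :
    v ∈ H.edgeVerts e ↔ (v : U) ∈ (e : Set U) := by
  simp [edgeVerts]

theorem image_edgeVerts (H : Hypergraph U) (e : ↥H.edgeSet) :
    Subtype.val '' (H.edgeVerts e : Set ↥H.vertexSet) = (e : Set U) := by
  ext u
  simp only [Set.mem_image, Finset.mem_coe, mem_edgeVerts]
  exact ⟨fun ⟨v, hv, h⟩ => h ▸ hv,
    fun hu => ⟨⟨u, H.subset_vertexSet_of_mem_edgeSet e.2 hu⟩, hu, rfl⟩⟩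

theorem edgeVerts_injective (H : Hypergraph U) : Function.Injective H.edgeVerts := by
  intro e e' h
  rw [Subtype.ext_iff, ← image_edgeVerts, h, image_edgeVerts]

theorem card_edgeVerts {H : Hypergraph U} {k : ℕ} (h : H.IsUniform k) (e : ↥H.edgeSet) :
    (H.edgeVerts e).card = k := by
  have h1 := h e e.2
  rw [← image_edgeVerts, Subtype.val_injective.encard_image, Set.encard_coe_eq_coe_finsetCard] at h1
  exact_mod_cast h1

theorem insert_range_eq_iff {H : Hypergraph U} [DecidableEq ↥H.vertexSet] {k : ℕ}
    (i : ↥H.vertexSet)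
    (β : Fin (k - 1) → ↥H.vertexSet) (e : ↥H.edgeSet) :
    insert (i : U) (Set.range fun t => (β t : U)) = e ↔
      insert i (Finset.univ.image β) = H.edgeVerts e := by
  rw [← image_edgeVerts, ← Finset.coe_inj, ← Subtype.val_injective.image_injective.eq_iff]
  rw [Finset.coe_insert, Set.image_insert_eq, Finset.coe_image, Finset.coe_univ, Set.image_univ,
    ← Set.range_comp]
  rfl

/-- The tuples that count are the `(k - 1)!` orderings of the other vertices of the hyperedge, and
all of them give the same monomial. This factorial cancels the one in the entries of the adjacency
tensor. -/
theorem sum_prod_X_of_insert_eq {V : Type*} [Fintype V] [DecidableEq V] {k : ℕ}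
    {s : Finset V} (hs : s.card = k) (i : V) :
    ∑ β : Fin (k - 1) → V, (if insert i (Finset.univ.image β) = s then
        ∏ t, (X (i, β t) : MvPolynomial (V × V) ℝ) else 0) =
      if i ∈ s then ((k - 1).factorial : ℝ) •
        monomial (∑ j ∈ s.erase i, Finsupp.single (i, j) 1) 1 else 0 := by
  split_ifs with hi
  · have hc : (s.erase i).card = k - 1 := by rw [Finset.card_erase_of_mem hi, hs]
    have hcard : Fintype.card (Fin (k - 1) ≃ ↥(s.erase i)) = (k - 1).factorial := by
      rw [Fintype.card_equiv (Fintype.equivOfCardEq (by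
        rw [Fintype.card_coe, hc, Fintype.card_fin])), Fintype.card_fin]
    rw [← Finset.sum_filter, ← hcard, Nat.cast_smul_eq_nsmul, ← Finset.card_univ,
      ← Finset.sum_const]
    symm
    refine Finset.sum_bij (fun (f : Fin (k - 1) ≃ ↥(s.erase i)) _ => fun t => (f t : V))
      ?_ ?_ ?_ ?_
    · intro f _
      rw [Finset.mem_filter]
      refine ⟨Finset.mem_univ _, ?_⟩
      have : Finset.univ.image (fun t => (f t : V)) = s.erase i := by
        ext v
        simp only [Finset.mem_image, Finset.mem_univ, true_and]
        exact ⟨fun ⟨t, ht⟩ => ht ▸ (f t).2, fun hv => ⟨f.symm ⟨v, hv⟩, by simp⟩⟩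
      rw [this, Finset.insert_erase hi]
    · intro f _ g _ h
      ext t
      exact congrFun h t
    · intro β hβ
      have hβ' := (Finset.mem_filter.mp hβ).2
      have h1 : s.erase i ⊆ Finset.univ.image β := by
        rw [← hβ']
        intro v hv
        rw [Finset.mem_erase, Finset.mem_insert] at hv
        exact hv.2.resolve_left hv.1
      have h2 : s.erase i = Finset.univ.image β :=
        Finset.eq_of_subset_of_card_le h1 (Finset.card_image_le.trans (by simp [hc]))
      have h3 : Function.Injective β := by
        rw [← Set.injOn_univ, ← Finset.coe_univ, ← Finset.card_image_iff, ← h2, hc]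
        simp
      have h4 : ∀ t, β t ∈ s.erase i := fun t => by
        rw [h2]
        exact Finset.mem_image_of_mem _ (Finset.mem_univ t)
      have h5 : Function.Bijective fun t => (⟨β t, h4 t⟩ : ↥(s.erase i)) :=
        (Fintype.bijective_iff_injective_and_card _).mpr
          ⟨fun t t' h => h3 (congrArg Subtype.val h), by
            rw [Fintype.card_coe, hc, Fintype.card_fin]⟩
      exact ⟨Equiv.ofBijective _ h5, Finset.mem_univ _, rfl⟩
    · intro f _
      simp only [X]
      rw [prod_monomial, f.sum_comp fun j : ↥(s.erase i) =>
        (Finsupp.single (i, (j : V)) 1 : V × V →₀ ℕ), Finset.prod_const_one,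
        Finset.sum_coe_sort (s.erase i) fun j => (Finsupp.single (i, j) 1 : V × V →₀ ℕ)]
  · refine Finset.sum_eq_zero fun β _ => if_neg fun h => hi ?_
    rw [← h]
    exact Finset.mem_insert_self _ _

theorem rowPoly_alphaTensor {H : Hypergraph U} {k : ℕ} (hH : H.IsUniform k) (a : ℝ)
    [Fintype ↥H.vertexSet] [DecidableEq ↥H.vertexSet] [Fintype ↥H.edgeSet] (i : ↥H.vertexSet) :
    rowPoly (H.alphaTensor k a) i = ∑ o, monomial (optArcs k H.edgeVerts (i, o))
      (optWeight H.edgeVerts (fun v => a * H.degree v) (1 - a) (i, o)) := by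
  classical
  have h1 : ∀ β : Fin (k - 1) → ↥H.vertexSet, H.alphaTensor k a i β =
      (if β = fun _ => i then a * H.degree i else 0) +
        ∑ e, if insert i (Finset.univ.image β) = H.edgeVerts e then
          (1 - a) / ((k - 1).factorial : ℝ) else 0 := by
    intro β
    simp only [alphaTensor, degreeTensor, adjacencyTensor, Pi.add_apply, Pi.smul_apply,
      smul_eq_mul]
    congr 1
    · simp [funext_iff]
    · by_cases h : insert (i : U) (Set.range fun t => (β t : U)) ∈ H.edgeSet
      · rw [if_pos h, Finset.sum_eq_single ⟨_, h⟩]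
        · rw [if_pos ((insert_range_eq_iff i β ⟨_, h⟩).mp rfl)]
          ring
        · intro e _ he
          exact if_neg fun h' => he (Subtype.ext ((insert_range_eq_iff i β e).mpr h').symm)
        · simp
      · rw [if_neg h, mul_zero, Finset.sum_eq_zero]
        intro e _
        exact if_neg fun h' => h (((insert_range_eq_iff i β e).mpr h') ▸ e.2)
  have h2 : ∀ e, ∑ β : Fin (k - 1) → ↥H.vertexSet,
      (if insert i (Finset.univ.image β) = H.edgeVerts e then
          (1 - a) / ((k - 1).factorial : ℝ) else 0) • ∏ t, X (i, β t) =
      monomial (optArcs k H.edgeVerts (i, some e))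
        (optWeight H.edgeVerts (fun v => a * H.degree v) (1 - a) (i, some e)) := by
    intro e
    have h3 := sum_prod_X_of_insert_eq (card_edgeVerts hH e) i
    have h4 : ∀ β : Fin (k - 1) → ↥H.vertexSet,
        (if insert i (Finset.univ.image β) = H.edgeVerts e then
          (1 - a) / ((k - 1).factorial : ℝ) else 0) • ∏ t, (X (i, β t) : MvPolynomial _ ℝ) =
        ((1 - a) / ((k - 1).factorial : ℝ)) • (if insert i (Finset.univ.image β) = H.edgeVerts e
          then ∏ t, (X (i, β t) : MvPolynomial _ ℝ) else 0) := by
      intro β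
      split_ifs <;> simp
    rw [Finset.sum_congr rfl fun β _ => h4 β, ← Finset.smul_sum, h3]
    simp only [optWeight, optArcs]
    split_ifs
    · rw [smul_smul, div_mul_cancel₀ _ (by positivity), smul_monomial, smul_eq_mul, mul_one]
    · simp
  rw [rowPoly, Fintype.sum_option, ← Finset.sum_congr rfl fun e _ => h2 e, Finset.sum_comm,
    Finset.sum_congr rfl fun β _ => by rw [h1 β, add_smul, Finset.sum_smul],
    Finset.sum_add_distrib]
  congr 1
  simp only [ite_smul, zero_smul, Finset.sum_ite_eq', Finset.mem_univ, if_true]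
  simp only [optArcs, optWeight, Finset.prod_const, Finset.card_univ, Fintype.card_fin, X,
    monomial_pow, smul_monomial]
  simp

theorem alphaMoment_eq_sum_configTerm {H : Hypergraph U} {k : ℕ}
    (hH : H.IsUniform k) (a : ℝ) [hV : Fintype ↥H.vertexSet] [hV' : DecidableEq ↥H.vertexSet]
    [Fintype ↥H.edgeSet] [DecidableEq ↥H.edgeSet] (d : ℕ) :
    H.alphaMoment k a d = ((k : ℝ) - 1) ^ (Fintype.card ↥H.vertexSet - 1) *
      ∑ n ∈ Finset.piAntidiag Finset.univ d,
        configTerm k H.edgeVerts (fun v => a * H.degree v) (1 - a) n := by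
  rw [← trace_eq_sum_configTerm (H.alphaTensor k a) H.edgeVerts _ _
    (rowPoly_alphaTensor hH a), alphaMoment]
  congr
  · exact Subsingleton.elim _ _
  · exact Subsingleton.elim _ _

end Hypergraph

end

/-! ### Families of generators with a nonzero contribution -/

section

open HTensor

section

variable {V E : Type*} [Fintype V] [DecidableEq V] [Fintype E] [DecidableEq E]
  {k : ℕ} {ed : E → Finset V}

theorem optArcs_some_apply (i : V) (e : E) (u v : V) :
    optArcs k ed (i, some e) (u, v) = if u = i ∧ v ∈ ed e ∧ v ≠ u then 1 else 0 := by
  simp only [optArcs, Finsupp.finsetSum_apply, Finsupp.single_apply, Prod.mk.injEq]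
  by_cases h : i = u
  · subst h
    simp [and_comm]
  · simp [h, Ne.symm h]

theorem configArcs_apply (n : V × Option E → ℕ) (u v : V) :
    configArcs k ed n (u, v) = (if u = v then n (u, none) * (k - 1) else 0) +
      ∑ e, if v ∈ ed e ∧ v ≠ u then n (u, some e) else 0 := by
  simp only [configArcs, Finsupp.finsetSum_apply, Finsupp.smul_apply, smul_eq_mul]
  rw [Fintype.sum_prod_type, Finset.sum_eq_single u]
  · rw [Fintype.sum_option]
    congr 1
    · by_cases h : u = v
      · subst h
        simp [optArcs]
      · simp [optArcs, h]
    · refine Finset.sum_congr rfl fun e _ => ?_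
      simp [optArcs_some_apply]
  · intro i _ hi
    refine Finset.sum_eq_zero fun o _ => ?_
    rcases o with _ | e
    · simp [optArcs, hi]
    · simp [optArcs_some_apply, hi.symm]
  · simp

/-- The edges that occur in a family of generators. -/
def configEdges (n : V × Option E → ℕ) : Finset E :=
  Finset.univ.filter fun e => ∃ i, n (i, some e) ≠ 0

theorem mem_configEdges {n : V × Option E → ℕ} {e : E} :
    e ∈ configEdges n ↔ ∃ i, n (i, some e) ≠ 0 := by simp [configEdges]

theorem configCoeff_nonneg (n : V × Option E → ℕ) : 0 ≤ configCoeff k ed n := by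
  have := closedCoeff_nonneg ((∑ p, n p) * (k - 1)) (configArcs k ed n)
  have := (expFactorial_pos (configArcs k ed n)).le
  rw [configCoeff]
  positivity

theorem configCoeff_pos {n : V × Option E → ℕ} {i : V} (h : EulerTrail i (configArcs k ed n) i)
    (hd : (configArcs k ed n).degree = (∑ p, n p) * (k - 1)) : 0 < configCoeff k ed n := by
  have := closedCoeff_pos h hd
  have := expFactorial_pos (configArcs k ed n)
  have h1 : 0 < ∏ i, ((∑ o, n (i, o)).factorial : ℝ) /
      (((∑ o, n (i, o)) * (k - 1)).factorial : ℝ) := Finset.prod_pos fun i _ => by positivity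
  have h2 : 0 < ∏ p, 1 / ((n p).factorial : ℝ) := Finset.prod_pos fun i _ => by positivity
  rw [configCoeff]
  positivity

theorem closedCoeff_ne_zero {n : V × Option E → ℕ} (h : configCoeff k ed n ≠ 0) :
    closedCoeff ((∑ p, n p) * (k - 1)) (configArcs k ed n) ≠ 0 :=
  right_ne_zero_of_mul (right_ne_zero_of_mul h)

theorem mem_of_configTerm_ne_zero {x : V → ℝ} {y : ℝ} {n : V × Option E → ℕ}
    (h : configTerm k ed x y n ≠ 0) {i : V} {e : E} (hn : n (i, some e) ≠ 0) : i ∈ ed e := by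
  by_contra hi
  refine right_ne_zero_of_mul h (Finset.prod_eq_zero (Finset.mem_univ (i, some e)) ?_)
  rw [optWeight, if_neg hi, zero_pow hn]

/-- Balanced weights on the incidences of a family of finite sets vanish. -/
def IsFlowFree (ed : E → Finset V) : Prop :=
  ∀ x : V → E → ℤ, (∀ v e, v ∉ ed e → x v e = 0) → (∀ e, ∑ v, x v e = 0) →
    (∀ v, ∑ e, x v e = 0) → ∀ v e, x v e = 0

/-- Let `N e` be the number of generators with edge `e`. At a vertex `v`, the edge `e` accounts for
`(k - 1) * n (v, e)` outgoing and `N e - n (v, e)` incoming arcs. Balance of the closed walk says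
that the weights `N e - k * n (v, e)` on the incidences sum to zero at each vertex; they also sum to
zero over each edge, so flow-freeness kills them. -/
theorem sum_eq_mul_of_configTerm_ne_zero (hk : 1 ≤ k) (hcard : ∀ e, (ed e).card = k)
    (hflow : IsFlowFree ed) {x : V → ℝ} {y : ℝ} {n : V × Option E → ℕ}
    (h : configTerm k ed x y n ≠ 0) {v : V} {e : E} (hv : v ∈ ed e) :
    ∑ i, n (i, some e) = k * n (v, some e) := by
  have hmem : ∀ i e, i ∉ ed e → n (i, some e) = 0 := fun i e hi => by
    by_contra hn
    exact hi (mem_of_configTerm_ne_zero h hn)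
  have hbal := sum_out_eq_sum_in (closedCoeff_ne_zero (left_ne_zero_of_mul h))
  have key := hflow (fun v e => if v ∈ ed e then
    (∑ i, n (i, some e) : ℤ) - k * n (v, some e) else 0)
    (fun v e hv => if_neg hv) (fun e => ?_) (fun v => ?_) v e
  · simp only [if_pos hv] at key
    zify
    linarith
  · rw [← Finset.sum_filter, Finset.sum_sub_distrib, ← Finset.mul_sum, Finset.sum_const]
    have h1 : ∑ i ∈ Finset.univ.filter (· ∈ ed e), (n (i, some e) : ℤ) =
        ∑ i, (n (i, some e) : ℤ) := by
      rw [Finset.sum_filter]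
      refine Finset.sum_congr rfl fun i _ => ?_
      split_ifs with hi
      · rfl
      · rw [hmem i e hi]; rfl
    rw [h1, Finset.filter_mem_eq_inter, Finset.univ_inter, hcard, nsmul_eq_mul, sub_self]
  · have h1 := hbal v
    simp only [configArcs_apply, Finset.sum_add_distrib] at h1
    rw [Finset.sum_ite_eq, Finset.sum_ite_eq'] at h1
    simp only [Finset.mem_univ, if_true, add_right_inj] at h1
    rw [Finset.sum_comm, Finset.sum_comm (γ := V)] at h1
    have h2 : ∀ e, ∑ u, (if u ∈ ed e ∧ u ≠ v then n (v, some e) else 0) =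
        (k - 1) * n (v, some e) := by
      intro e
      by_cases hv : v ∈ ed e
      · rw [← Finset.sum_filter, Finset.sum_const, smul_eq_mul]
        congr 1
        have : Finset.univ.filter (fun u => u ∈ ed e ∧ u ≠ v) = (ed e).erase v := by
          ext u; simp [and_comm]
        rw [this, Finset.card_erase_of_mem hv, hcard]
      · simp [hmem v e hv]
    have h3 : ∀ e, ((∑ u, if v ∈ ed e ∧ v ≠ u then n (u, some e) else 0 : ℕ) : ℤ) =
        if v ∈ ed e then (∑ i, n (i, some e) : ℤ) - n (v, some e) else 0 := by
      intro e
      by_cases hv : v ∈ ed e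
      · simp only [hv, true_and, if_true]
        rw [← Finset.sum_filter, Finset.filter_ne,
          ← Finset.add_sum_erase Finset.univ _ (Finset.mem_univ v)]
        push_cast
        ring
      · simp [hv]
    rw [Finset.sum_congr rfl fun e _ => h2 e] at h1
    calc ∑ e, (if v ∈ ed e then (∑ i, n (i, some e) : ℤ) - k * n (v, some e) else 0)
        = ∑ e, (((∑ u, if v ∈ ed e ∧ v ≠ u then n (u, some e) else 0 : ℕ) : ℤ) -
            (((k - 1) * n (v, some e) : ℕ) : ℤ)) := by
          refine Finset.sum_congr rfl fun e _ => ?_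
          rw [h3]
          split_ifs with hv
          · rw [Nat.cast_mul, Nat.cast_sub hk]
            push_cast
            ring
          · simp [hmem v e hv]
      _ = 0 := by rw [Finset.sum_sub_distrib, ← Nat.cast_sum, ← Nat.cast_sum, h1, sub_self]

/-- An occurring edge is used at least once from each of its `k` vertices, because it is used
equally often from all of them. -/
theorem sum_loops_add_le (hk : 1 ≤ k) (hcard : ∀ e, (ed e).card = k) (hflow : IsFlowFree ed)
    {x : V → ℝ} {y : ℝ} {n : V × Option E → ℕ} (h : configTerm k ed x y n ≠ 0) :
    ∑ v, n (v, none) + k * (configEdges n).card ≤ ∑ p, n p := by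
  rw [Fintype.sum_prod_type]
  simp only [Fintype.sum_option, Finset.sum_add_distrib]
  rw [Finset.sum_comm (γ := V)]
  refine Nat.add_le_add_left ?_ _
  rw [mul_comm, ← smul_eq_mul, ← Finset.sum_const]
  refine (Finset.sum_le_sum fun e he => ?_).trans
    (Finset.sum_le_univ_sum_of_nonneg fun _ => Nat.zero_le _)
  obtain ⟨i, hi⟩ := mem_configEdges.mp he
  rw [sum_eq_mul_of_configTerm_ne_zero hk hcard hflow h (mem_of_configTerm_ne_zero h hi)]
  exact Nat.le_mul_of_pos_right _ (Nat.pos_of_ne_zero hi)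

/-- Closed walks do not leave a set of vertices that every occurring edge contains or avoids. -/
theorem mem_iff_mem_of_configTerm_ne_zero (hk : 2 ≤ k) (hcard : ∀ e, (ed e).card = k)
    {x : V → ℝ} {y : ℝ} {n : V × Option E → ℕ} (h : configTerm k ed x y n ≠ 0) (S : Set V)
    (hS : ∀ e ∈ configEdges n, ∀ u ∈ ed e, ∀ v ∈ ed e, u ∈ S → v ∈ S) {p q : V × Option E}
    (hp : n p ≠ 0) (hq : n q ≠ 0) : p.1 ∈ S ↔ q.1 ∈ S := by
  -- Since `k ≥ 2`, every generator emits an arc, so the closed walk visits its vertex.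
  have hout : ∀ p, n p ≠ 0 → ∃ u, configArcs k ed n (p.1, u) ≠ 0 := by
    rintro ⟨i, _ | e⟩ hp
    · refine ⟨i, ?_⟩
      rw [configArcs_apply, if_pos rfl]
      have : 0 < n (i, none) * (k - 1) := Nat.mul_pos (Nat.pos_of_ne_zero hp) (by omega)
      exact (Nat.add_pos_left this _).ne'
    · have hi := mem_of_configTerm_ne_zero h hp
      obtain ⟨u, hu, hui⟩ := Finset.exists_mem_ne (s := ed e) (by rw [hcard]; omega) i
      refine ⟨u, ?_⟩
      rw [configArcs_apply]
      have h1 : n (i, some e) ≤ ∑ e, if u ∈ ed e ∧ u ≠ i then n (i, some e) else 0 := by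
        refine le_trans ?_ (Finset.single_le_sum (f := fun e => if u ∈ ed e ∧ u ≠ i then
          n (i, some e) else 0) (fun _ _ => Nat.zero_le _) (Finset.mem_univ e))
        simp [hu, hui]
      have h2 := Nat.pos_of_ne_zero hp
      exact (Nat.add_pos_right _ (h2.trans_le h1)).ne'
  obtain ⟨u, hu⟩ := hout p hp
  obtain ⟨v, hv⟩ := hout q hq
  refine mem_iff_mem_of_closedCoeff_ne_zero (closedCoeff_ne_zero (left_ne_zero_of_mul h))
    (S := S) ?_ hu hv
  rintro ⟨i, j⟩ hij
  rw [configArcs_apply] at hij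
  by_cases h' : i = j
  · rw [h']
  · rw [if_neg h', zero_add] at hij
    obtain ⟨e, -, he⟩ := Finset.exists_ne_zero_of_sum_ne_zero hij
    simp only [ne_eq, ite_eq_right_iff, Classical.not_imp] at he
    have he' : e ∈ configEdges n := mem_configEdges.mpr ⟨i, he.2⟩
    have hi := mem_of_configTerm_ne_zero h he.2
    exact ⟨hS e he' i hi j he.1.1, hS e he' j he.1.1 i hi⟩

end

/-! ### Restriction to a substructure -/

section extend

variable {V E V₀ E₀ : Type*} [Fintype V] [DecidableEq V] [Fintype E] [DecidableEq E]
  [Fintype V₀] [DecidableEq V₀] [Fintype E₀] [DecidableEq E₀]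
  {k : ℕ} {ed : E → Finset V} {ed₀ : E₀ → Finset V₀} {f : V₀ → V} {g : E₀ → E}

/-- The family of generators that corresponds to a family of generators of a substructure. -/
noncomputable def configExtend (f : V₀ → V) (g : E₀ → E) (n : V₀ × Option E₀ → ℕ) :
    V × Option E → ℕ :=
  Function.extend (Prod.map f (Option.map g)) n 0

theorem configExtend_injective_map (hf : Function.Injective f) (hg : Function.Injective g) :
    Function.Injective (Prod.map f (Option.map g)) :=
  hf.prodMap (Option.map_injective hg)

theorem configExtend_apply (hf : Function.Injective f) (hg : Function.Injective g)
    (n : V₀ × Option E₀ → ℕ) (p : V₀ × Option E₀) :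
    configExtend f g n (Prod.map f (Option.map g) p) = n p :=
  (configExtend_injective_map hf hg).extend_apply _ _ _

theorem configExtend_apply_of_notMem (n : V₀ × Option E₀ → ℕ) {p : V × Option E}
    (hp : p ∉ Set.range (Prod.map f (Option.map g))) : configExtend f g n p = 0 :=
  Function.extend_apply' _ _ _ hp

theorem optArcs_map (hf : Function.Injective f) (hed : ∀ e, ed (g e) = (ed₀ e).image f)
    (p : V₀ × Option E₀) : optArcs k ed (Prod.map f (Option.map g) p) =
      (optArcs k ed₀ p).mapDomain (Prod.map f f) := by
  rcases p with ⟨i, _ | e⟩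
  · simp only [optArcs, Prod.map_apply, Option.map_none]
    rw [Finsupp.mapDomain_single]
    rfl
  · simp only [Prod.map_apply, Option.map_some, optArcs, hed]
    rw [← Finset.image_erase hf, Finset.sum_image hf.injOn, Finsupp.mapDomain_finsetSum]
    simp [Finsupp.mapDomain_single]

theorem configArcs_extend (hf : Function.Injective f) (hg : Function.Injective g)
    (hed : ∀ e, ed (g e) = (ed₀ e).image f) (n : V₀ × Option E₀ → ℕ) :
    configArcs k ed (configExtend f g n) = (configArcs k ed₀ n).mapDomain (Prod.map f f) := by
  rw [configArcs, configArcs, Finsupp.mapDomain_finsetSum]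
  symm
  refine Fintype.sum_of_injective _ (configExtend_injective_map hf hg) _ _ (fun p hp => ?_)
    fun p => ?_
  · rw [configExtend_apply_of_notMem _ hp, zero_smul]
  · rw [configExtend_apply hf hg, optArcs_map hf hed, Finsupp.mapDomain_smul]

theorem sum_configExtend (hf : Function.Injective f) (hg : Function.Injective g)
    (n : V₀ × Option E₀ → ℕ) : ∑ p, configExtend f g n p = ∑ p, n p := by
  symm
  refine Fintype.sum_of_injective _ (configExtend_injective_map hf hg) _ _ (fun p hp => ?_)
    fun p => ?_
  · rw [configExtend_apply_of_notMem _ hp]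
  · rw [configExtend_apply hf hg]

/-- Rows and generators outside the substructure contribute factors `1`. The family must be
nonempty, since walks of length zero would see the number of vertices of the ambient structure. -/
theorem configCoeff_extend (hk : 2 ≤ k) (hf : Function.Injective f) (hg : Function.Injective g)
    (hed : ∀ e, ed (g e) = (ed₀ e).image f) {n : V₀ × Option E₀ → ℕ} (hn : ∑ p, n p ≠ 0) :
    configCoeff k ed (configExtend f g n) = configCoeff k ed₀ n := by
  have hff : Function.Injective (Prod.map f f) := hf.prodMap hf
  have hrow : ∀ i, ∑ o, configExtend f g n (f i, o) = ∑ o, n (i, o) := by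
    intro i
    symm
    refine Fintype.sum_of_injective _ (Option.map_injective hg) _ _ (fun o ho => ?_) fun o => ?_
    · refine configExtend_apply_of_notMem _ ?_
      rintro ⟨⟨a, b⟩, h⟩
      exact ho ⟨b, congrArg Prod.snd h⟩
    · exact (configExtend_apply hf hg n (i, o)).symm
  rw [configCoeff, configCoeff, configArcs_extend hf hg hed, sum_configExtend hf hg]
  congr 1
  · congr 1
    · symm
      refine Fintype.prod_of_injective f hf _ _ (fun i hi => ?_) fun i => by rw [hrow]
      have : ∑ o, configExtend f g n (i, o) = 0 := Finset.sum_eq_zero fun o _ => by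
        refine configExtend_apply_of_notMem _ ?_
        rintro ⟨⟨a, b⟩, h⟩
        exact hi ⟨a, congrArg Prod.fst h⟩
      simp [this]
    · symm
      refine Fintype.prod_of_injective _ (configExtend_injective_map hf hg) _ _ (fun p hp => ?_)
        fun p => by rw [configExtend_apply hf hg]
      simp [configExtend_apply_of_notMem _ hp]
  · congr 1
    · rw [expFactorial, expFactorial, Finsupp.prod_mapDomain_index_inj hff]
    · exact closedCoeff_mapDomain hf (Nat.mul_ne_zero hn (by omega)) _

theorem configTerm_extend (hk : 2 ≤ k) (hf : Function.Injective f) (hg : Function.Injective g)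
    (hed : ∀ e, ed (g e) = (ed₀ e).image f) {n : V₀ × Option E₀ → ℕ} (hn : ∑ p, n p ≠ 0)
    (x : V → ℝ) (y : ℝ) :
    configTerm k ed x y (configExtend f g n) = configTerm k ed₀ (x ∘ f) y n := by
  rw [configTerm, configTerm, configCoeff_extend hk hf hg hed hn]
  congr 1
  symm
  refine Fintype.prod_of_injective _ (configExtend_injective_map hf hg) _ _ (fun p hp => ?_)
    fun p => ?_
  · rw [configExtend_apply_of_notMem _ hp, pow_zero]
  · rw [configExtend_apply hf hg]
    congr 1
    rcases p with ⟨i, _ | e⟩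
    · rfl
    · simp [optWeight, hed, hf.eq_iff]

theorem configEdges_extend (hf : Function.Injective f) (hg : Function.Injective g)
    (n : V₀ × Option E₀ → ℕ) : configEdges (configExtend f g n) = (configEdges n).image g := by
  ext e
  simp only [mem_configEdges, Finset.mem_image]
  constructor
  · rintro ⟨i, hi⟩
    obtain ⟨⟨a, o⟩, h⟩ : (i, some e) ∈ Set.range (Prod.map f (Option.map g)) := by
      by_contra h
      exact hi (configExtend_apply_of_notMem _ h)
    rw [← h, configExtend_apply hf hg] at hi
    simp only [Prod.map_apply, Prod.mk.injEq, Option.map_eq_some_iff] at h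
    obtain ⟨-, b, rfl, rfl⟩ := h
    exact ⟨b, ⟨a, hi⟩, rfl⟩
  · rintro ⟨b, ⟨a, h⟩, rfl⟩
    exact ⟨f a, fun h' => h (by rw [← configExtend_apply hf hg n (a, some b)]; exact h')⟩

/-- The sum of the contributions in which every edge occurs. -/
noncomputable def fullSum (k : ℕ) (ed : E → Finset V) (x : V → ℝ) (y : ℝ) (d : ℕ) : ℝ :=
  ∑ n ∈ Finset.piAntidiag Finset.univ d with configEdges n = Finset.univ, configTerm k ed x y n

/-- The closed walk of a contributing family uses only edges of the substructure, so it cannot leave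
the vertices of the substructure. In particular no loop lies outside, and the family is an
extension. This makes contributions local. -/
theorem sum_configTerm_eq_fullSum (hk : 2 ≤ k) (hcard : ∀ e, (ed e).card = k)
    (hf : Function.Injective f) (hg : Function.Injective g)
    (hed : ∀ e, ed (g e) = (ed₀ e).image f) [Nonempty E₀] {d : ℕ} (hd : d ≠ 0)
    (x : V → ℝ) (y : ℝ) :
    ∑ n ∈ Finset.piAntidiag Finset.univ d with configEdges n = Finset.univ.image g,
      configTerm k ed x y n = fullSum k ed₀ (x ∘ f) y d := by
  symm
  refine Finset.sum_of_injOn (configExtend f g)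
    (fun n _ n' _ h => funext fun p => by
      rw [← configExtend_apply hf hg n p, h, configExtend_apply hf hg])
    (fun n hn => ?_) (fun n hn hn' => ?_) (fun n hn => ?_)
  · simp only [Finset.coe_filter, Finset.mem_piAntidiag, Set.mem_ofPred_eq] at hn ⊢
    rw [sum_configExtend hf hg, configEdges_extend hf hg, hn.2]
    simpa using hn.1
  · by_contra h
    simp only [Finset.mem_filter, Finset.mem_piAntidiag] at hn
    have hrange : ∀ p, n p ≠ 0 → p ∈ Set.range (Prod.map f (Option.map g)) := by
      -- One occurring edge anchors the walk in the range of `f`; without edges, loops at any vertex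
      -- of the ambient structure would be possible.
      obtain ⟨e₀⟩ := ‹Nonempty E₀›
      have he₀ : g e₀ ∈ configEdges n := by rw [hn.2]; simp
      obtain ⟨i₀, hi₀⟩ := mem_configEdges.mp he₀
      have hmem : ∀ e ∈ configEdges n, ∀ v ∈ ed e, v ∈ Set.range f := by
        intro e he v hv
        rw [hn.2, Finset.mem_image] at he
        obtain ⟨b, -, rfl⟩ := he
        rw [hed, Finset.mem_image] at hv
        obtain ⟨a, -, rfl⟩ := hv
        exact ⟨a, rfl⟩
      have hi₀' := hmem _ he₀ _ (mem_of_configTerm_ne_zero h hi₀)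
      intro p hp
      have h1 := mem_iff_mem_of_configTerm_ne_zero hk hcard h (Set.range f)
        (fun e he u _ v hv _ => hmem e he v hv) hp hi₀
      obtain ⟨a, ha⟩ := h1.mpr hi₀'
      rcases p with ⟨i, _ | e⟩
      · exact ⟨(a, none), by simpa using ha⟩
      · have he : e ∈ configEdges n := mem_configEdges.mpr ⟨i, hp⟩
        rw [hn.2, Finset.mem_image] at he
        obtain ⟨b, -, rfl⟩ := he
        exact ⟨(a, some b), by simpa using ha⟩
    have hext : configExtend f g (fun p => n (Prod.map f (Option.map g) p)) = n := by
      funext p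
      by_cases hp : p ∈ Set.range (Prod.map f (Option.map g))
      · obtain ⟨p, rfl⟩ := hp
        rw [configExtend_apply hf hg]
      · rw [configExtend_apply_of_notMem _ hp]
        by_contra h'
        exact hp (hrange p (Ne.symm h'))
    refine hn' ⟨_, ?_, hext⟩
    simp only [Finset.coe_filter, Finset.mem_piAntidiag, Set.mem_ofPred_eq]
    refine ⟨⟨?_, by simp⟩, ?_⟩
    · rw [← sum_configExtend hf hg, hext]
      exact hn.1.1
    · refine Finset.image_injective hg ?_
      rw [← configEdges_extend hf hg, hext, hn.2]
  · simp only [Finset.mem_filter, Finset.mem_piAntidiag] at hn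
    exact (configTerm_extend hk hf hg hed (by rw [hn.1.1]; exact hd) x y).symm

end extend

end

/-! ### Splitting below order `3k` into vertices, edges and adjacent pairs -/

section

open HTensor

/-- The coefficient of the `d`-th power of the weight of the loop at a vertex. -/
noncomputable def vertexCoeff (k d : ℕ) : ℝ :=
  configCoeff k (fun _ : Empty => (∅ : Finset Unit)) fun _ => d

theorem vertexCoeff_pos (k d : ℕ) : 0 < vertexCoeff k d := by
  have h : configArcs k (fun _ : Empty => (∅ : Finset Unit)) (fun _ => d) =
      Finsupp.single ((), ()) (d * (k - 1)) := by
    rw [configArcs, Fintype.sum_subsingleton _ ((), none)]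
    exact Finsupp.smul_single _ _ _
  refine configCoeff_pos (i := ()) ?_ ?_
  · rw [h]
    exact EulerTrail.loops _ _
  · rw [h, Finsupp.degree_single]
    simp

/-- One edge with `k` vertices. -/
def singleEdge (k : ℕ) : Unit → Finset (Fin k) := fun _ => Finset.univ

/-- Two edges with `k` vertices that share the vertex `none`. -/
def twoEdges (k : ℕ) : Bool → Finset (Option (Bool × Fin (k - 1))) :=
  fun b => insert none (Finset.univ.image fun j => some (b, j))

section

variable {V E : Type*} [Fintype V] [DecidableEq V] [Fintype E] [DecidableEq E]
  {k : ℕ} {ed : E → Finset V}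

/-- Without edges a closed walk stays at one vertex, so a contributing family consists of `d` loops
at a single vertex. -/
theorem sum_configTerm_empty (hk : 2 ≤ k) (hcard : ∀ e, (ed e).card = k) {d : ℕ} (hd : d ≠ 0)
    (x : V → ℝ) (y : ℝ) :
    ∑ n ∈ Finset.piAntidiag Finset.univ d with configEdges n = ∅, configTerm k ed x y n =
      ∑ v, vertexCoeff k d * x v ^ d := by
  have hinj : ∀ v : V, Function.Injective fun _ : Unit => v :=
    fun v => Function.injective_of_subsingleton _
  have hinj' : Function.Injective (Empty.elim : Empty → E) := Function.injective_of_subsingleton _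
  have happ : ∀ v : V, configExtend (fun _ : Unit => v) (Empty.elim : Empty → E) (fun _ => d) =
      Pi.single (v, none) d := by
    intro v
    funext p
    by_cases hp : p = (v, none)
    · subst hp
      rw [Pi.single_eq_same]
      exact configExtend_apply (hinj v) hinj' (fun _ => d) ((), none)
    · rw [Pi.single_eq_of_ne hp]
      refine configExtend_apply_of_notMem _ ?_
      rintro ⟨⟨a, _ | b⟩, h⟩
      · exact hp h.symm
      · exact b.elim
  symm
  refine Finset.sum_of_injOn (fun v => (Pi.single (v, none) d : V × Option E → ℕ))
    (fun v _ w _ h => ?_)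
    (fun v _ => ?_) (fun n hn hn' => ?_) (fun v _ => ?_)
  · have := congrFun h (v, none)
    simp only [Pi.single_eq_same] at this
    by_contra hvw
    rw [Pi.single_eq_of_ne (by simpa using hvw)] at this
    exact hd this
  · simp only [Finset.coe_filter, Finset.mem_piAntidiag, Set.mem_ofPred_eq]
    refine ⟨⟨by simp, by simp⟩, ?_⟩
    ext e
    simp [mem_configEdges]
  · by_contra h
    simp only [Finset.mem_filter, Finset.mem_piAntidiag] at hn
    have hnone : ∀ i e, n (i, some e) = 0 := fun i e => by
      by_contra h'
      have := mem_configEdges.mpr ⟨i, h'⟩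
      rw [hn.2] at this
      simp at this
    obtain ⟨⟨v, o⟩, hv⟩ : ∃ p, n p ≠ 0 := by
      by_contra h'
      push Not at h'
      exact hd (by rw [← hn.1.1]; exact Finset.sum_eq_zero fun p _ => h' p)
    obtain rfl : o = none := by
      rcases o with _ | e
      · rfl
      · exact absurd (hnone v e) hv
    have hsupp : ∀ p, p ≠ (v, none) → n p = 0 := by
      rintro ⟨w, _ | e⟩ hp
      · by_contra hw
        have := mem_iff_mem_of_configTerm_ne_zero hk hcard h {v}
          (fun e he => by rw [hn.2] at he; simp at he) hw hv
        simp only [Set.mem_singleton_iff, iff_true] at this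
        exact hp (by rw [this])
      · exact hnone w e
    refine hn' ⟨v, Finset.mem_coe.mpr (Finset.mem_univ _), ?_⟩
    funext p
    beta_reduce
    by_cases hp : p = (v, none)
    · subst hp
      rw [Pi.single_eq_same, ← hn.1.1, Finset.sum_eq_single (v, none) (fun p _ hp => hsupp p hp)
        (by simp)]
    · rw [Pi.single_eq_of_ne hp, hsupp p hp]
  · have hs : ∑ p : Unit × Option Empty, d ≠ 0 := by simpa [Fintype.sum_prod_type] using hd
    rw [configTerm, ← happ, configCoeff_extend hk (hinj v) hinj'
      (ed₀ := fun _ : Empty => (∅ : Finset Unit)) (fun e => e.elim) hs, vertexCoeff, happ,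
      Finset.prod_eq_single (v, none)]
    · rw [Pi.single_eq_same]; rfl
    · intro p _ hp
      rw [Pi.single_eq_of_ne hp, pow_zero]
    · simp

theorem sum_configTerm_eq_sum_fiber (d : ℕ) (x : V → ℝ) (y : ℝ) :
    ∑ n ∈ Finset.piAntidiag Finset.univ d, configTerm k ed x y n =
      ∑ s : Finset E, ∑ n ∈ Finset.piAntidiag Finset.univ d with configEdges n = s,
        configTerm k ed x y n :=
  (Finset.sum_fiberwise _ _ _).symm

theorem sum_fiber_eq_zero_of_lt (hk : 1 ≤ k) (hcard : ∀ e, (ed e).card = k)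
    (hflow : IsFlowFree ed) {d : ℕ} {s : Finset E} (hd : d < k * s.card) (x : V → ℝ) (y : ℝ) :
    ∑ n ∈ Finset.piAntidiag Finset.univ d with configEdges n = s, configTerm k ed x y n = 0 := by
  refine Finset.sum_eq_zero fun n hn => ?_
  by_contra h
  simp only [Finset.mem_filter, Finset.mem_piAntidiag] at hn
  have := sum_loops_add_le hk hcard hflow h
  rw [hn.2, hn.1.1] at this
  omega

theorem sum_configTerm_of_lt (hk : 2 ≤ k) (hcard : ∀ e, (ed e).card = k)
    (hflow : IsFlowFree ed) {d : ℕ} (hd : d ≠ 0) (hdk : d < k) (x : V → ℝ) (y : ℝ) :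
    ∑ n ∈ Finset.piAntidiag Finset.univ d, configTerm k ed x y n =
      ∑ v, vertexCoeff k d * x v ^ d := by
  rw [sum_configTerm_eq_sum_fiber, Finset.sum_eq_single ∅, sum_configTerm_empty hk hcard hd]
  · intro s _ hs
    refine sum_fiber_eq_zero_of_lt (by omega) hcard hflow ?_ x y
    exact hdk.trans_le (Nat.le_mul_of_pos_right _
      (Finset.card_pos.mpr (Finset.nonempty_iff_ne_empty.mpr hs)))
  · simp

/-- Below order `3k`, the sum splits into contributions of the vertices, of the edges and of the
pairs of adjacent edges. -/
theorem sum_configTerm_eq (hk : 2 ≤ k) (hcard : ∀ e, (ed e).card = k) (hflow : IsFlowFree ed)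
    (hlin : ∀ e e', e ≠ e' → ∀ v w, v ∈ ed e → v ∈ ed e' → w ∈ ed e → w ∈ ed e' → v = w)
    {f₁ : E → Fin k → V} (hf₁ : ∀ e, Function.Injective (f₁ e))
    (hed₁ : ∀ e, ed e = Finset.univ.image (f₁ e))
    {W : Finset V} {g : V → Bool → E} {f₂ : V → Option (Bool × Fin (k - 1)) → V}
    (hW : ∀ v e e', v ∈ ed e → v ∈ ed e' → e ≠ e' → v ∈ W ∧ Finset.univ.image (g v) = {e, e'})
    (hg : ∀ v ∈ W, Function.Injective (g v)) (hf₂ : ∀ v ∈ W, Function.Injective (f₂ v))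
    (hed₂ : ∀ v ∈ W, ∀ b, ed (g v b) = (twoEdges k b).image (f₂ v)) (hnone : ∀ v, f₂ v none = v)
    {d : ℕ} (hd : d ≠ 0) (hdk : d < 3 * k) (x : V → ℝ) (y : ℝ) :
    ∑ n ∈ Finset.piAntidiag Finset.univ d, configTerm k ed x y n =
      ∑ v, vertexCoeff k d * x v ^ d + ∑ e, fullSum k (singleEdge k) (x ∘ f₁ e) y d +
        ∑ v ∈ W, fullSum k (twoEdges k) (x ∘ f₂ v) y d := by
  have hmemW : ∀ v ∈ W, ∀ b, v ∈ ed (g v b) := by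
    intro v hv b
    rw [hed₂ v hv, Finset.mem_image]
    exact ⟨none, by simp [twoEdges], hnone v⟩
  -- The edge sets that can contribute: none, one edge, or the two edges through `v ∈ W`. By
  -- linearity the pair determines `v`, so nothing is counted twice.
  let ψ : Unit ⊕ E ⊕ W → Finset E :=
    Sum.elim (fun _ => ∅) (Sum.elim (fun e => {e}) fun v => Finset.univ.image (g v))
  have hcard₂ : ∀ v ∈ W, (Finset.univ.image (g v)).card = 2 := fun v hv => by
    rw [Finset.card_image_of_injective _ (hg v hv)]; rfl
  have hψ : Function.Injective ψ := by
    rintro (u | e | v) (u' | e' | v') h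
    · rfl
    · exact absurd h.symm (Finset.singleton_ne_empty e')
    · exact absurd (congrArg Finset.card h.symm) (by
        change (Finset.univ.image (g v')).card ≠ 0
        rw [hcard₂ v' v'.2]; omega)
    · exact absurd h (Finset.singleton_ne_empty e)
    · rw [Finset.singleton_injective h]
    · exact absurd (congrArg Finset.card h.symm) (by
        change (Finset.univ.image (g v')).card ≠ 1
        rw [hcard₂ v' v'.2]; omega)
    · exact absurd (congrArg Finset.card h) (by
        change (Finset.univ.image (g v)).card ≠ 0
        rw [hcard₂ v v.2]; omega)
    · exact absurd (congrArg Finset.card h) (by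
        change (Finset.univ.image (g v)).card ≠ 1
        rw [hcard₂ v v.2]; omega)
    · have h' : Finset.univ.image (g v) = Finset.univ.image (g v') := h
      have hmem : ∀ b, (v : V) ∈ ed (g v' b) := by
        intro b
        have : g v' b ∈ Finset.univ.image (g v) := by
          rw [h']
          exact Finset.mem_image_of_mem _ (Finset.mem_univ _)
        obtain ⟨c, -, hc⟩ := Finset.mem_image.mp this
        rw [← hc]
        exact hmemW v v.2 c
      have := hlin (g v' true) (g v' false) (fun h => by simpa using hg v' v'.2 h) v v'
        (hmem _) (hmem _) (hmemW v' v'.2 _) (hmemW v' v'.2 _)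
      rw [Subtype.ext this]
  obtain ⟨H, hH⟩ : ∃ H : Finset E → ℝ, ∀ s, H s = ∑ n ∈ Finset.piAntidiag Finset.univ d with
    configEdges n = s, configTerm k ed x y n := ⟨_, fun _ => rfl⟩
  simp only [sum_configTerm_eq_sum_fiber, ← hH]
  rw [← Fintype.sum_of_injective ψ hψ (fun i => H (ψ i)) H ?_ (fun _ => rfl)]
  · rw [Fintype.sum_sum_type, Fintype.sum_sum_type, add_assoc]
    congr 1
    · rw [Fintype.sum_unique]
      exact (hH ∅).trans (sum_configTerm_empty hk hcard hd x y)
    congr 1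
    · refine Finset.sum_congr rfl fun e _ => (hH {e}).trans ?_
      have := sum_configTerm_eq_fullSum (ed₀ := singleEdge k) (g := fun _ : Unit => e) hk hcard
        (hf₁ e) (Function.injective_of_subsingleton _) (fun _ => hed₁ e) hd x y
      rwa [Finset.univ_unique, Finset.image_singleton] at this
    · rw [← Finset.sum_coe_sort W fun v => fullSum k (twoEdges k) (x ∘ f₂ v) y d]
      refine Finset.sum_congr rfl fun v _ => (hH (Finset.univ.image (g v))).trans ?_
      exact sum_configTerm_eq_fullSum (ed₀ := twoEdges k) hk hcard
        (hf₂ v v.2) (hg v v.2) (hed₂ v v.2) hd x y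
  · intro s hs
    rw [hH]
    -- Three edges need at least `3k > d` generators.
    by_cases h3 : 3 ≤ s.card
    · refine sum_fiber_eq_zero_of_lt (by omega) hcard hflow (hdk.trans_le ?_) x y
      rw [mul_comm]
      exact Nat.mul_le_mul_left _ h3
    have h2 : s.card = 2 := by
      rcases Nat.lt_or_ge s.card 2 with h | h
      · interval_cases h' : s.card
        · exact absurd ⟨Sum.inl (), (Finset.card_eq_zero.mp h').symm⟩ hs
        · obtain ⟨e, rfl⟩ := Finset.card_eq_one.mp h'
          exact absurd ⟨Sum.inr (Sum.inl e), rfl⟩ hs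
      · omega
    obtain ⟨e, e', hne, rfl⟩ := Finset.card_eq_two.mp h2
    refine Finset.sum_eq_zero fun n hn => ?_
    by_contra h
    simp only [Finset.mem_filter, Finset.mem_piAntidiag] at hn
    have hdisj : ∀ v ∈ ed e, v ∉ ed e' := by
      intro v hv hv'
      obtain ⟨hvW, hvg⟩ := hW v e e' hv hv' hne
      exact hs ⟨Sum.inr (Sum.inr ⟨v, hvW⟩), hvg⟩
    obtain ⟨i, hi⟩ := mem_configEdges.mp (show e ∈ configEdges n by rw [hn.2]; simp)
    obtain ⟨j, hj⟩ := mem_configEdges.mp (show e' ∈ configEdges n by rw [hn.2]; simp)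
    -- For two disjoint edges the vertex set of one of them is closed under both, so no closed walk
    -- uses both.
    have := mem_iff_mem_of_configTerm_ne_zero hk hcard h (ed e : Set V)
      (fun a ha u hu v hv hue => by
      rw [hn.2, Finset.mem_insert, Finset.mem_singleton] at ha
      rcases ha with rfl | rfl
      · exact hv
      · exact absurd hu (hdisj u hue)) hi hj
    exact hdisj j (this.mp (mem_of_configTerm_ne_zero h hi)) (mem_of_configTerm_ne_zero h hj)

end

end

/-! ### Mixed differences in the loop weights -/

section

open HTensor

section

variable {V E : Type*} [Fintype V] [DecidableEq V] [Fintype E] [DecidableEq E]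
  {k : ℕ} {ed : E → Finset V}

/-- An isomorphism is an embedding of a substructure onto everything; this gives the invariance
under permutations of the vertices that makes contributions depend on numbers of degree-two vertices
only. -/
theorem fullSum_comp_equiv {V₀ E₀ : Type*} [Fintype V₀] [DecidableEq V₀] [Fintype E₀]
    [DecidableEq E₀] {ed₀ : E₀ → Finset V₀} (hk : 2 ≤ k) (hcard : ∀ e, (ed e).card = k)
    (f : V₀ ≃ V) (g : E₀ ≃ E) (hed : ∀ e, ed (g e) = (ed₀ e).image f) [Nonempty E₀] {d : ℕ}
    (hd : d ≠ 0) (x : V → ℝ) (y : ℝ) :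
    fullSum k ed₀ (x ∘ f) y d = fullSum k ed x y d := by
  rw [← sum_configTerm_eq_fullSum hk hcard f.injective g.injective hed hd x y,
    Finset.image_univ_of_surjective g.surjective, fullSum]

theorem fullSum_eq_zero_of_lt (hk : 1 ≤ k) (hcard : ∀ e, (ed e).card = k) (hflow : IsFlowFree ed)
    {d : ℕ} (hd : d < k * Fintype.card E) (x : V → ℝ) (y : ℝ) : fullSum k ed x y d = 0 :=
  sum_fiber_eq_zero_of_lt hk hcard hflow hd x y

/-- The mixed second difference of the full sum when the weights of the loops at `w` and `w'`
change from `a` to `2a`. -/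
noncomputable def mixedDiff (k : ℕ) (ed : E → Finset V) (x : V → ℝ) (y : ℝ) (d : ℕ) (w w' : V)
    (a : ℝ) : ℝ :=
  fullSum k ed (Function.update (Function.update x w (2 * a)) w' (2 * a)) y d -
    fullSum k ed (Function.update (Function.update x w (2 * a)) w' a) y d -
    fullSum k ed (Function.update (Function.update x w a) w' (2 * a)) y d +
    fullSum k ed (Function.update (Function.update x w a) w' a) y d

theorem prod_optWeight_update {w w' : V} (hw : w ≠ w') (x : V → ℝ) (y s t : ℝ)
    (n : V × Option E → ℕ) :
    ∏ p, optWeight ed (Function.update (Function.update x w s) w' t) y p ^ n p =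
      s ^ n (w, none) * t ^ n (w', none) *
        ∏ p ∈ (Finset.univ.erase (w, none)).erase (w', none), optWeight ed x y p ^ n p := by
  rw [← Finset.mul_prod_erase Finset.univ _ (Finset.mem_univ (w, none)),
    ← Finset.mul_prod_erase (Finset.univ.erase (w, none)) _
      (show (w', none) ∈ Finset.univ.erase (w, none) by simp [hw.symm]), ← mul_assoc]
  congr 1
  · simp [optWeight, Function.update_of_ne hw]
  · refine Finset.prod_congr rfl ?_
    rintro ⟨i, _ | e⟩ hp
    · simp only [Finset.mem_erase, ne_eq, Prod.mk.injEq, and_true, Finset.mem_univ] at hp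
      simp only [optWeight]
      rw [Function.update_of_ne hp.1, Function.update_of_ne hp.2]
    · rfl

/-- The loop weights at `w` and `w'` enter a term as `s ^ n * t ^ n'`, so doubling each of them and
taking differences gives the factors `2 ^ n - 1` and `2 ^ n' - 1`. Only families with loops at both
vertices survive. -/
theorem mixedDiff_eq_sum {w w' : V} (hw : w ≠ w') (x : V → ℝ) (y : ℝ) (d : ℕ) (a : ℝ) :
    mixedDiff k ed x y d w w' a =
      ∑ n ∈ Finset.piAntidiag Finset.univ d with configEdges n = Finset.univ,
        configTerm k ed (Function.update (Function.update x w a) w' a) y n *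
          ((2 ^ n (w, none) - 1) * (2 ^ n (w', none) - 1)) := by
  simp only [mixedDiff, fullSum]
  rw [← Finset.sum_sub_distrib, ← Finset.sum_sub_distrib, ← Finset.sum_add_distrib]
  refine Finset.sum_congr rfl fun n _ => ?_
  simp only [configTerm, prod_optWeight_update hw, mul_pow]
  ring

/-- A surviving family has `k` generators for each edge and two loops besides, which exceeds `d`. -/
theorem mixedDiff_eq_zero (hk : 1 ≤ k) (hcard : ∀ e, (ed e).card = k) (hflow : IsFlowFree ed)
    {w w' : V} (hw : w ≠ w') {d : ℕ} (hd : d < k * Fintype.card E + 2) (x : V → ℝ) (y a : ℝ) :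
    mixedDiff k ed x y d w w' a = 0 := by
  rw [mixedDiff_eq_sum hw]
  refine Finset.sum_eq_zero fun n hn => ?_
  by_contra h
  simp only [Finset.mem_filter, Finset.mem_piAntidiag] at hn
  have h1 := sum_loops_add_le hk hcard hflow (left_ne_zero_of_mul h)
  rw [hn.2, hn.1.1, Finset.card_univ] at h1
  have h2 : n (w, none) ≠ 0 := fun h0 => h (by simp [h0])
  have h3 : n (w', none) ≠ 0 := fun h0 => h (by simp [h0])
  have h4 : n (w, none) + n (w', none) ≤ ∑ v, n (v, none) := by
    rw [← Finset.sum_pair (f := fun v => n (v, none)) hw]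
    exact Finset.sum_le_univ_sum_of_nonneg fun _ => Nat.zero_le _
  omega

theorem configTerm_nonneg {x : V → ℝ} {y : ℝ} (hx : ∀ v, 0 ≤ x v) (hy : 0 ≤ y)
    (n : V × Option E → ℕ) : 0 ≤ configTerm k ed x y n := by
  refine mul_nonneg (configCoeff_nonneg n) (Finset.prod_nonneg ?_)
  rintro ⟨i, _ | e⟩ _
  · exact pow_nonneg (hx i) _
  · refine pow_nonneg ?_ _
    simp only [optWeight]
    split_ifs
    · exact hy
    · exact le_rfl

/-- Every generator of an edge once, and prescribed numbers of loops. -/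
def onceConfig (ed : E → Finset V) (l : V → ℕ) : V × Option E → ℕ
  | (i, none) => l i
  | (i, some e) => if i ∈ ed e then 1 else 0

theorem configArcs_onceConfig (l : V → ℕ) : configArcs k ed (onceConfig ed l) =
    ∑ e, completeArcs (ed e) + ∑ i, Finsupp.single (i, i) (l i * (k - 1)) := by
  rw [configArcs, Fintype.sum_prod_type]
  simp only [Fintype.sum_option, Finset.sum_add_distrib]
  rw [add_comm, Finset.sum_comm]
  congr 1
  · refine Finset.sum_congr rfl fun e _ => ?_
    simp only [onceConfig, ite_smul, one_smul, zero_smul]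
    rw [← Finset.sum_filter, Finset.filter_mem_eq_inter, Finset.univ_inter]
    rfl
  · refine Finset.sum_congr rfl fun i _ => ?_
    simp [onceConfig, optArcs, -Finsupp.single_tsub]

theorem sum_onceConfig (hcard : ∀ e, (ed e).card = k) (l : V → ℕ) :
    ∑ p, onceConfig ed l p = ∑ v, l v + k * Fintype.card E := by
  rw [Fintype.sum_prod_type]
  simp only [Fintype.sum_option, Finset.sum_add_distrib, onceConfig]
  congr 1
  rw [Finset.sum_comm]
  simp [hcard, mul_comm]

theorem degree_completeArcs (s : Finset V) :
    (completeArcs s).degree = s.card * (s.card - 1) := by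
  rw [completeArcs, map_sum, Finset.sum_const_nat (m := s.card - 1)]
  intro i hi
  rw [map_sum]
  simp [Finset.card_erase_of_mem hi]

/-- An explicit closed walk: the complete digraph on each edge has an Euler trail based at the
common vertex `r`; these trails are joined at `r`, and the loops are spliced in where the walk
passes. -/
theorem configCoeff_onceConfig_pos (hcard : ∀ e, (ed e).card = k) {r : V} (hr : ∀ e, r ∈ ed e)
    (hcover : ∀ v, ∃ e, v ∈ ed e) (l : V → ℕ) : 0 < configCoeff k ed (onceConfig ed l) := by
  refine configCoeff_pos (i := r) ?_ ?_
  · rw [configArcs_onceConfig]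
    refine EulerTrail.insert_closed_sum _ (fun v => v) _ ?_ (fun v _ => ?_)
      fun v _ => EulerTrail.loops v _
    · rw [← zero_add (∑ e, completeArcs (ed e))]
      exact EulerTrail.insert_closed_sum _ (fun _ => r) _ EulerTrail.nil (fun _ _ => Or.inl rfl)
        fun e _ => eulerTrail_completeArcs (hr e)
    · by_cases hv : v = r
      · exact Or.inl hv
      · obtain ⟨e, he⟩ := hcover v
        refine Or.inr ⟨r, ?_⟩
        rw [Finsupp.finsetSum_apply]
        exact (Finset.sum_pos' (fun _ _ => Nat.zero_le _) ⟨e, Finset.mem_univ _,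
          Nat.pos_of_ne_zero (completeArcs_apply_ne_zero he (hr e) hv)⟩).ne'
  · rw [configArcs_onceConfig, sum_onceConfig hcard, map_add, map_sum, map_sum]
    simp only [degree_completeArcs, hcard, Finsupp.degree_single, Finset.sum_const,
      Finset.card_univ, smul_eq_mul]
    rw [← Finset.sum_mul]
    ring

/-- All terms are nonnegative. The order is just large enough for the family with every edge
generator once and one loop at each of `w`, `w'`, whose term is positive. -/
theorem mixedDiff_pos (hcard : ∀ e, (ed e).card = k) {r : V} (hr : ∀ e, r ∈ ed e)
    (hcover : ∀ v, ∃ e, v ∈ ed e) {w w' : V} (hw : w ≠ w') {d : ℕ}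
    (hd : d = k * Fintype.card E + 2) {x : V → ℝ} {y a : ℝ} (hx : ∀ v, 0 < x v) (hy : 0 < y)
    (ha : 0 < a) : 0 < mixedDiff k ed x y d w w' a := by
  rw [mixedDiff_eq_sum hw]
  have hx' : ∀ v, 0 < Function.update (Function.update x w a) w' a v := by
    intro v
    rw [Function.update_apply, Function.update_apply]
    split_ifs
    · exact ha
    · exact ha
    · exact hx v
  have h2 : ∀ l : ℕ, (0 : ℝ) ≤ 2 ^ l - 1 := fun l => sub_nonneg.mpr (one_le_pow₀ (by norm_num))
  refine Finset.sum_pos' (fun n _ => mul_nonneg (configTerm_nonneg (fun v => (hx' v).le) hy.le n)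
    (mul_nonneg (h2 _) (h2 _))) ⟨onceConfig ed (Pi.single w 1 + Pi.single w' 1), ?_, ?_⟩
  · simp only [Finset.mem_filter, Finset.mem_piAntidiag, Finset.mem_univ, implies_true, and_true]
    refine ⟨?_, ?_⟩
    · rw [sum_onceConfig hcard, hd]
      simp only [Pi.add_apply, Finset.sum_add_distrib, Finset.sum_pi_single', Finset.mem_univ,
        if_true]
      ring
    · ext e
      simp only [mem_configEdges, Finset.mem_univ, iff_true]
      exact ⟨r, by simp [onceConfig, hr e]⟩
  · refine mul_pos (mul_pos (configCoeff_onceConfig_pos hcard hr hcover _) (Finset.prod_pos ?_)) ?_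
    · rintro ⟨i, _ | e⟩ _
      · exact pow_pos (hx' i) _
      · by_cases hi : i ∈ ed e
        · simp only [optWeight, hi, if_true]
          exact pow_pos hy _
        · simp [onceConfig, hi]
    · simp [onceConfig, hw, hw.symm]

end

theorem isFlowFree_singleEdge (k : ℕ) : IsFlowFree (singleEdge k) := by
  intro x _ _ h v e
  simpa using h v

theorem card_twoEdges {k : ℕ} (hk : 1 ≤ k) (b : Bool) : (twoEdges k b).card = k := by
  rw [twoEdges, Finset.card_insert_of_notMem (by simp),
    Finset.card_image_of_injective _ fun i j h => by simpa using h]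
  simp
  omega

/-- Every vertex other than the common one lies in a single edge, so its weight vanishes; each edge
sum then leaves only the weight at the common vertex. -/
theorem isFlowFree_twoEdges (k : ℕ) : IsFlowFree (twoEdges k) := by
  intro x h1 h2 h3
  have hsome : ∀ b j e, x (some (b, j)) e = 0 := by
    intro b j e
    by_cases hb : e = b
    · subst hb
      have h4 := h3 (some (e, j))
      rwa [Fintype.sum_eq_single e] at h4
      intro e' he'
      exact h1 _ _ (by simp [twoEdges, he'])
    · exact h1 _ _ (by simp [twoEdges, hb])
  rintro (_ | ⟨b, j⟩) e
  · have h4 := h2 e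
    rw [Fintype.sum_option, Finset.sum_eq_zero fun p _ => hsome p.1 p.2 e, add_zero] at h4
    exact h4
  · exact hsome b j e

/-- The weights of the loops in an edge with `δ` vertices of degree two. -/
def edgeProfile (k : ℕ) (a : ℝ) (δ : ℕ) : Fin k → ℝ := fun j => if (j : ℕ) < δ then 2 * a else a

/-- The contribution of an edge with `δ` vertices of degree two. -/
noncomputable def edgeSum (k : ℕ) (a y : ℝ) (d δ : ℕ) : ℝ :=
  fullSum k (singleEdge k) (edgeProfile k a δ) y d

/-- The weights of the loops in two adjacent edges with `δ` and `δ'` vertices of degree two. -/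
def pairProfile (k : ℕ) (a : ℝ) (δ δ' : ℕ) : Option (Bool × Fin (k - 1)) → ℝ
  | none => 2 * a
  | some (true, j) => if (j : ℕ) + 1 < δ then 2 * a else a
  | some (false, j) => if (j : ℕ) + 1 < δ' then 2 * a else a

/-- The contribution of two adjacent edges with `δ` and `δ'` vertices of degree two. -/
noncomputable def pairSum (k : ℕ) (a y : ℝ) (d δ δ' : ℕ) : ℝ :=
  fullSum k (twoEdges k) (pairProfile k a δ δ') y d

theorem card_singleEdge (k : ℕ) (e : Unit) : (singleEdge k e).card = k := by simp [singleEdge]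

/-- Raising `δ` by one doubles one more loop weight, so two successive steps are independent changes
at the vertices `δ` and `δ + 1`. -/
theorem edgeSum_second_diff {k : ℕ} (hk : 2 ≤ k) {a y : ℝ} {d δ : ℕ} (hd : d ≠ 0)
    (hδ : δ + 2 ≤ k) :
    edgeSum k a y d (δ + 2) - 2 * edgeSum k a y d (δ + 1) + edgeSum k a y d δ =
      mixedDiff k (singleEdge k) (edgeProfile k a δ) y d ⟨δ, by omega⟩ ⟨δ + 1, by omega⟩ a := by
  have hne : (⟨δ, by omega⟩ : Fin k) ≠ ⟨δ + 1, by omega⟩ := by simp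
  -- Doubling only the second of the two weights is, up to swapping the vertices, the same as
  -- doubling only the first; hence the coefficient `2`.
  have hsymm := fullSum_comp_equiv hk (card_singleEdge k)
    (Equiv.swap (⟨δ, by omega⟩ : Fin k) ⟨δ + 1, by omega⟩) (Equiv.refl Unit)
    (ed₀ := singleEdge k) (by intro e; simp [singleEdge]) hd
    (edgeProfile k a (δ + 1)) y
  have h1 : Function.update (Function.update (edgeProfile k a δ) ⟨δ, by omega⟩ (2 * a))
      ⟨δ + 1, by omega⟩ (2 * a) = edgeProfile k a (δ + 2) := by
    funext j
    simp only [Function.update_apply, edgeProfile, Fin.ext_iff]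
    grind
  have h2 : Function.update (Function.update (edgeProfile k a δ) ⟨δ, by omega⟩ (2 * a))
      ⟨δ + 1, by omega⟩ a = edgeProfile k a (δ + 1) := by
    funext j
    simp only [Function.update_apply, edgeProfile, Fin.ext_iff]
    grind
  have h3 : Function.update (Function.update (edgeProfile k a δ) ⟨δ, by omega⟩ a)
      ⟨δ + 1, by omega⟩ (2 * a) = edgeProfile k a (δ + 1) ∘
        Equiv.swap (⟨δ, by omega⟩ : Fin k) ⟨δ + 1, by omega⟩ := by
    funext j
    simp only [Function.update_apply, edgeProfile, Function.comp_apply, Equiv.swap_apply_def,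
      Fin.ext_iff]
    grind
  have h4 : Function.update (Function.update (edgeProfile k a δ) ⟨δ, by omega⟩ a)
      ⟨δ + 1, by omega⟩ a = edgeProfile k a δ := by
    funext j
    simp only [Function.update_apply, edgeProfile, Fin.ext_iff]
    grind
  rw [mixedDiff, h1, h2, h3, h4, hsymm]
  simp only [edgeSum]
  ring

theorem edgeSum_affine {k : ℕ} (hk : 2 ≤ k) {a y : ℝ} {d δ : ℕ} (hd : d ≠ 0) (hdk : d < k + 2)
    (hδ : δ + 2 ≤ k) :
    edgeSum k a y d (δ + 2) - 2 * edgeSum k a y d (δ + 1) + edgeSum k a y d δ = 0 := by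
  rw [edgeSum_second_diff hk hd hδ]
  exact mixedDiff_eq_zero (by omega) (card_singleEdge k) (isFlowFree_singleEdge k) (by simp)
    (by simpa using hdk) _ _ _

theorem edgeSum_convex {k : ℕ} (hk : 2 ≤ k) {a y : ℝ} (ha : 0 < a) (hy : 0 < y) {δ : ℕ}
    (hδ : δ + 2 ≤ k) : 0 < edgeSum k a y (k + 2) (δ + 2) - 2 * edgeSum k a y (k + 2) (δ + 1) +
      edgeSum k a y (k + 2) δ := by
  rw [edgeSum_second_diff hk (by omega) hδ]
  refine mixedDiff_pos (card_singleEdge k) (r := ⟨δ, by omega⟩)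
    (fun _ => Finset.mem_univ _) (fun _ => ⟨(), Finset.mem_univ _⟩) (by simp) (by simp)
    (fun j => ?_) hy ha
  simp only [edgeProfile]
  split_ifs <;> linarith

theorem pairSum_eq_zero {k : ℕ} (hk : 1 ≤ k) {a y : ℝ} {d δ δ' : ℕ} (hd : d < 2 * k) :
    pairSum k a y d δ δ' = 0 :=
  fullSum_eq_zero_of_lt hk (card_twoEdges hk) (isFlowFree_twoEdges k) (by simpa [mul_comm] using hd)
    _ _

theorem pairSum_comm {k : ℕ} (hk : 2 ≤ k) {a y : ℝ} {d δ δ' : ℕ} (hd : d ≠ 0) :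
    pairSum k a y d δ δ' = pairSum k a y d δ' δ := by
  have h := fullSum_comp_equiv hk (card_twoEdges (by omega))
    (Equiv.optionCongr (Equiv.prodCongr Equiv.boolNot (Equiv.refl (Fin (k - 1))))) Equiv.boolNot
    (ed₀ := twoEdges k) (fun e => by
      rw [twoEdges, twoEdges, Finset.image_insert, Finset.image_image]
      rfl) hd (pairProfile k a δ δ') y
  rw [pairSum, ← h, pairSum]
  congr 1
  funext p
  rcases p with _ | ⟨_ | _, j⟩ <;> rfl

/-- The common vertex is one of the degree-two vertices of both edges. The next doubled weight in an
edge with `δ + 1` such vertices is therefore at position `δ` among its other vertices. -/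
theorem pairSum_mixed_diff {k : ℕ} {a y : ℝ} {d δ δ' : ℕ} (hδ : δ + 1 < k) (hδ' : δ' + 1 < k) :
    pairSum k a y d (δ + 2) (δ' + 2) - pairSum k a y d (δ + 2) (δ' + 1) -
        pairSum k a y d (δ + 1) (δ' + 2) + pairSum k a y d (δ + 1) (δ' + 1) =
      mixedDiff k (twoEdges k) (pairProfile k a (δ + 1) (δ' + 1)) y d (some (true, ⟨δ, by omega⟩))
        (some (false, ⟨δ', by omega⟩)) a := by
  have key : ∀ s t : ℕ, s ≤ 1 → t ≤ 1 →
      Function.update (Function.update (pairProfile k a (δ + 1) (δ' + 1))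
        (some (true, ⟨δ, by omega⟩)) (if s = 1 then 2 * a else a)) (some (false, ⟨δ', by omega⟩))
        (if t = 1 then 2 * a else a) = pairProfile k a (δ + 1 + s) (δ' + 1 + t) := by
    intro s t hs ht
    funext p
    rcases p with _ | ⟨_ | _, j⟩
    · simp [pairProfile]
    · simp only [Function.update_apply, pairProfile, Option.some.injEq, Prod.mk.injEq, Fin.ext_iff]
      grind
    · simp only [Function.update_apply, pairProfile, Option.some.injEq, Prod.mk.injEq, Fin.ext_iff]
      grind
  have h1 := key 1 1 le_rfl le_rfl
  have h2 := key 1 0 le_rfl zero_le_one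
  have h3 := key 0 1 zero_le_one le_rfl
  have h4 := key 0 0 zero_le_one zero_le_one
  simp only [if_true, zero_ne_one, if_false] at h1 h2 h3 h4
  rw [mixedDiff, h1, h2, h3, h4]
  rfl

theorem pairSum_additive {k : ℕ} (hk : 2 ≤ k) {a y : ℝ} {d δ δ' : ℕ} (hd : d < 2 * k + 2)
    (hδ : δ + 1 < k) (hδ' : δ' + 1 < k) :
    pairSum k a y d (δ + 2) (δ' + 2) - pairSum k a y d (δ + 2) (δ' + 1) -
        pairSum k a y d (δ + 1) (δ' + 2) + pairSum k a y d (δ + 1) (δ' + 1) = 0 := by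
  rw [pairSum_mixed_diff hδ hδ']
  exact mixedDiff_eq_zero (by omega) (card_twoEdges (by omega)) (isFlowFree_twoEdges k) (by simp)
    (by simpa [mul_comm] using hd) _ _ _

theorem pairSum_supermodular {k : ℕ} (hk : 2 ≤ k) {a y : ℝ} (ha : 0 < a) (hy : 0 < y) {δ δ' : ℕ}
    (hδ : δ + 1 < k) (hδ' : δ' + 1 < k) :
    0 < pairSum k a y (2 * k + 2) (δ + 2) (δ' + 2) - pairSum k a y (2 * k + 2) (δ + 2) (δ' + 1) -
        pairSum k a y (2 * k + 2) (δ + 1) (δ' + 2) +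
        pairSum k a y (2 * k + 2) (δ + 1) (δ' + 1) := by
  rw [pairSum_mixed_diff hδ hδ']
  refine mixedDiff_pos (card_twoEdges (by omega)) (r := none)
    (fun _ => by simp [twoEdges]) ?_ (by simp) (by simp [mul_comm]) ?_ hy ha
  · rintro (_ | ⟨b, j⟩)
    · exact ⟨true, by simp [twoEdges]⟩
    · exact ⟨b, by simp [twoEdges]⟩
  · rintro (_ | ⟨_ | _, j⟩)
    · simpa [pairProfile] using ha
    · simp only [pairProfile]
      split_ifs <;> linarith
    · simp only [pairProfile]
      split_ifs <;> linarith

end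

/-! ### Numerical structure of hypertrees with degrees at most two -/

section

open HTensor

theorem exists_equiv_of_card_fiber {α β γ : Type*} [Fintype α] [Fintype β] [DecidableEq γ]
    (p : α → γ) (q : β → γ)
    (h : ∀ c, (Finset.univ.filter fun a => p a = c).card =
      (Finset.univ.filter fun b => q b = c).card) :
    ∃ e : α ≃ β, ∀ a, q (e a) = p a := by
  let e : ∀ c, {a // p a = c} ≃ {b // q b = c} := fun c => Fintype.equivOfCardEq (by
    rw [Fintype.card_subtype, Fintype.card_subtype, h])
  refine ⟨(Equiv.sigmaFiberEquiv p).symm.trans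
    ((Equiv.sigmaCongrRight e).trans (Equiv.sigmaFiberEquiv q)), fun a => ?_⟩
  exact (e (p a) ⟨a, rfl⟩).2

/-- With the distinguished elements listed first, the loop weights of an actual edge become the
standard profile for `δ`. -/
theorem exists_sorted_enumeration {V : Type*} [DecidableEq V] (s : Finset V) (P : V → Prop)
    [DecidablePred P] {N δ : ℕ} (hN : s.card = N) (hδ : (s.filter P).card = δ) :
    ∃ f : Fin N → V, Function.Injective f ∧ s = Finset.univ.image f ∧
      ∀ j, P (f j) ↔ (j : ℕ) < δ := by
  have hle : δ ≤ N := hN ▸ hδ ▸ Finset.card_filter_le _ _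
  have h1 : (Finset.univ.filter fun j : Fin N => (j : ℕ) < δ).card = δ := by
    rw [Fin.card_filter_val_lt, min_eq_right hle]
  have h2 : (Finset.univ.filter fun v : ↥s => P v).card = δ := by
    rw [← hδ, ← Finset.card_map (Function.Embedding.subtype (· ∈ s))]
    congr 1
    ext v
    simp [and_comm]
  obtain ⟨e, he⟩ := exists_equiv_of_card_fiber (fun j : Fin N => decide ((j : ℕ) < δ))
    (fun v : ↥s => decide (P v)) (fun c => by
      cases c
      · simp only [decide_eq_false_iff_not]
        have h3 := Finset.card_filter_add_card_filter_not (s := Finset.univ)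
          (fun j : Fin N => (j : ℕ) < δ)
        have h4 := Finset.card_filter_add_card_filter_not (s := Finset.univ) (fun v : ↥s => P v)
        rw [h1, Finset.card_univ, Fintype.card_fin] at h3
        rw [h2, Finset.card_univ, Fintype.card_coe, hN] at h4
        omega
      · simp only [decide_eq_true_eq]
        rw [h1, h2])
  refine ⟨fun j => e j, fun i j h => e.injective (Subtype.ext h), ?_, fun j => ?_⟩
  · ext v
    simp only [Finset.mem_image, Finset.mem_univ, true_and]
    exact ⟨fun hv => ⟨e.symm ⟨v, hv⟩, by simp⟩, fun ⟨j, hj⟩ => hj ▸ (e j).2⟩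
  · simpa using he j

section

variable {V E : Type*} [Fintype V] [DecidableEq V] [Fintype E] [DecidableEq E]
  {k : ℕ} {ed : E → Finset V}

/-- Two edges are adjacent in the line graph if they are different and share a vertex. -/
def lineGraph (ed : E → Finset V) : SimpleGraph E where
  Adj e e' := e ≠ e' ∧ ∃ v, v ∈ ed e ∧ v ∈ ed e'
  symm := ⟨fun _ _ h => ⟨h.1.symm, h.2.imp fun _ => And.symm⟩⟩
  loopless := ⟨fun _ h => h.1 rfl⟩

instance : DecidableRel (lineGraph ed).Adj := fun e e' =>
  inferInstanceAs (Decidable (e ≠ e' ∧ ∃ v, v ∈ ed e ∧ v ∈ ed e'))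

/-- The edges through a vertex. -/
def edgesAt (ed : E → Finset V) (v : V) : Finset E := Finset.univ.filter fun e => v ∈ ed e

theorem mem_edgesAt {v : V} {e : E} : e ∈ edgesAt ed v ↔ v ∈ ed e := by simp [edgesAt]

/-- The vertices of degree two. -/
def jointVerts (ed : E → Finset V) : Finset V := Finset.univ.filter fun v => (edgesAt ed v).card = 2

theorem mem_jointVerts {v : V} : v ∈ jointVerts ed ↔ (edgesAt ed v).card = 2 := by
  simp [jointVerts]

/-- The number of vertices of degree two of an edge. -/
def jointDegree (ed : E → Finset V) (e : E) : ℕ := ((ed e).filter (· ∈ jointVerts ed)).card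

/-- The numerical and connectivity properties of the hyperedges of a `k`-uniform hypertree. -/
structure IsEdgeTree (k : ℕ) (ed : E → Finset V) : Prop where
  card_edge : ∀ e, (ed e).card = k
  flowFree : IsFlowFree ed
  linear : ∀ e e', e ≠ e' → ∀ v w, v ∈ ed e → v ∈ ed e' → w ∈ ed e → w ∈ ed e' → v = w
  card_add : Fintype.card V + Fintype.card E = k * Fintype.card E + 1
  cover : ∀ v, ∃ e, v ∈ ed e
  connected : (lineGraph ed).Connected

namespace IsEdgeTree

theorem sum_card_edgesAt (h : IsEdgeTree k ed) :
    ∑ v, (edgesAt ed v).card = k * Fintype.card E := by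
  simp only [edgesAt, Finset.card_filter]
  rw [Finset.sum_comm]
  simp [h.card_edge, mul_comm]

theorem card_edgesAt_pos (h : IsEdgeTree k ed) (v : V) : 0 < (edgesAt ed v).card := by
  obtain ⟨e, he⟩ := h.cover v
  exact Finset.card_pos.mpr ⟨e, mem_edgesAt.mpr he⟩

/-- The degree sum `k * |E|` equals `|V|` plus the number of vertices of degree two; compare with
`card_add`. -/
theorem card_jointVerts (h : IsEdgeTree k ed) (h2 : ∀ v, (edgesAt ed v).card ≤ 2) :
    (jointVerts ed).card + 1 = Fintype.card E := by
  have h1 : ∀ v, (edgesAt ed v).card = 1 + if v ∈ jointVerts ed then 1 else 0 := by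
    intro v
    have := h2 v
    have := h.card_edgesAt_pos v
    have h4 := mem_jointVerts (ed := ed) (v := v)
    split_ifs with hv
    · rw [h4.mp hv]
    · rw [h4] at hv
      omega
  have h3 := h.sum_card_edgesAt
  rw [Finset.sum_congr rfl fun v _ => h1 v, Finset.sum_add_distrib] at h3
  simp only [Finset.sum_const, Finset.card_univ, smul_eq_mul, mul_one, Finset.sum_boole,
    Nat.cast_id, Finset.filter_mem_eq_inter, Finset.univ_inter] at h3
  have := h.card_add
  omega

/-- All degrees are one or two, and the numbers of both kinds are fixed by the parameters. Thus the
vertex part cannot distinguish such hypertrees. -/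
theorem sum_pow_card_edgesAt (h : IsEdgeTree k ed) (h2 : ∀ v, (edgesAt ed v).card ≤ 2) (a c : ℝ)
    (d : ℕ) : ∑ v, c * (a * (edgesAt ed v).card) ^ d =
      Fintype.card V * (c * a ^ d) + (Fintype.card E - 1) * (c * ((2 * a) ^ d - a ^ d)) := by
  have h1 : ∀ v, c * (a * (edgesAt ed v).card) ^ d = c * a ^ d +
      if v ∈ jointVerts ed then c * ((2 * a) ^ d - a ^ d) else 0 := by
    intro v
    have h3 := h2 v
    have h4 := h.card_edgesAt_pos v
    split_ifs with hv
    · rw [mem_jointVerts.mp hv]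
      push_cast
      ring
    · rw [mem_jointVerts] at hv
      have : (edgesAt ed v).card = 1 := by omega
      rw [this]
      simp
  rw [Finset.sum_congr rfl fun v _ => h1 v, Finset.sum_add_distrib, ← Finset.sum_filter,
    Finset.filter_mem_eq_inter, Finset.univ_inter, ← h.card_jointVerts h2]
  simp

theorem exists_pair_choice (ed : E → Finset V) (hE : Nonempty E) : ∃ g : V → Bool → E,
    ∀ v ∈ jointVerts ed, Function.Injective (g v) ∧ Finset.univ.image (g v) = edgesAt ed v := by
  have : ∀ v, ∃ g : Bool → E, v ∈ jointVerts ed →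
      Function.Injective g ∧ Finset.univ.image g = edgesAt ed v := by
    intro v
    by_cases hv : v ∈ jointVerts ed
    · obtain ⟨e, e', hne, h⟩ := Finset.card_eq_two.mp (mem_jointVerts.mp hv)
      refine ⟨fun b => if b then e else e', fun _ => ⟨?_, ?_⟩⟩
      · rintro (_ | _) (_ | _) h' <;> simp [hne, hne.symm] at h' ⊢
      · rw [h]
        ext x
        simp [eq_comm]
    · exact ⟨fun _ => hE.some, fun h => absurd h hv⟩
  choose g hg using this
  exact ⟨g, hg⟩

/-- The instance of `sum_configTerm_eq` in which the gluing vertices are those of degree two. The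
remaining dependence on the hypertree is through the numbers `jointDegree` of single and of adjacent
edges. -/
theorem sum_configTerm (h : IsEdgeTree k ed) (hk : 2 ≤ k) (h2 : ∀ v, (edgesAt ed v).card ≤ 2)
    {g : V → Bool → E} (hg : ∀ v ∈ jointVerts ed, Function.Injective (g v) ∧
      Finset.univ.image (g v) = edgesAt ed v) {d : ℕ} (hd : d ≠ 0) (hdk : d < 3 * k) (a y : ℝ) :
    ∑ n ∈ Finset.piAntidiag Finset.univ d,
        configTerm k ed (fun v => a * (edgesAt ed v).card) y n =
      Fintype.card V * (vertexCoeff k d * a ^ d) +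
        (Fintype.card E - 1) * (vertexCoeff k d * ((2 * a) ^ d - a ^ d)) +
      ∑ e, edgeSum k a y d (jointDegree ed e) +
      ∑ v ∈ jointVerts ed,
        pairSum k a y d (jointDegree ed (g v true)) (jointDegree ed (g v false)) := by
  have hmem : ∀ v ∈ jointVerts ed, ∀ b, v ∈ ed (g v b) := by
    intro v hv b
    rw [← mem_edgesAt, ← (hg v hv).2]
    exact Finset.mem_image_of_mem _ (Finset.mem_univ _)
  have hx : ∀ v, a * ((edgesAt ed v).card : ℝ) = if v ∈ jointVerts ed then 2 * a else a := by
    intro v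
    have h3 := h2 v
    have h4 := h.card_edgesAt_pos v
    split_ifs with hv
    · rw [mem_jointVerts.mp hv]
      push_cast
      ring
    · rw [mem_jointVerts] at hv
      have : (edgesAt ed v).card = 1 := by omega
      rw [this]
      simp
  choose f₁ hf₁ hed₁ hP₁ using fun e => exists_sorted_enumeration (ed e) (· ∈ jointVerts ed)
    (h.card_edge e) (rfl : _ = jointDegree ed e)
  -- The vertices other than `v` are enumerated in each edge through `v`; the `- 1` removes `v`,
  -- itself of degree two, from the count.
  have hex : ∀ v, ∃ f : Bool → Fin (k - 1) → V, v ∈ jointVerts ed → ∀ b,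
      Function.Injective (f b) ∧ (ed (g v b)).erase v = Finset.univ.image (f b) ∧
        ∀ j, f b j ∈ jointVerts ed ↔ (j : ℕ) < jointDegree ed (g v b) - 1 := by
    intro v
    by_cases hv : v ∈ jointVerts ed
    · have : ∀ b, ∃ f : Fin (k - 1) → V, Function.Injective f ∧
          (ed (g v b)).erase v = Finset.univ.image f ∧
            ∀ j, f j ∈ jointVerts ed ↔ (j : ℕ) < jointDegree ed (g v b) - 1 := fun b =>
        exists_sorted_enumeration _ (· ∈ jointVerts ed)
          (by rw [Finset.card_erase_of_mem (hmem v hv b), h.card_edge])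
          (by rw [Finset.filter_erase, Finset.card_erase_of_mem (by simp [hmem v hv b, hv]),
            jointDegree])
      choose f hf using this
      exact ⟨f, fun _ => hf⟩
    · exact ⟨fun _ _ => v, fun h => absurd h hv⟩
  choose f hf using hex
  let f₂ : V → Option (Bool × Fin (k - 1)) → V := fun v o => o.elim v fun p => f v p.1 p.2
  have hfmem : ∀ v ∈ jointVerts ed, ∀ b j, f v b j ≠ v ∧ f v b j ∈ ed (g v b) := by
    intro v hv b j
    rw [← Finset.mem_erase, (hf v hv b).2.1]
    exact Finset.mem_image_of_mem _ (Finset.mem_univ _)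
  rw [sum_configTerm_eq hk h.card_edge h.flowFree h.linear hf₁ hed₁ (W := jointVerts ed) (g := g)
    (f₂ := f₂) ?_ (fun v hv => (hg v hv).1) ?_ ?_ (fun _ => rfl) hd hdk,
    h.sum_pow_card_edgesAt h2]
  · refine congrArg₂ _ (congrArg₂ _ rfl ?_) ?_
    · refine Finset.sum_congr rfl fun e _ => ?_
      rw [edgeSum]
      congr 1
      funext j
      simp only [Function.comp_apply, hx, hP₁, edgeProfile]
    · refine Finset.sum_congr rfl fun v hv => ?_
      rw [pairSum]
      congr 1
      funext p
      rcases p with _ | ⟨b, j⟩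
      · simp [f₂, hx, hv, pairProfile]
      · have h3 := (hf v hv b).2.2 j
        have h4 : (j : ℕ) < jointDegree ed (g v b) - 1 ↔ (j : ℕ) + 1 < jointDegree ed (g v b) := by
          omega
        rw [h4] at h3
        cases b <;> simp only [Function.comp_apply, f₂, Option.elim, hx, h3, pairProfile]
  · intro v e e' he he' hne
    have h3 : {e, e'} ⊆ edgesAt ed v := by
      intro x hx
      rw [Finset.mem_insert, Finset.mem_singleton] at hx
      rcases hx with rfl | rfl
      · exact mem_edgesAt.mpr he
      · exact mem_edgesAt.mpr he'
    have h4 : {e, e'} = edgesAt ed v :=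
      Finset.eq_of_subset_of_card_le h3 ((h2 v).trans (Finset.card_pair hne).ge)
    have h5 : v ∈ jointVerts ed := mem_jointVerts.mpr (h4 ▸ Finset.card_pair hne)
    exact ⟨h5, (hg v h5).2.trans h4.symm⟩
  · rintro v hv (_ | ⟨b, j⟩) (_ | ⟨b', j'⟩) heq
    · rfl
    · exact absurd heq.symm (hfmem v hv b' j').1
    · exact absurd heq (hfmem v hv b j).1
    · replace heq : f v b j = f v b' j' := heq
      by_cases hb : b = b'
      · subst hb
        rw [(hf v hv b).1 heq]
      · refine absurd ?_ (hfmem v hv b j).1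
        exact h.linear _ _ (fun hgg => hb ((hg v hv).1 hgg)) _ _ (hfmem v hv b j).2
          (heq ▸ (hfmem v hv b' j').2) (hmem v hv b) (hmem v hv b')
  · intro v hv b
    rw [twoEdges, Finset.image_insert, Finset.image_image]
    change ed (g v b) = insert v (Finset.univ.image (f v b))
    rw [← (hf v hv b).2.1, Finset.insert_erase (hmem v hv b)]

/-- Double counting: each of the `|E| - 1` vertices of degree two lies in two edges. -/
theorem sum_jointDegree (h : IsEdgeTree k ed) (h2 : ∀ v, (edgesAt ed v).card ≤ 2) :
    ∑ e, jointDegree ed e + 2 = 2 * Fintype.card E := by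
  have h1 : ∑ e, jointDegree ed e = ∑ v ∈ jointVerts ed, (edgesAt ed v).card := by
    have h3 : ∀ e, jointDegree ed e = ∑ v ∈ jointVerts ed, if v ∈ ed e then 1 else 0 := by
      intro e
      rw [jointDegree, ← Finset.card_filter]
      congr 1
      ext v
      simp [and_comm]
    rw [Finset.sum_congr rfl fun e _ => h3 e, Finset.sum_comm]
    refine Finset.sum_congr rfl fun v _ => ?_
    rw [edgesAt, Finset.card_filter]
  rw [h1, Finset.sum_congr rfl fun v hv => mem_jointVerts.mp hv, Finset.sum_const, smul_eq_mul,
    ← h.card_jointVerts h2]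
  ring

/-- A neighbour corresponds to the vertex shared with it: linearity makes this vertex unique, and
the degree bound makes the neighbour unique. -/
theorem jointDegree_eq_degree (h : IsEdgeTree k ed) (h2 : ∀ v, (edgesAt ed v).card ≤ 2) (e : E) :
    jointDegree ed e = (lineGraph ed).degree e := by
  have hadj : ∀ e' ∈ (lineGraph ed).neighborFinset e, e ≠ e' ∧ ∃ v, v ∈ ed e ∧ v ∈ ed e' :=
    fun e' he' => (SimpleGraph.mem_neighborFinset _ _ _).mp he'
  have hpair : ∀ v e', v ∈ ed e → v ∈ ed e' → e ≠ e' → edgesAt ed v = {e, e'} := by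
    intro v e' he he' hne
    refine (Finset.eq_of_subset_of_card_le ?_ ((h2 v).trans (Finset.card_pair hne).ge)).symm
    intro x hx
    rw [Finset.mem_insert, Finset.mem_singleton] at hx
    rcases hx with rfl | rfl
    · exact mem_edgesAt.mpr he
    · exact mem_edgesAt.mpr he'
  symm
  refine Finset.card_bij (fun e' he' => (hadj e' he').2.choose) ?_ ?_ ?_
  · intro e' he'
    have hv := (hadj e' he').2.choose_spec
    rw [Finset.mem_filter, mem_jointVerts, hpair _ e' hv.1 hv.2 (hadj e' he').1,
      Finset.card_pair (hadj e' he').1]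
    exact ⟨hv.1, rfl⟩
  · intro e' he' e'' he'' heq
    have hv := (hadj e' he').2.choose_spec
    have hv' := (hadj e'' he'').2.choose_spec
    rw [← heq] at hv'
    have h3 := mem_edgesAt.mpr hv'.2
    rw [hpair _ e' hv.1 hv.2 (hadj e' he').1, Finset.mem_insert, Finset.mem_singleton] at h3
    exact (h3.resolve_left (hadj e'' he'').1.symm).symm
  · intro v hv
    rw [Finset.mem_filter, mem_jointVerts] at hv
    obtain ⟨e', he', hne⟩ := Finset.exists_mem_ne (by omega : 1 < (edgesAt ed v).card) e
    have he'' : e' ∈ (lineGraph ed).neighborFinset e :=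
      (SimpleGraph.mem_neighborFinset _ _ _).mpr ⟨hne.symm, v, hv.1, mem_edgesAt.mp he'⟩
    have hw := (hadj e' he'').2.choose_spec
    exact ⟨e', he'', h.linear e e' hne.symm _ _ hw.1 hw.2 hv.1 (mem_edgesAt.mp he')⟩

end IsEdgeTree

end

end

/-! ### Sums of convex functions and the excess -/

section

open HTensor

/-- The sum of the differences of a function from its linear interpolation at `1` and `2`. -/
theorem sum_eq_interpolation {E : Type*} [Fintype E] {f : E → ℕ}
    (hf : ∑ e, f e + 2 = 2 * Fintype.card E) (φ : ℕ → ℝ) :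
    ∑ e, φ (f e) = Fintype.card E * φ 2 - 2 * (φ 2 - φ 1) +
      ∑ e, (φ (f e) - φ 2 - ((f e : ℝ) - 2) * (φ 2 - φ 1)) := by
  have h : ∑ e, (f e : ℝ) + 2 = 2 * Fintype.card E := by exact_mod_cast hf
  rw [Finset.sum_sub_distrib, Finset.sum_sub_distrib, ← Finset.sum_mul, Finset.sum_sub_distrib]
  simp only [Finset.sum_const, Finset.card_univ, nsmul_eq_mul]
  linear_combination (φ 2 - φ 1) * h

/-- The total amount by which the values of a function exceed two. -/
def excess {E : Type*} [Fintype E] (f : E → ℕ) : ℕ := ∑ e, (f e - 2)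

theorem le_two_of_excess_eq_zero {E : Type*} [Fintype E] {f : E → ℕ} (hX : excess f = 0) (e : E) :
    f e ≤ 2 := by
  have := (Finset.sum_eq_zero_iff.mp hX) e (Finset.mem_univ e)
  omega

theorem exists_eq_three_of_excess_eq_one {E : Type*} [Fintype E] {f : E → ℕ}
    (hX : excess f = 1) : ∃ c, f c = 3 ∧ ∀ e, e ≠ c → f e ≤ 2 := by
  classical
  obtain ⟨c, -, hc⟩ := Finset.exists_ne_zero_of_sum_ne_zero (show ∑ e, (f e - 2) ≠ 0 by
    rw [← excess, hX]; exact one_ne_zero)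
  rw [excess, ← Finset.add_sum_erase _ _ (Finset.mem_univ c)] at hX
  refine ⟨c, by omega, fun e he => ?_⟩
  have h0 : ∑ e ∈ Finset.univ.erase c, (f e - 2) = 0 := by omega
  have := Finset.sum_eq_zero_iff.mp h0 e (by simp [he])
  omega

theorem sum_of_excess_eq_zero {E : Type*} [Fintype E] {f : E → ℕ}
    (hf : ∑ e, f e + 2 = 2 * Fintype.card E) (h1 : ∀ e, 1 ≤ f e) (hX : excess f = 0)
    (φ : ℕ → ℝ) : ∑ e, φ (f e) = Fintype.card E * φ 2 - 2 * (φ 2 - φ 1) := by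
  rw [sum_eq_interpolation hf, Finset.sum_eq_zero, add_zero]
  intro e _
  have h2 := le_two_of_excess_eq_zero hX e
  have h3 := h1 e
  interval_cases f e <;> norm_num

theorem sum_of_excess_eq_one {E : Type*} [Fintype E] {f : E → ℕ}
    (hf : ∑ e, f e + 2 = 2 * Fintype.card E) (h1 : ∀ e, 1 ≤ f e) (hX : excess f = 1)
    (φ : ℕ → ℝ) : ∑ e, φ (f e) = Fintype.card E * φ 2 - 2 * (φ 2 - φ 1) +
      (φ 3 - 2 * φ 2 + φ 1) := by
  obtain ⟨c, hc, hle⟩ := exists_eq_three_of_excess_eq_one hX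
  rw [sum_eq_interpolation hf, Fintype.sum_eq_single c]
  · rw [hc]
    push_cast
    ring
  · intro e he
    have h2 := hle e he
    have h3 := h1 e
    interval_cases f e <;> norm_num

/-- A function with vanishing second differences is affine. -/
theorem sum_of_affine {E : Type*} [Fintype E] {f : E → ℕ} {k : ℕ}
    (hf : ∑ e, f e + 2 = 2 * Fintype.card E) (h1 : ∀ e, 1 ≤ f e) (hk : ∀ e, f e ≤ k)
    (φ : ℕ → ℝ) (hφ : ∀ δ, δ + 2 ≤ k → φ (δ + 2) - 2 * φ (δ + 1) + φ δ = 0) :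
    ∑ e, φ (f e) = Fintype.card E * φ 2 - 2 * (φ 2 - φ 1) := by
  have key : ∀ δ, δ + 2 ≤ k → φ (δ + 1) - φ 2 - (((δ + 1 : ℕ) : ℝ) - 2) * (φ 2 - φ 1) = 0 ∧
      φ (δ + 2) - φ (δ + 1) = φ 2 - φ 1 := by
    intro δ
    induction δ with
    | zero => intro _; refine ⟨by push_cast; ring, by norm_num⟩
    | succ δ ih =>
      intro hδ
      obtain ⟨h2, h3⟩ := ih (by omega)
      have h4 := hφ (δ + 1) hδ
      push_cast at h2 ⊢
      refine ⟨?_, ?_⟩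
      · rw [show δ + 1 + 1 = δ + 2 from rfl]
        linear_combination h2 + h3
      · rw [show δ + 1 + 2 = δ + 3 from rfl, show δ + 1 + 1 = δ + 2 from rfl] at *
        linear_combination h4 + h3
  rw [sum_eq_interpolation hf, Finset.sum_eq_zero, add_zero]
  intro e _
  have h2 := h1 e
  have h3 := hk e
  obtain ⟨δ, hδ⟩ : ∃ δ, f e = δ + 1 := ⟨f e - 1, by omega⟩
  rw [hδ] at h3 ⊢
  rcases Nat.lt_or_ge δ 2 with h | h
  · interval_cases δ <;> norm_num
  · obtain ⟨δ, rfl⟩ : ∃ δ', δ = δ' + 1 := ⟨δ - 1, by omega⟩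
    obtain ⟨h4, h5⟩ := key δ (by omega)
    push_cast at h4 ⊢
    rw [show δ + 1 + 1 = δ + 2 from rfl]
    linear_combination h4 + h5

/-- The line through the values at `1` and `2` is summed exactly because the sum of `f` is fixed. By
convexity a value at `δ ≥ 3` exceeds this line by at least `δ - 2` times the second difference at
`1, 2, 3`. For excess at most one this bound is an equality, see `sum_of_excess_eq_zero` and
`sum_of_excess_eq_one`. -/
theorem le_sum_of_convex {E : Type*} [Fintype E] {f : E → ℕ} {k : ℕ}
    (hf : ∑ e, f e + 2 = 2 * Fintype.card E) (h1 : ∀ e, 1 ≤ f e) (hk : ∀ e, f e ≤ k)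
    (φ : ℕ → ℝ) (hφ : ∀ δ, δ + 2 ≤ k → 0 ≤ φ (δ + 2) - 2 * φ (δ + 1) + φ δ) :
    Fintype.card E * φ 2 - 2 * (φ 2 - φ 1) + excess f * (φ 3 - 2 * φ 2 + φ 1) ≤
      ∑ e, φ (f e) := by
  have key : ∀ δ, δ + 3 ≤ k → (δ + 1 : ℝ) * (φ 3 - 2 * φ 2 + φ 1) ≤
        φ (δ + 3) - φ 2 - ((δ + 1 : ℝ)) * (φ 2 - φ 1) ∧ φ 3 - φ 2 ≤ φ (δ + 3) - φ (δ + 2) := by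
    intro δ
    induction δ with
    | zero => intro _; exact ⟨by norm_num; linarith, by norm_num⟩
    | succ δ ih =>
      intro hδ
      obtain ⟨h2, h3⟩ := ih (by omega)
      have h4 := hφ (δ + 2) (by omega)
      push_cast at h2 ⊢
      rw [show δ + 1 + 3 = δ + 4 from rfl, show δ + 1 + 2 = δ + 3 from rfl]
      rw [show δ + 2 + 2 = δ + 4 from rfl, show δ + 2 + 1 = δ + 3 from rfl] at h4
      exact ⟨by linarith, by linarith⟩
  rw [sum_eq_interpolation hf, excess, Nat.cast_sum, Finset.sum_mul]
  refine add_le_add_right (Finset.sum_le_sum fun e _ => ?_) _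
  have h2 := h1 e
  have h3 := hk e
  rcases Nat.lt_or_ge (f e) 3 with h | h
  · interval_cases f e <;> norm_num
  · obtain ⟨δ, hδ⟩ : ∃ δ, f e = δ + 3 := ⟨f e - 3, by omega⟩
    rw [hδ] at h3 ⊢
    have h4 := (key δ h3).1
    rw [show δ + 3 - 2 = δ + 1 by omega]
    push_cast
    rw [show (δ : ℝ) + 3 - 2 = δ + 1 by ring]
    exact h4

section

variable {V E : Type*} [Fintype V] [DecidableEq V] [Fintype E] [DecidableEq E]
  {k : ℕ} {ed : E → Finset V}

/-- The sum of the contributions to the `d`-th trace of the tensor `𝒜_a`. -/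
noncomputable def momentSum (k : ℕ) (ed : E → Finset V) (a : ℝ) (d : ℕ) : ℝ :=
  ∑ n ∈ Finset.piAntidiag Finset.univ d,
    configTerm k ed (fun v => a * (edgesAt ed v).card) (1 - a) n

/-- The vertices that lie in an edge with three and in an edge with one vertex of degree two. -/
def centralLeafVerts (ed : E → Finset V) : Finset V := Finset.univ.filter fun v =>
  ∃ e e', v ∈ ed e ∧ v ∈ ed e' ∧ jointDegree ed e = 3 ∧ jointDegree ed e' = 1

namespace IsEdgeTree

theorem jointDegree_le (h : IsEdgeTree k ed) (e : E) : jointDegree ed e ≤ k :=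
  (Finset.card_filter_le _ _).trans (h.card_edge e).le

theorem one_le_jointDegree (h : IsEdgeTree k ed) (h2 : ∀ v, (edgesAt ed v).card ≤ 2)
    (hm : 2 ≤ Fintype.card E) (e : E) : 1 ≤ jointDegree ed e := by
  have : Nontrivial E := Fintype.one_lt_card_iff_nontrivial.mp hm
  rw [h.jointDegree_eq_degree h2]
  exact h.connected.preconnected.degree_pos_of_nontrivial e

theorem edgesAt_eq_pair (h2 : ∀ v, (edgesAt ed v).card ≤ 2) {v : V} {e e' : E} (he : v ∈ ed e)
    (he' : v ∈ ed e') (hne : e ≠ e') : edgesAt ed v = {e, e'} := by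
  refine (Finset.eq_of_subset_of_card_le ?_ ((h2 v).trans (Finset.card_pair hne).ge)).symm
  intro x hx
  rw [Finset.mem_insert, Finset.mem_singleton] at hx
  rcases hx with rfl | rfl
  · exact mem_edgesAt.mpr he
  · exact mem_edgesAt.mpr he'

/-- Two edges of degree one in the line graph are not adjacent. -/
theorem not_adj_of_degree_eq_one (h : IsEdgeTree k ed) (hm : 3 ≤ Fintype.card E) {e e' : E}
    (he : (lineGraph ed).degree e = 1) (he' : (lineGraph ed).degree e' = 1) :
    ¬ (lineGraph ed).Adj e e' := by
  intro hadj
  have hclosed : ∀ x, (lineGraph ed).Reachable e x → x = e ∨ x = e' := by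
    intro x hx
    rw [SimpleGraph.reachable_iff_reflTransGen] at hx
    induction hx with
    | refl => exact Or.inl rfl
    | tail _ hbc ih =>
      rcases ih with rfl | rfl
      · exact Or.inr ((SimpleGraph.degree_eq_one_iff_existsUnique_adj.mp he).unique hbc hadj)
      · exact Or.inl ((SimpleGraph.degree_eq_one_iff_existsUnique_adj.mp he').unique hbc hadj.symm)
  have hsub : (Finset.univ : Finset E) ⊆ {e, e'} := fun x _ => by
    simpa using hclosed x (h.connected.preconnected e x)
  have := (Finset.card_le_card hsub).trans Finset.card_le_two
  rw [Finset.card_univ] at this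
  omega

/-- Double counting of the incidences between edges and vertices of degree two. -/
theorem sum_pair_eq {g : V → Bool → E} (hg : ∀ v ∈ jointVerts ed, Function.Injective (g v) ∧
      Finset.univ.image (g v) = edgesAt ed v) (φ : E → ℝ) :
    ∑ v ∈ jointVerts ed, (φ (g v true) + φ (g v false)) = ∑ e, jointDegree ed e * φ e := by
  have h1 : ∀ v ∈ jointVerts ed, φ (g v true) + φ (g v false) =
      ∑ e, if v ∈ ed e then φ e else 0 := by
    intro v hv
    rw [← Finset.sum_filter]
    change _ = ∑ e ∈ edgesAt ed v, φ e
    rw [← (hg v hv).2, Finset.sum_image (hg v hv).1.injOn, Fintype.sum_bool]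
  rw [Finset.sum_congr rfl h1, Finset.sum_comm]
  refine Finset.sum_congr rfl fun e _ => ?_
  rw [← Finset.sum_filter, Finset.sum_const, nsmul_eq_mul, jointDegree]
  congr 3
  ext v
  simp [and_comm]

end IsEdgeTree

end

end

/-! ### Comparison of the moments of two hypertrees -/

section

open HTensor

section

variable {V E : Type*} [Fintype V] [DecidableEq V] [Fintype E] [DecidableEq E]
  {k : ℕ} {ed : E → Finset V}

namespace IsEdgeTree

/-- For the pairs of values that occur, `φ i j` is the sum of the one-edge terms `φ i 2 - φ 2 2 / 2`
and `φ j 2 - φ 2 2 / 2`, except for the pair `{3, 1}`, which needs a correction. The one-edge terms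
add up to a sum of `ψ` over the edges, which depends only on the number of edges. -/
theorem sum_pair_of_excess_eq_one (h : IsEdgeTree k ed) (h2 : ∀ v, (edgesAt ed v).card ≤ 2)
    (hm : 3 ≤ Fintype.card E) (hX : excess (jointDegree ed) = 1) {g : V → Bool → E}
    (hg : ∀ v ∈ jointVerts ed, Function.Injective (g v) ∧ Finset.univ.image (g v) = edgesAt ed v)
    (φ : ℕ → ℕ → ℝ) (hφ : ∀ i j, φ i j = φ j i) (ψ : ℕ → ℝ)
    (hψ : ∀ i, ψ i = i * (φ i 2 - φ 2 2 / 2)) :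
    ∑ v ∈ jointVerts ed, φ (jointDegree ed (g v true)) (jointDegree ed (g v false)) =
      Fintype.card E * ψ 2 - 2 * (ψ 2 - ψ 1) + (ψ 3 - 2 * ψ 2 + ψ 1) +
        (centralLeafVerts ed).card * (φ 3 1 - φ 3 2 - φ 2 1 + φ 2 2) := by
  obtain ⟨c, hc, hle⟩ := exists_eq_three_of_excess_eq_one hX
  have h1 := h.one_le_jointDegree h2 (by omega)
  have hmem : ∀ v ∈ jointVerts ed, ∀ b, v ∈ ed (g v b) := by
    intro v hv b
    rw [← mem_edgesAt, ← (hg v hv).2]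
    exact Finset.mem_image_of_mem _ (Finset.mem_univ _)
  have hne : ∀ v ∈ jointVerts ed, g v true ≠ g v false := fun v hv hgg => by
    simpa using (hg v hv).1 hgg
  have hsub : centralLeafVerts ed ⊆ jointVerts ed := by
    intro v hv
    obtain ⟨e, e', he, he', h3, h1'⟩ := (Finset.mem_filter.mp hv).2
    have hee : e ≠ e' := by rintro rfl; omega
    rw [mem_jointVerts, edgesAt_eq_pair h2 he he' hee, Finset.card_pair hee]
  have hcl : ∀ v ∈ jointVerts ed, v ∈ centralLeafVerts ed ↔
      (jointDegree ed (g v true) = 3 ∧ jointDegree ed (g v false) = 1) ∨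
        (jointDegree ed (g v true) = 1 ∧ jointDegree ed (g v false) = 3) := by
    intro v hv
    rw [centralLeafVerts, Finset.mem_filter]
    constructor
    · rintro ⟨-, e, e', he, he', h3, h1'⟩
      rw [← mem_edgesAt, ← (hg v hv).2, Finset.mem_image] at he he'
      obtain ⟨b, -, rfl⟩ := he
      obtain ⟨b', -, rfl⟩ := he'
      cases b <;> cases b' <;> simp_all
    · rintro (⟨h3, h1'⟩ | ⟨h1', h3⟩)
      · exact ⟨Finset.mem_univ _, _, _, hmem v hv true, hmem v hv false, h3, h1'⟩
      · exact ⟨Finset.mem_univ _, _, _, hmem v hv false, hmem v hv true, h3, h1'⟩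
  have key : ∀ v ∈ jointVerts ed,
      φ (jointDegree ed (g v true)) (jointDegree ed (g v false)) =
        (φ (jointDegree ed (g v true)) 2 - φ 2 2 / 2 +
          (φ (jointDegree ed (g v false)) 2 - φ 2 2 / 2)) +
        if v ∈ centralLeafVerts ed then φ 3 1 - φ 3 2 - φ 2 1 + φ 2 2 else 0 := by
    intro v hv
    have hiff := hcl v hv
    have ht := h1 (g v true)
    have hf := h1 (g v false)
    -- Two adjacent leaves would form a whole component of the connected line graph, which has at
    -- least three vertices.
    have h11 : ¬ (jointDegree ed (g v true) = 1 ∧ jointDegree ed (g v false) = 1) := by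
      rintro ⟨ht, hf⟩
      rw [h.jointDegree_eq_degree h2] at ht hf
      exact h.not_adj_of_degree_eq_one hm ht hf
        ⟨hne v hv, v, hmem v hv true, hmem v hv false⟩
    by_cases htc : g v true = c
    · have hfc := hle (g v false) fun hfc => hne v hv (htc.trans hfc.symm)
      rw [htc, hc] at hiff ⊢
      split_ifs with hv'
      · rcases hiff.mp hv' with ⟨-, h⟩ | ⟨h, -⟩
        · rw [h, hφ 1 2]; ring
        · omega
      · have : jointDegree ed (g v false) = 2 := by
          by_contra h
          exact hv' (hiff.mpr (Or.inl ⟨rfl, by omega⟩))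
        rw [this]; ring
    · have htc' := hle _ htc
      by_cases hfc : g v false = c
      · rw [hfc, hc] at hiff ⊢
        split_ifs with hv'
        · rcases hiff.mp hv' with ⟨h, -⟩ | ⟨h, -⟩
          · omega
          · rw [h, hφ 1 3, hφ 1 2]; ring
        · have : jointDegree ed (g v true) = 2 := by
            by_contra h
            exact hv' (hiff.mpr (Or.inr ⟨by omega, rfl⟩))
          rw [this, hφ 2 3]; ring
      · have hfc' := hle _ hfc
        rw [if_neg fun hv' => by have := hiff.mp hv'; omega]
        generalize jointDegree ed (g v true) = i at *
        generalize jointDegree ed (g v false) = j at *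
        interval_cases i <;> interval_cases j
        · simp at h11
        · ring
        · rw [hφ 2 1]; ring
        · ring
  rw [Finset.sum_congr rfl key, Finset.sum_add_distrib,
    sum_pair_eq hg fun e => φ (jointDegree ed e) 2 - φ 2 2 / 2, ← Finset.sum_filter,
    Finset.filter_mem_eq_inter, Finset.inter_eq_right.mpr hsub, Finset.sum_const, nsmul_eq_mul,
    ← sum_of_excess_eq_one (h.sum_jointDegree h2) h1 hX ψ]
  simp only [hψ]

end IsEdgeTree

variable {V' E' : Type*} [Fintype V'] [DecidableEq V'] [Fintype E'] [DecidableEq E']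
  {ed' : E' → Finset V'}

namespace IsEdgeTree

theorem card_vert_eq (h : IsEdgeTree k ed) (h' : IsEdgeTree k ed')
    (hE : Fintype.card E = Fintype.card E') : Fintype.card V = Fintype.card V' := by
  have h1 := h.card_add
  have h2 := h'.card_add
  rw [← hE] at h2
  omega

/-- Orders `1` and `2` are below `k`, so only loops matter and the moments are power sums of the
degrees. -/
theorem momentSum_lt_of_three_le (hk : 3 ≤ k) (h : IsEdgeTree k ed) (h' : IsEdgeTree k ed')
    (hE : Fintype.card E = Fintype.card E') (h2 : ∀ v, (edgesAt ed v).card ≤ 2)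
    (h3 : ∃ v, 2 < (edgesAt ed' v).card) {a : ℝ} (ha : 0 < a) :
    (∀ t, 1 ≤ t → t < 2 → momentSum k ed a t = momentSum k ed' a t) ∧
      momentSum k ed a 2 < momentSum k ed' a 2 := by
  have hV := h.card_vert_eq h' hE
  have hs := h.sum_card_edgesAt
  have hs' := h'.sum_card_edgesAt
  rw [← hE, ← hs] at hs'
  have hsz : ∑ v, ((edgesAt ed' v).card : ℝ) = ∑ v, ((edgesAt ed v).card : ℝ) := by
    exact_mod_cast hs'
  constructor
  · intro t ht ht'
    obtain rfl : t = 1 := by omega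
    rw [momentSum, momentSum, sum_configTerm_of_lt (by omega) h.card_edge h.flowFree (by omega)
      (by omega), sum_configTerm_of_lt (by omega) h'.card_edge h'.flowFree (by omega) (by omega)]
    simp only [pow_one, ← Finset.mul_sum, hsz]
  · rw [momentSum, momentSum, sum_configTerm_of_lt (by omega) h.card_edge h.flowFree (by omega)
      (by omega), sum_configTerm_of_lt (by omega) h'.card_edge h'.flowFree (by omega) (by omega)]
    simp only [mul_pow, ← Finset.mul_sum]
    refine mul_lt_mul_of_pos_left (mul_lt_mul_of_pos_left ?_ (by positivity)) (vertexCoeff_pos k 2)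
    -- The affine part has the same total for both hypertrees. The product `(n - 1) * (n - 2)`
    -- vanishes for degrees one and two and is positive for larger ones.
    have hsq : ∀ n : ℕ, ((n : ℝ)) ^ 2 = ((n : ℝ) - 1) * (n - 2) + (3 * n - 2) := fun n => by ring
    simp only [hsq, Finset.sum_add_distrib, Finset.sum_sub_distrib, ← Finset.mul_sum, hsz]
    simp only [Finset.sum_const, Finset.card_univ, hV]
    refine add_lt_add_left ?_ _
    refine lt_of_eq_of_lt (Finset.sum_eq_zero fun v _ => ?_) (Finset.sum_pos' (fun v _ => ?_) ?_)
    · have h4 := h2 v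
      have h5 := h.card_edgesAt_pos v
      interval_cases (edgesAt ed v).card <;> norm_num
    · have h5 := h'.card_edgesAt_pos v
      rcases Nat.lt_or_ge (edgesAt ed' v).card 2 with h6 | h6
      · interval_cases (edgesAt ed' v).card; norm_num
      · have : (2 : ℝ) ≤ (edgesAt ed' v).card := by exact_mod_cast h6
        exact mul_nonneg (by linarith) (by linarith)
    · obtain ⟨v, hv⟩ := h3
      have : (2 : ℝ) < (edgesAt ed' v).card := by exact_mod_cast hv
      exact ⟨v, Finset.mem_univ _, mul_pos (by linarith) (by linarith)⟩

theorem momentSum_eq_of_lt (hk : 2 ≤ k) (h : IsEdgeTree k ed) (h2 : ∀ v, (edgesAt ed v).card ≤ 2)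
    {d : ℕ} (hd : d ≠ 0) (hdk : d < 2 * k) (a : ℝ) :
    momentSum k ed a d = Fintype.card V * (vertexCoeff k d * a ^ d) +
        (Fintype.card E - 1) * (vertexCoeff k d * ((2 * a) ^ d - a ^ d)) +
      ∑ e, edgeSum k a (1 - a) d (jointDegree ed e) := by
  obtain ⟨g, hg⟩ := exists_pair_choice ed h.connected.nonempty
  rw [momentSum, h.sum_configTerm hk h2 hg hd (by omega),
    Finset.sum_eq_zero (s := jointVerts ed) fun v _ => pairSum_eq_zero (by omega) hdk, add_zero]

/-- As `k ≥ 3` gives `k + 2 < 2 * k`, no pair of edges contributes. Below order `k + 2` the edge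
contribution is affine in `δ` and its sum is constant; at order `k + 2` it is strictly convex. -/
theorem momentSum_lt_of_excess_lt (hk : 3 ≤ k) (h : IsEdgeTree k ed) (h' : IsEdgeTree k ed')
    (hE : Fintype.card E = Fintype.card E') (hm : 2 ≤ Fintype.card E)
    (h2 : ∀ v, (edgesAt ed v).card ≤ 2) (h2' : ∀ v, (edgesAt ed' v).card ≤ 2)
    (hX : excess (jointDegree ed) ≤ 1)
    (hlt : excess (jointDegree ed) < excess (jointDegree ed')) {a : ℝ} (ha : 0 < a)
    (ha1 : a < 1) :
    (∀ t, 1 ≤ t → t < k + 2 → momentSum k ed a t = momentSum k ed' a t) ∧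
      momentSum k ed a (k + 2) < momentSum k ed' a (k + 2) := by
  have hV := h.card_vert_eq h' hE
  have h1 := h.one_le_jointDegree h2 hm
  have h1' := h'.one_le_jointDegree h2' (hE ▸ hm)
  constructor
  · intro t ht htk
    rw [h.momentSum_eq_of_lt (by omega) h2 (by omega) (by omega),
      h'.momentSum_eq_of_lt (by omega) h2' (by omega) (by omega), hV, hE,
      sum_of_affine (h.sum_jointDegree h2) h1 h.jointDegree_le _
        (fun δ hδ => edgeSum_affine (by omega) (by omega) htk hδ),
      sum_of_affine (h'.sum_jointDegree h2') h1' h'.jointDegree_le _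
        (fun δ hδ => edgeSum_affine (by omega) (by omega) htk hδ), hE]
  · rw [h.momentSum_eq_of_lt (by omega) h2 (by omega) (by omega),
      h'.momentSum_eq_of_lt (by omega) h2' (by omega) (by omega), hV, hE]
    refine (add_lt_add_iff_left _).mpr ?_
    have hconv : ∀ δ, δ + 2 ≤ k → 0 < edgeSum k a (1 - a) (k + 2) (δ + 2) -
        2 * edgeSum k a (1 - a) (k + 2) (δ + 1) + edgeSum k a (1 - a) (k + 2) δ := fun δ hδ =>
      edgeSum_convex (by omega) ha (by linarith) hδ
    refine lt_of_lt_of_le ?_ (le_sum_of_convex (h'.sum_jointDegree h2') h1' h'.jointDegree_le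
      (edgeSum k a (1 - a) (k + 2)) fun δ hδ => (hconv δ hδ).le)
    have hc := hconv 1 hk
    have hlt' : (excess (jointDegree ed) : ℝ) + 1 ≤ excess (jointDegree ed') := by
      exact_mod_cast hlt
    rw [← hE]
    rcases Nat.le_one_iff_eq_zero_or_eq_one.mp hX with h0 | h0
    · rw [sum_of_excess_eq_zero (h.sum_jointDegree h2) h1 h0]
      rw [h0, Nat.cast_zero, zero_add] at hlt'
      norm_num at hc ⊢
      have : 0 < (excess (jointDegree ed') : ℝ) := by linarith
      exact mul_pos this hc
    · rw [sum_of_excess_eq_one (h.sum_jointDegree h2) h1 h0]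
      rw [h0, Nat.cast_one] at hlt'
      norm_num at hc
      nlinarith

/-- Equal excess `1` makes the edge parts agree at every order, and `2 * k + 2 < 3 * k`, so the
comparison reduces to the correction term of `sum_pair_of_excess_eq_one`. -/
theorem momentSum_lt_of_centralLeafVerts_lt (hk : 3 ≤ k) (h : IsEdgeTree k ed)
    (h' : IsEdgeTree k ed')
    (hE : Fintype.card E = Fintype.card E') (hm : 3 ≤ Fintype.card E)
    (h2 : ∀ v, (edgesAt ed v).card ≤ 2) (h2' : ∀ v, (edgesAt ed' v).card ≤ 2)
    (hX : excess (jointDegree ed) = 1) (hX' : excess (jointDegree ed') = 1)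
    (hlt : (centralLeafVerts ed').card < (centralLeafVerts ed).card) {a : ℝ} (ha : 0 < a)
    (ha1 : a < 1) :
    (∀ t, 1 ≤ t → t < 2 * k + 2 → momentSum k ed a t = momentSum k ed' a t) ∧
      momentSum k ed a (2 * k + 2) < momentSum k ed' a (2 * k + 2) := by
  have hV := h.card_vert_eq h' hE
  obtain ⟨g, hg⟩ := exists_pair_choice ed h.connected.nonempty
  obtain ⟨g', hg'⟩ := exists_pair_choice ed' h'.connected.nonempty
  have h1 := h.one_le_jointDegree h2 (by omega)
  have h1' := h'.one_le_jointDegree h2' (by omega)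
  have hedge : ∀ t, ∑ e, edgeSum k a (1 - a) t (jointDegree ed e) =
      ∑ e, edgeSum k a (1 - a) t (jointDegree ed' e) := fun t => by
    rw [sum_of_excess_eq_one (h.sum_jointDegree h2) h1 hX,
      sum_of_excess_eq_one (h'.sum_jointDegree h2') h1' hX', hE]
  constructor
  · intro t ht htk
    rw [momentSum, momentSum, h.sum_configTerm (by omega) h2 hg (by omega) (by omega),
      h'.sum_configTerm (by omega) h2' hg' (by omega) (by omega), hV, hE, hedge]
    congr 1
    -- The mixed difference at `(2, 1)` is the negative of the correction for the pair `{3, 1}`, so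
    -- the correction vanishes here.
    have hadd := pairSum_additive (a := a) (y := 1 - a) (by omega : 2 ≤ k) htk
      (by omega : 1 + 1 < k) (by omega : 0 + 1 < k)
    rw [h.sum_pair_of_excess_eq_one h2 hm hX hg (pairSum k a (1 - a) t)
        (fun i j => pairSum_comm (by omega) (by omega)) _ (fun _ => rfl),
      h'.sum_pair_of_excess_eq_one h2' (by omega) hX' hg' (pairSum k a (1 - a) t)
        (fun i j => pairSum_comm (by omega) (by omega)) _ (fun _ => rfl), hE]
    norm_num at hadd
    rw [show pairSum k a (1 - a) t 3 1 - pairSum k a (1 - a) t 3 2 - pairSum k a (1 - a) t 2 1 +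
      pairSum k a (1 - a) t 2 2 = 0 by linarith]
    ring
  · rw [momentSum, momentSum, h.sum_configTerm (by omega) h2 hg (by omega) (by omega),
      h'.sum_configTerm (by omega) h2' hg' (by omega) (by omega), hV, hE, hedge]
    refine (add_lt_add_iff_left _).mpr ?_
    -- The correction is now negative: more leaves at the central edge mean a smaller moment.
    have hsup := pairSum_supermodular (by omega : 2 ≤ k) ha (by linarith : 0 < 1 - a)
      (by omega : 1 + 1 < k) (by omega : 0 + 1 < k)
    rw [h.sum_pair_of_excess_eq_one h2 hm hX hg (pairSum k a (1 - a) (2 * k + 2))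
        (fun i j => pairSum_comm (by omega) (by omega)) _ (fun _ => rfl),
      h'.sum_pair_of_excess_eq_one h2' (by omega) hX' hg' (pairSum k a (1 - a) (2 * k + 2))
        (fun i j => pairSum_comm (by omega) (by omega)) _ (fun _ => rfl), hE]
    norm_num at hsup
    refine (add_lt_add_iff_left _).mpr ?_
    have hlt' : ((centralLeafVerts ed').card : ℝ) < (centralLeafVerts ed).card := by
      exact_mod_cast hlt
    exact mul_lt_mul_of_neg_right hlt' (by linarith)

end IsEdgeTree

end

end

/-! ### From hypertrees to edge systems and their moments -/

section

open HTensor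

namespace Hypergraph

variable {U : Type*} [Finite U] {H : Hypergraph U} [Fintype ↥H.vertexSet]
  [DecidableEq ↥H.vertexSet] [Fintype ↥H.edgeSet] [DecidableEq ↥H.edgeSet]

theorem incidenceGraph_adj_inl_inr {v : ↥H.vertexSet} {e : ↥H.edgeSet} :
    H.incidenceGraph.Adj (.inl v) (.inr e) ↔ v ∈ H.edgeVerts e := by
  rw [mem_edgeVerts]; rfl

theorem incidenceGraph_adj_inr_inl {v : ↥H.vertexSet} {e : ↥H.edgeSet} :
    H.incidenceGraph.Adj (.inr e) (.inl v) ↔ v ∈ H.edgeVerts e := by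
  rw [mem_edgeVerts]; rfl

theorem not_incidenceGraph_adj_inl_inl {v w : ↥H.vertexSet} :
    ¬ H.incidenceGraph.Adj (.inl v) (.inl w) := id

theorem not_incidenceGraph_adj_inr_inr {e f : ↥H.edgeSet} :
    ¬ H.incidenceGraph.Adj (.inr e) (.inr f) := id

theorem degree_eq_card_edgesAt (v : ↥H.vertexSet) :
    H.degree v = (edgesAt H.edgeVerts v).card := by
  rw [degree, ← Set.ncard_coe_finset, ← Set.ncard_image_of_injective _ Subtype.val_injective]
  congr 1
  ext e
  simp [mem_edgesAt, and_comm]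

theorem card_edgeFinset_incidenceGraph [Fintype H.incidenceGraph.edgeSet] :
    H.incidenceGraph.edgeFinset.card = ∑ e, (H.edgeVerts e).card := by
  classical
  have h := H.incidenceGraph.sum_degrees_eq_twice_card_edges
  rw [Fintype.sum_sum_type] at h
  have h1 : ∀ v, H.incidenceGraph.degree (.inl v) = (edgesAt H.edgeVerts v).card := by
    intro v
    rw [← SimpleGraph.card_neighborFinset_eq_degree,
      ← Finset.card_map (Function.Embedding.inr (α := ↥H.vertexSet)) (s := edgesAt _ v)]
    refine congrArg Finset.card (Finset.ext ?_)
    rintro (w | e)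
    · simp [not_incidenceGraph_adj_inl_inl]
    · simp [incidenceGraph_adj_inl_inr, edgesAt]
  have h2 : ∀ e, H.incidenceGraph.degree (.inr e) = (H.edgeVerts e).card := by
    intro e
    rw [← SimpleGraph.card_neighborFinset_eq_degree,
      ← Finset.card_map (Function.Embedding.inl (β := ↥H.edgeSet)) (s := H.edgeVerts e)]
    refine congrArg Finset.card (Finset.ext ?_)
    rintro (w | f)
    · simp [incidenceGraph_adj_inr_inl]
    · simp [not_incidenceGraph_adj_inr_inr]
  have h3 : ∑ v, (edgesAt H.edgeVerts v).card = ∑ e, (H.edgeVerts e).card := by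
    simp only [edgesAt, Finset.card_filter]
    rw [Finset.sum_comm]
    simp [-mem_edgeVerts]
  rw [Finset.sum_congr rfl fun v _ => h1 v, Finset.sum_congr rfl fun e _ => h2 e, h3] at h
  rw [Subsingleton.elim (SimpleGraph.fintypeEdgeSet _) ‹Fintype H.incidenceGraph.edgeSet›] at h
  omega

namespace IsUniformHypertree

variable {k m : ℕ}

theorem card_edgeSet (h : H.IsUniformHypertree k m) : Fintype.card ↥H.edgeSet = m := by
  have := h.card_edges
  rw [Set.encard_eq_coe_toFinset_card, Set.toFinset_card] at this
  exact_mod_cast this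

/-- Every incidence is a bridge of the incidence graph, and a flow that balances at all nodes
carries nothing across a cut consisting of one bridge. -/
theorem isFlowFree (h : H.IsUniformHypertree k m) : IsFlowFree H.edgeVerts := by
  classical
  intro x hx he hv v₀ e₀
  by_contra h0
  have hmem : v₀ ∈ H.edgeVerts e₀ := by
    by_contra hn
    exact h0 (hx _ _ hn)
  have hbr := SimpleGraph.isAcyclic_iff_forall_adj_isBridge.mp h.isTree.isAcyclic
    (incidenceGraph_adj_inl_inr.mpr hmem)
  set G' := H.incidenceGraph.deleteEdges {s(.inl v₀, .inr e₀)} with hG'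
  have hnr : ¬ G'.Reachable (.inl v₀) (.inr e₀) := SimpleGraph.isBridge_iff.mp hbr
  have hstep : ∀ v e, v ∈ H.edgeVerts e → ¬ (v = v₀ ∧ e = e₀) →
      (G'.Reachable (.inl v₀) (.inl v) ↔ G'.Reachable (.inl v₀) (.inr e)) := by
    intro v e hve hne
    have hadj : G'.Adj (.inl v) (.inr e) := by
      rw [hG', SimpleGraph.deleteEdges_adj]
      refine ⟨incidenceGraph_adj_inl_inr.mpr hve, ?_⟩
      simpa using hne
    exact ⟨fun h => h.trans hadj.reachable, fun h => h.trans hadj.symm.reachable⟩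
  -- The weights are tested against the indicator of the side of `v₀` after deletion of the
  -- incidence `(v₀, e₀)`. Every other incidence has both ends on the same side, so only `x v₀ e₀`
  -- remains.
  have h1 : ∑ v, ∑ e, x v e * ((if G'.Reachable (.inl v₀) (.inl v) then 1 else 0) -
      (if G'.Reachable (.inl v₀) (.inr e) then 1 else 0)) = 0 := by
    simp only [mul_sub, Finset.sum_sub_distrib]
    rw [Finset.sum_comm (f := fun v e => x v e *
      (if G'.Reachable (.inl v₀) (.inr e) then (1 : ℤ) else 0))]
    simp only [← Finset.sum_mul, hv, he, zero_mul, Finset.sum_const_zero, sub_zero]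
  rw [Fintype.sum_eq_single v₀, Fintype.sum_eq_single e₀, if_pos (SimpleGraph.Reachable.refl _),
    if_neg hnr, sub_zero, mul_one] at h1
  · exact h0 h1
  · intro e hne
    by_cases hm : v₀ ∈ H.edgeVerts e
    · have := (hstep v₀ e hm (fun h => hne h.2)).mp (SimpleGraph.Reachable.refl _)
      rw [if_pos (SimpleGraph.Reachable.refl _), if_pos this, sub_self, mul_zero]
    · rw [hx _ _ hm, zero_mul]
  · intro v hne
    refine Finset.sum_eq_zero fun e _ => ?_
    by_cases hm : v ∈ H.edgeVerts e
    · have := hstep v e hm (fun h => hne h.1)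
      simp [this]
    · rw [hx _ _ hm, zero_mul]

/-- Two edges with two common vertices would give a way around an incidence, which is a bridge. The
count is that of the edges of the incidence tree, and walks in this tree project to walks in the
line graph. -/
theorem isEdgeTree (h : H.IsUniformHypertree k m) (hm : 1 ≤ m) : IsEdgeTree k H.edgeVerts := by
  classical
  have hE : Nonempty ↥H.edgeSet := Fintype.card_pos_iff.mp (by rw [h.card_edgeSet]; omega)
  refine ⟨card_edgeVerts h.uniform, h.isFlowFree, ?_, ?_, ?_, ?_⟩
  · intro e e' hne v w hv hv' hw hw'
    by_contra hvw
    have hbr := SimpleGraph.isAcyclic_iff_forall_adj_isBridge.mp h.isTree.isAcyclic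
      (incidenceGraph_adj_inl_inr.mpr hv)
    refine SimpleGraph.isBridge_iff.mp hbr ?_
    have h1 : (H.incidenceGraph.deleteEdges {s(.inl v, .inr e)}).Adj (.inl v) (.inr e') := by
      rw [SimpleGraph.deleteEdges_adj]
      exact ⟨incidenceGraph_adj_inl_inr.mpr hv', by simpa using hne.symm⟩
    have h2 : (H.incidenceGraph.deleteEdges {s(.inl v, .inr e)}).Adj (.inl w) (.inr e') := by
      rw [SimpleGraph.deleteEdges_adj]
      exact ⟨incidenceGraph_adj_inl_inr.mpr hw', by simpa using fun h => absurd h.symm hvw⟩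
    have h3 : (H.incidenceGraph.deleteEdges {s(.inl v, .inr e)}).Adj (.inl w) (.inr e) := by
      rw [SimpleGraph.deleteEdges_adj]
      exact ⟨incidenceGraph_adj_inl_inr.mpr hw, by simpa using fun h => hvw h.symm⟩
    exact (h1.reachable.trans h2.symm.reachable).trans h3.reachable
  · have h1 := h.isTree.card_edgeFinset
    rw [card_edgeFinset_incidenceGraph, Fintype.card_sum,
      Finset.sum_congr rfl fun e _ => card_edgeVerts h.uniform e, Finset.sum_const, smul_eq_mul,
      Finset.card_univ, mul_comm] at h1
    exact h1.symm
  · intro v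
    have : Nontrivial (↥H.vertexSet ⊕ ↥H.edgeSet) := ⟨.inl v, .inr hE.some, by simp⟩
    have h1 := h.isTree.connected.preconnected.degree_pos_of_nontrivial (.inl v)
    obtain ⟨w | e, hw⟩ := (SimpleGraph.degree_pos_iff_exists_adj _ _).mp h1
    · exact absurd hw not_incidenceGraph_adj_inl_inl
    · exact ⟨e, incidenceGraph_adj_inl_inr.mp hw⟩
  · rw [SimpleGraph.connected_iff]
    refine ⟨fun e e' => ?_, hE⟩
    have key : ∀ p, H.incidenceGraph.Reachable (.inr e) p →
        (∀ f, p = .inr f → (lineGraph H.edgeVerts).Reachable e f) ∧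
        (∀ v f, p = .inl v → v ∈ H.edgeVerts f → (lineGraph H.edgeVerts).Reachable e f) := by
      intro p hp
      rw [SimpleGraph.reachable_iff_reflTransGen] at hp
      induction hp with
      | refl =>
        refine ⟨?_, by simp⟩
        rintro f hf
        rw [Sum.inr_injective hf]
      | @tail b c _ hbc ih =>
        rcases b with v | f
        · rcases c with w | f'
          · exact absurd hbc not_incidenceGraph_adj_inl_inl
          · refine ⟨fun f'' hf => ?_, by simp⟩
            rw [← Sum.inr_injective hf]
            exact ih.2 v f' rfl (incidenceGraph_adj_inl_inr.mp hbc)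
        · rcases c with w | f'
          · refine ⟨by simp, fun v f'' hv hf => ?_⟩
            obtain rfl := Sum.inl_injective hv
            refine (ih.1 f rfl).trans ?_
            by_cases hff : f = f''
            · rw [hff]
            · exact SimpleGraph.Adj.reachable ⟨hff, w, incidenceGraph_adj_inr_inl.mp hbc, hf⟩
          · exact absurd hbc not_incidenceGraph_adj_inr_inr
    exact (key _ (h.isTree.connected.preconnected (.inr e) (.inr e'))).1 e' rfl

theorem alphaMoment_eq (h : H.IsUniformHypertree k m) (a : ℝ) (d : ℕ) :
    H.alphaMoment k a d = ((k : ℝ) - 1) ^ (Fintype.card ↥H.vertexSet - 1) *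
      momentSum k H.edgeVerts a d := by
  rw [alphaMoment_eq_sum_configTerm h.uniform, momentSum]
  simp only [degree_eq_card_edgesAt]

end IsUniformHypertree

end Hypergraph

theorem momentSum_zero {V E : Type*} [Fintype V] [DecidableEq V] [Fintype E] [DecidableEq E]
    (k : ℕ) (ed : E → Finset V) (a : ℝ) : momentSum k ed a 0 = Fintype.card V := by
  rw [momentSum, Finset.piAntidiag_zero, Finset.sum_singleton, configTerm, configCoeff]
  simp [configArcs, expFactorial, closedCoeff_eq_sum, walkCoeff_zero]

theorem Hypergraph.AlphaLT.not_alphaEq {U W : Type*} [Finite U] [Finite W] {H : Hypergraph U}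
    {K : Hypergraph W} {k : ℕ} {a : ℝ} (h : AlphaLT k a H K) : ¬ AlphaEq k a H K := by
  rintro ⟨-, heq⟩
  obtain ⟨-, d, hd, hle, -, hlt⟩ := h
  exact hlt.ne (heq d (by omega))

namespace Hypergraph

variable {U W : Type*} [Finite U] [Finite W] {H : Hypergraph U} {K : Hypergraph W}
  [Fintype ↥H.vertexSet] [DecidableEq ↥H.vertexSet] [Fintype ↥H.edgeSet] [DecidableEq ↥H.edgeSet]
  [Fintype ↥K.vertexSet] [DecidableEq ↥K.vertexSet] [Fintype ↥K.edgeSet] [DecidableEq ↥K.edgeSet]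
  {k m : ℕ}

theorem IsUniformHypertree.alphaLT (hk : 3 ≤ k) (hm : 4 ≤ m) (hH : H.IsUniformHypertree k m)
    (hK : K.IsUniformHypertree k m) {a : ℝ} {d : ℕ} (hd : 1 ≤ d) (hd' : d ≤ 2 * k + 2)
    (h : (∀ t, 1 ≤ t → t < d → momentSum k H.edgeVerts a t = momentSum k K.edgeVerts a t) ∧
      momentSum k H.edgeVerts a d < momentSum k K.edgeVerts a d) : AlphaLT k a H K := by
  have hHt := hH.isEdgeTree (by omega)
  have hKt := hK.isEdgeTree (by omega)
  have hE : Fintype.card ↥H.edgeSet = Fintype.card ↥K.edgeSet := by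
    rw [hH.card_edgeSet, hK.card_edgeSet]
  have hV := hHt.card_vert_eq hKt hE
  refine ⟨by rw [← Nat.card_coe_set_eq, ← Nat.card_coe_set_eq, Nat.card_eq_fintype_card,
    Nat.card_eq_fintype_card, hV], d, hd, ?_, fun t ht => ?_, ?_⟩
  -- The number of vertices is `(k - 1) * m + 1 ≥ 4 * k - 3 ≥ 2 * k + 3`, so the order `d ≤ 2 * k +
  -- 2` lies in the admissible range.
  · have hn := hHt.card_add
    rw [hH.card_edgeSet] at hn
    rw [← Nat.card_coe_set_eq, Nat.card_eq_fintype_card]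
    have h1 : 1 ≤ (k - 1) ^ (Fintype.card ↥H.vertexSet - 1) := Nat.one_le_pow _ _ (by omega)
    have h2 : Fintype.card ↥H.vertexSet ≤
        Fintype.card ↥H.vertexSet * (k - 1) ^ (Fintype.card ↥H.vertexSet - 1) :=
      Nat.le_mul_of_pos_right _ h1
    have h3 : (k - 1) * 4 ≤ (k - 1) * m := Nat.mul_le_mul_left _ hm
    have h4 : (k - 1) * m + m = k * m := by
      rw [← Nat.succ_mul, Nat.succ_eq_add_one, Nat.sub_add_cancel (by omega)]
    omega
  · rw [hH.alphaMoment_eq, hK.alphaMoment_eq, hV]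
    rcases Nat.eq_zero_or_pos t with rfl | ht'
    · rw [momentSum_zero, momentSum_zero, hV]
    · rw [h.1 t ht' ht]
  · rw [hH.alphaMoment_eq, hK.alphaMoment_eq, hV]
    refine mul_lt_mul_of_pos_left h.2 (pow_pos ?_ _)
    have : (3 : ℝ) ≤ k := by exact_mod_cast hk
    linarith

end Hypergraph

end

/-! ### Recognition of paths and forks -/

namespace SimpleGraph

section

variable {V : Type*} {G : SimpleGraph V}

theorem Connected.exists_adj_dist_eq (hG : G.Connected) {l v : V} {n : ℕ}
    (hv : G.dist l v = n + 1) : ∃ w, G.Adj v w ∧ G.dist l w = n := by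
  obtain ⟨p, hp⟩ := hG.exists_walk_length_eq_dist v l
  cases p with
  | nil => simp at hv
  | @cons _ w _ hadj q =>
    refine ⟨w, hadj, ?_⟩
    rw [dist_comm, hv, Walk.length_cons] at hp
    have h1 : G.dist l w ≤ n := by
      rw [dist_comm]
      exact (dist_le q).trans (by omega)
    have h2 := hG.dist_triangle (u := l) (v := w) (w := v)
    rw [hv, dist_eq_one_iff_adj.mpr hadj.symm] at h2
    omega

/-- Every distance layer has at most one vertex: the only vertex of a layer has one neighbour in the
layer before, which leaves room for one neighbour in the next layer. -/
theorem Connected.dist_injective (hG : G.Connected) {l : V}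
    (h1 : ∀ x y, G.Adj l x → G.Adj l y → x = y)
    (h2 : ∀ v x y z, G.Adj v x → G.Adj v y → G.Adj v z → x = y ∨ x = z ∨ y = z) :
    Function.Injective (G.dist l) := by
  have key : ∀ n v w, G.dist l v = n → G.dist l w = n → v = w := by
    intro n
    induction n with
    | zero =>
      intro v w hv hw
      rw [← hG.dist_eq_zero_iff.mp hv, ← hG.dist_eq_zero_iff.mp hw]
    | succ n ih =>
      intro v w hv hw
      obtain ⟨v', hvv, hv'⟩ := hG.exists_adj_dist_eq hv
      obtain ⟨w', hww, hw'⟩ := hG.exists_adj_dist_eq hw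
      obtain rfl := ih v' w' hv' hw'
      cases n with
      | zero =>
        obtain rfl := hG.dist_eq_zero_iff.mp hv'
        exact h1 v w hvv.symm hww.symm
      | succ n =>
        obtain ⟨u, hu, hu'⟩ := hG.exists_adj_dist_eq hv'
        rcases h2 v' v w u hvv.symm hww.symm hu with h | h | h
        · exact h
        · rw [h] at hv
          omega
        · rw [h] at hw
          omega
  exact fun v w h => key _ v w h rfl

/-- A connected graph without vertices of degree at least three in which `l` has degree at most
one is a path that starts at `l`. -/
theorem Connected.exists_iso_pathGraph [Fintype V] (hG : G.Connected) {l : V}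
    (h1 : ∀ x y, G.Adj l x → G.Adj l y → x = y)
    (h2 : ∀ v x y z, G.Adj v x → G.Adj v y → G.Adj v z → x = y ∨ x = z ∨ y = z) {n : ℕ}
    (hn : Fintype.card V = n) : ∃ f : G ≃g pathGraph n, ((f l : Fin n) : ℕ) = 0 := by
  classical
  have hinj := hG.dist_injective h1 h2
  have hlt : ∀ v, G.dist l v < n := by
    have key : ∀ d v, G.dist l v = d → Finset.range (d + 1) ⊆ Finset.univ.image (G.dist l) := by
      intro d
      induction d with
      | zero =>
        intro v hv x hx
        rw [Finset.mem_range] at hx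
        exact Finset.mem_image.mpr ⟨v, Finset.mem_univ _, by omega⟩
      | succ d ih =>
        intro v hv x hx
        rw [Finset.mem_range] at hx
        by_cases hxd : x = d + 1
        · exact Finset.mem_image.mpr ⟨v, Finset.mem_univ _, by omega⟩
        · obtain ⟨w, -, hw⟩ := hG.exists_adj_dist_eq hv
          exact ih w hw (Finset.mem_range.mpr (by omega))
    intro v
    have h3 := (Finset.card_le_card (key _ v rfl)).trans Finset.card_image_le
    rw [Finset.card_range, Finset.card_univ, hn] at h3
    omega
  let g : V → Fin n := fun v => ⟨G.dist l v, hlt v⟩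
  have hg : Function.Bijective g := (Fintype.bijective_iff_injective_and_card g).mpr
    ⟨fun v w h => hinj (congrArg Fin.val h), by rw [hn, Fintype.card_fin]⟩
  have hadj : ∀ v w, G.dist l v + 1 = G.dist l w → G.Adj v w := by
    intro v w hvw
    obtain ⟨u, hu, hu'⟩ := hG.exists_adj_dist_eq hvw.symm
    rw [← hinj hu']
    exact hu.symm
  refine ⟨⟨Equiv.ofBijective g hg, fun {v w} => ?_⟩, ?_⟩
  · rw [Equiv.ofBijective_apply, Equiv.ofBijective_apply, pathGraph_adj]
    refine ⟨fun h => ?_, fun h => ?_⟩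
    · exact h.elim (hadj v w) fun h => (hadj w v h).symm
    · have h3 := hG.dist_triangle (u := l) (v := v) (w := w)
      have h4 := hG.dist_triangle (u := l) (v := w) (w := v)
      rw [dist_eq_one_iff_adj.mpr h] at h3
      rw [dist_eq_one_iff_adj.mpr h.symm] at h4
      have h5 : G.dist l v ≠ G.dist l w := fun h' => h.ne (hinj h')
      change G.dist l v + 1 = G.dist l w ∨ G.dist l w + 1 = G.dist l v
      omega
  · exact dist_self

theorem eq_or_eq_or_eq_of_degree_le_two {v : V} [Fintype (G.neighborSet v)]
    (h : G.degree v ≤ 2) {x y z : V} (hx : G.Adj v x) (hy : G.Adj v y) (hz : G.Adj v z) :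
    x = y ∨ x = z ∨ y = z := by
  classical
  by_contra! hne
  have h1 : ({x, y, z} : Finset V) ⊆ G.neighborFinset v := by
    intro u hu
    simp only [Finset.mem_insert, Finset.mem_singleton] at hu
    rw [mem_neighborFinset]
    rcases hu with rfl | rfl | rfl <;> assumption
  have h2 := Finset.card_le_card h1
  rw [Finset.card_eq_three.mpr ⟨x, y, z, hne.1, hne.2.1, hne.2.2, rfl⟩,
    card_neighborFinset_eq_degree] at h2
  omega

theorem eq_of_degree_le_one {v : V} [Fintype (G.neighborSet v)]
    (h : G.degree v ≤ 1) {x y : V} (hx : G.Adj v x) (hy : G.Adj v y) : x = y :=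
  Finset.card_le_one.mp ((G.card_neighborFinset_eq_degree v).trans_le h) x (by simpa) y (by simpa)

/-- The path with `n` vertices, and one more vertex that is joined to its second vertex. -/
def forkGraph (n : ℕ) : SimpleGraph (Option (Fin n)) where
  Adj
    | some i, some j => (i : ℕ) + 1 = j ∨ (j : ℕ) + 1 = i
    | some i, none => (i : ℕ) = 1
    | none, some j => (j : ℕ) = 1
    | none, none => False
  symm := ⟨by rintro (_ | i) (_ | j) h <;> first | exact h | exact h.symm⟩
  loopless := ⟨by
    rintro (_ | i) h
    · exact h
    · change (i : ℕ) + 1 = i ∨ (i : ℕ) + 1 = i at h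
      omega⟩

/-- Deleting the leaf `l'` leaves a path that starts at `l`; its second vertex is `c`, the neighbour
of `l`, and there `l'` is attached again. -/
theorem Connected.nonempty_iso_forkGraph [Fintype V] [DecidableEq V] [DecidableRel G.Adj]
    (hG : G.Connected) {c l l' : V} (hl : G.degree l = 1) (hl' : G.degree l' = 1) (hne : l ≠ l')
    (hc : G.degree c = 3) (hlc : G.Adj c l) (hlc' : G.Adj c l') (h2 : ∀ v, v ≠ c → G.degree v ≤ 2)
    {n : ℕ} (hn : Fintype.card V = n + 1) : Nonempty (forkGraph n ≃g G) := by
  have hcl : c ≠ l' := hlc'.ne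
  obtain ⟨f, hf⟩ := (hG.induce_compl_singleton_of_degree_eq_one hl').exists_iso_pathGraph
    (l := ⟨l, hne⟩) (n := n)
    (fun x y hx hy => Subtype.ext (eq_of_degree_le_one hl.le hx hy))
    (fun v x y z hx hy hz => by
      -- The centre has degree three but has lost its neighbour `l'`.
      by_cases hvc : (v : V) = c
      · by_contra! hxyz
        simp only [ne_eq, Subtype.ext_iff] at hxyz
        have h1 : ({(x : V), (y : V), (z : V)} : Finset V) ⊆ (G.neighborFinset c).erase l' := by
          intro u hu
          simp only [Finset.mem_insert, Finset.mem_singleton] at hu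
          rw [Finset.mem_erase, mem_neighborFinset, ← hvc]
          rcases hu with rfl | rfl | rfl
          · exact ⟨x.2, hx⟩
          · exact ⟨y.2, hy⟩
          · exact ⟨z.2, hz⟩
        have h3 := Finset.card_le_card h1
        rw [Finset.card_eq_three.mpr ⟨_, _, _, hxyz.1, hxyz.2.1, hxyz.2.2, rfl⟩,
          Finset.card_erase_of_mem ((mem_neighborFinset _ _ _).mpr hlc'),
          card_neighborFinset_eq_degree, hc] at h3
        omega
      · simp only [Subtype.ext_iff]
        exact eq_or_eq_or_eq_of_degree_le_two (h2 _ hvc) hx hy hz)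
    (by
      rw [Fintype.card_compl_set]
      simp [hn])
  have hfc : ((f ⟨c, hcl⟩ : Fin n) : ℕ) = 1 := by
    have h3 : (G.induce {l'}ᶜ).Adj ⟨c, hcl⟩ ⟨l, hne⟩ := hlc
    rw [← f.map_adj_iff, pathGraph_adj, hf] at h3
    omega
  have hadj : ∀ i : Fin n, G.Adj l' (f.symm i) ↔ (i : ℕ) = 1 := by
    intro i
    constructor
    · intro h
      have h3 : (f.symm i : V) = c := eq_of_degree_le_one hl'.le h hlc'.symm
      have h4 : f.symm i = ⟨c, hcl⟩ := Subtype.ext h3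
      rw [← hfc, ← h4, f.apply_symm_apply]
    · intro h
      have h4 : i = f ⟨c, hcl⟩ := Fin.ext (h.trans hfc.symm)
      rw [h4, f.symm_apply_apply]
      exact hlc'.symm
  let g : Option (Fin n) → V := fun o => o.elim l' fun i => (f.symm i : V)
  have hg : Function.Bijective g := by
    rw [Fintype.bijective_iff_injective_and_card]
    refine ⟨?_, by simp [hn]⟩
    rintro (_ | i) (_ | j) hij
    · rfl
    · exact absurd hij.symm (f.symm j).2
    · exact absurd hij (f.symm i).2
    · exact congrArg some (f.symm.injective (Subtype.ext hij))
  refine ⟨⟨Equiv.ofBijective g hg, ?_⟩⟩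
  rintro (_ | i) (_ | j)
  · exact ⟨fun h => absurd h (G.loopless.irrefl _), fun h => h.elim⟩
  · exact hadj j
  · exact (G.adj_comm _ _).trans (hadj i)
  · refine Iff.trans ?_ pathGraph_adj
    exact (f.symm.map_adj_iff (v := i) (w := j))

end

end SimpleGraph

/-! ### Isomorphisms of hypertrees and of their line graphs -/

section

open HTensor

section

variable {V V' E E' : Type*} [Fintype V] [DecidableEq V] [Fintype V'] [DecidableEq V']
  [Fintype E] [DecidableEq E] [Fintype E'] [DecidableEq E'] {k : ℕ}
  {ed : E → Finset V} {ed' : E' → Finset V'}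

namespace IsEdgeTree

theorem card_filter_edgesAt_eq_singleton (h : IsEdgeTree k ed)
    (h2 : ∀ v, (edgesAt ed v).card ≤ 2) (e : E) :
    (Finset.univ.filter fun v => edgesAt ed v = {e}).card + (lineGraph ed).degree e = k := by
  rw [← h.jointDegree_eq_degree h2, jointDegree, ← h.card_edge e,
    ← Finset.card_filter_add_card_filter_not (s := ed e) fun v => v ∈ jointVerts ed, add_comm]
  congr 2
  ext v
  simp only [Finset.mem_filter, Finset.mem_univ, true_and, mem_jointVerts]
  constructor
  · intro hv
    exact ⟨mem_edgesAt.mp (by simp [hv]), by simp [hv]⟩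
  · rintro ⟨hv, hv2⟩
    have h3 := h2 v
    have h4 : (edgesAt ed v).card = 1 := by
      have := h.card_edgesAt_pos v
      omega
    obtain ⟨e', he'⟩ := Finset.card_eq_one.mp h4
    have h5 := mem_edgesAt.mpr hv
    rw [he', Finset.mem_singleton] at h5
    rw [he', h5]

theorem card_filter_edgesAt_eq_pair (h : IsEdgeTree k ed) (h2 : ∀ v, (edgesAt ed v).card ≤ 2)
    {e e' : E} (hne : e ≠ e') : (Finset.univ.filter fun v => edgesAt ed v = {e, e'}).card =
      if (lineGraph ed).Adj e e' then 1 else 0 := by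
  split_ifs with hadj
  · obtain ⟨-, v, hv, hv'⟩ := hadj
    rw [Finset.card_eq_one]
    refine ⟨v, ?_⟩
    ext w
    simp only [Finset.mem_filter, Finset.mem_univ, true_and, Finset.mem_singleton]
    constructor
    · intro hw
      exact h.linear e e' hne w v (mem_edgesAt.mp (by simp [hw])) (mem_edgesAt.mp (by simp [hw]))
        hv hv'
    · rintro rfl
      exact edgesAt_eq_pair h2 hv hv' hne
  · rw [Finset.card_eq_zero, Finset.filter_eq_empty_iff]
    intro v _ hv
    exact hadj ⟨hne, v, mem_edgesAt.mp (by simp [hv]), mem_edgesAt.mp (by simp [hv])⟩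

/-- Hypertrees without vertices of degree at least three are determined by their line graphs. -/
theorem exists_vertex_equiv (h : IsEdgeTree k ed) (h' : IsEdgeTree k ed')
    (h2 : ∀ v, (edgesAt ed v).card ≤ 2) (h2' : ∀ v, (edgesAt ed' v).card ≤ 2)
    (ψ : lineGraph ed ≃g lineGraph ed') :
    ∃ φ : V ≃ V', ∀ v e, φ v ∈ ed' (ψ e) ↔ v ∈ ed e := by
  -- Vertices are matched according to the set of edges through them. The fibre over one edge has
  -- `k` minus its line-graph degree elements, the fibre over two edges has one or none according to
  -- adjacency, and all other fibres are empty.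
  obtain ⟨φ, hφ⟩ := exists_equiv_of_card_fiber
    (fun v => (edgesAt ed v).map ψ.toEquiv.toEmbedding) (fun v => edgesAt ed' v) (by
      intro c
      have h0 : ∀ v, (edgesAt ed v).map ψ.toEquiv.toEmbedding = c ↔
          edgesAt ed v = c.map ψ.symm.toEquiv.toEmbedding := by
        intro v
        constructor
        · rintro rfl
          ext e
          rw [Finset.mem_map_equiv, Finset.mem_map_equiv]
          exact iff_of_eq (congrArg (· ∈ edgesAt ed v) (ψ.symm_apply_apply e).symm)
        · intro hv
          rw [hv]
          ext e
          rw [Finset.mem_map_equiv, Finset.mem_map_equiv]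
          exact iff_of_eq (congrArg (· ∈ c) (ψ.apply_symm_apply e))
      simp only [h0]
      rcases Nat.lt_or_ge 2 c.card with hc | hc
      · rw [Finset.filter_false_of_mem, Finset.filter_false_of_mem]
        · simp
        · rintro v - rfl
          exact absurd (h2' v) (by omega)
        · intro v _ hv
          have := h2 v
          rw [hv, Finset.card_map] at this
          omega
      · have hc3 : c.card = 0 ∨ c.card = 1 ∨ c.card = 2 := by omega
        rcases hc3 with hc | hc | hc
        · rw [Finset.filter_false_of_mem, Finset.filter_false_of_mem]
          · simp
          · rintro v - rfl
            exact absurd (h'.card_edgesAt_pos v) (by omega)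
          · intro v _ hv
            have := h.card_edgesAt_pos v
            rw [hv, Finset.card_map] at this
            omega
        · obtain ⟨e, rfl⟩ := Finset.card_eq_one.mp hc
          rw [Finset.map_singleton]
          have h3 := h.card_filter_edgesAt_eq_singleton h2 (ψ.symm e)
          have h4 := h'.card_filter_edgesAt_eq_singleton h2' e
          rw [← ψ.symm.degree_eq e] at h4
          exact Nat.add_right_cancel (h3.trans h4.symm)
        · obtain ⟨e, e', hne, rfl⟩ := Finset.card_eq_two.mp hc
          rw [Finset.map_insert, Finset.map_singleton]
          have h3 := h.card_filter_edgesAt_eq_pair h2 (ψ.symm.injective.ne hne)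
          have h4 := h'.card_filter_edgesAt_eq_pair h2' hne
          simp only [← ψ.symm.map_adj_iff (v := e) (w := e')] at h4
          exact h3.trans h4.symm)
  refine ⟨φ, fun v e => ?_⟩
  rw [← mem_edgesAt, hφ v, ← mem_edgesAt (ed := ed), Finset.mem_map_equiv]
  exact iff_of_eq (congrArg (· ∈ edgesAt ed v) (ψ.symm_apply_apply e))

theorem nonempty_iso_pathGraph (h : IsEdgeTree k ed) (h2 : ∀ v, (edgesAt ed v).card ≤ 2)
    (hX : excess (jointDegree ed) = 0) :
    Nonempty (lineGraph ed ≃g SimpleGraph.pathGraph (Fintype.card E)) := by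
  have hle : ∀ e, (lineGraph ed).degree e ≤ 2 := fun e => by
    rw [← h.jointDegree_eq_degree h2]
    exact le_two_of_excess_eq_zero hX e
  -- The degrees sum to `2 * |E| - 2`, so they cannot all be at least two.
  have hl : ∃ l, (lineGraph ed).degree l ≤ 1 := by
    by_contra! hcon
    have h3 := h.sum_jointDegree h2
    simp only [h.jointDegree_eq_degree h2] at h3
    have h4 : ∑ e : E, 2 ≤ ∑ e, (lineGraph ed).degree e := Finset.sum_le_sum fun e _ => hcon e
    rw [Finset.sum_const, Finset.card_univ, smul_eq_mul] at h4
    omega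
  obtain ⟨l, hl⟩ := hl
  obtain ⟨f, -⟩ := h.connected.exists_iso_pathGraph (l := l)
    (fun x y hx hy => SimpleGraph.eq_of_degree_le_one hl hx hy)
    (fun v x y z hx hy hz => SimpleGraph.eq_or_eq_or_eq_of_degree_le_two (hle v) hx hy hz) rfl
  exact ⟨f⟩

/-- Both vertices counted in `centralLeafVerts` lie in the unique edge with value `3`. The leaves
behind them are different, since otherwise two edges would share two vertices. -/
theorem nonempty_iso_forkGraph (h : IsEdgeTree k ed) (h2 : ∀ v, (edgesAt ed v).card ≤ 2)
    (hX : excess (jointDegree ed) = 1) (hc : 2 ≤ (centralLeafVerts ed).card) {n : ℕ}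
    (hn : Fintype.card E = n + 1) :
    Nonempty (SimpleGraph.forkGraph n ≃g lineGraph ed) := by
  obtain ⟨c, hc3, hle⟩ := exists_eq_three_of_excess_eq_one hX
  have hu : ∀ e, jointDegree ed e = 3 → e = c := by
    intro e he
    by_contra hne
    have := hle e hne
    omega
  obtain ⟨v, hv, w, hw, hvw⟩ := Finset.one_lt_card.mp hc
  simp only [centralLeafVerts, Finset.mem_filter, Finset.mem_univ, true_and] at hv hw
  obtain ⟨e₁, l, hv1, hv2, he1, hl⟩ := hv
  obtain ⟨e₂, l', hw1, hw2, he2, hl'⟩ := hw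
  obtain rfl := hu _ he1
  obtain rfl := hu _ he2
  have hne : e₂ ≠ l := by
    rintro rfl
    omega
  have hne' : e₂ ≠ l' := by
    rintro rfl
    omega
  refine h.connected.nonempty_iso_forkGraph (c := e₂) (l := l) (l' := l') ?_ ?_ ?_ ?_
    ⟨hne, v, hv1, hv2⟩ ⟨hne', w, hw1, hw2⟩ (fun e he => ?_) hn
  · rw [← h.jointDegree_eq_degree h2, hl]
  · rw [← h.jointDegree_eq_degree h2, hl']
  · rintro rfl
    exact hvw (h.linear _ _ hne v w hv1 hv2 hw1 hw2)
  · rw [← h.jointDegree_eq_degree h2, hc3]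
  · rw [← h.jointDegree_eq_degree h2]
    exact hle e he

end IsEdgeTree

/-- Relabelling is a bijection between families that preserves contributions. Order zero is separate
because `configTerm_extend` needs a nonempty family. -/
theorem momentSum_eq_of_equiv (hk : 2 ≤ k) (φ : V ≃ V') (ψ : E ≃ E')
    (hφ : ∀ v e, φ v ∈ ed' (ψ e) ↔ v ∈ ed e) (a : ℝ) (d : ℕ) :
    momentSum k ed a d = momentSum k ed' a d := by
  rcases Nat.eq_zero_or_pos d with rfl | hd
  · rw [momentSum_zero, momentSum_zero, Fintype.card_congr φ]
  have hed : ∀ e, ed' (ψ e) = (ed e).image φ := by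
    intro e
    ext v
    rw [Finset.mem_image]
    constructor
    · intro hv
      exact ⟨φ.symm v, (hφ _ e).mp (by rwa [φ.apply_symm_apply]), φ.apply_symm_apply v⟩
    · rintro ⟨w, hw, rfl⟩
      exact (hφ w e).mpr hw
  have hdeg : ∀ v, (edgesAt ed' (φ v)).card = (edgesAt ed v).card := by
    intro v
    rw [← Finset.card_map ψ.toEmbedding]
    congr 1
    ext e
    rw [mem_edgesAt, Finset.mem_map_equiv, mem_edgesAt, ← hφ, ψ.apply_symm_apply]
  have hinv : ∀ n : V' × Option E' → ℕ,
      configExtend φ ψ (fun p => n (Prod.map φ (Option.map ψ) p)) = n := by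
    intro n
    funext p
    obtain ⟨⟨v, o⟩, rfl⟩ : p ∈ Set.range (Prod.map φ (Option.map ψ)) := by
      rw [Set.range_prodMap]
      refine ⟨φ.surjective _, ?_⟩
      rcases p.2 with _ | e
      · exact ⟨none, rfl⟩
      · exact ⟨some (ψ.symm e), by simp⟩
    rw [configExtend_apply φ.injective ψ.injective]
  refine Finset.sum_bij' (fun n _ => configExtend φ ψ n)
    (fun n _ p => n (Prod.map φ (Option.map ψ) p)) ?_ ?_ ?_ ?_ ?_
  · intro n hn
    rw [Finset.mem_piAntidiag] at hn ⊢
    exact ⟨by rw [sum_configExtend φ.injective ψ.injective, hn.1], fun p _ => Finset.mem_univ p⟩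
  · intro n hn
    rw [Finset.mem_piAntidiag] at hn ⊢
    exact ⟨by rw [← sum_configExtend φ.injective ψ.injective, hinv, hn.1],
      fun p _ => Finset.mem_univ p⟩
  · intro n _
    funext p
    rw [configExtend_apply φ.injective ψ.injective]
  · intro n _
    exact hinv n
  · intro n hn
    rw [configTerm_extend hk φ.injective ψ.injective hed (by
      rw [(Finset.mem_piAntidiag.mp hn).1]; omega)]
    congr 1
    funext v
    simp [hdeg]

end

namespace Hypergraph

variable {U W : Type*} [Finite U] [Finite W] {H : Hypergraph U} {K : Hypergraph W}

theorem isIsomorphic_of_equiv (φ : ↥H.vertexSet ≃ ↥K.vertexSet) (ψ : ↥H.edgeSet ≃ ↥K.edgeSet)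
    (hφ : ∀ v e, φ v ∈ K.edgeVerts (ψ e) ↔ v ∈ H.edgeVerts e) : H.IsIsomorphic K := by
  have himg : ∀ e, φ '' (H.edgeVerts e : Set ↥H.vertexSet) = K.edgeVerts (ψ e) := by
    intro e
    ext v
    rw [Equiv.image_eq_preimage_symm, Set.mem_preimage, Finset.mem_coe, Finset.mem_coe, ← hφ,
      φ.apply_symm_apply]
  refine ⟨φ, fun s => ⟨fun hs => ?_, fun hs => ?_⟩⟩
  · have h1 : s = H.edgeVerts ⟨_, hs⟩ :=
      Subtype.val_injective.image_injective (image_edgeVerts H ⟨_, hs⟩).symm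
    rw [h1, himg, image_edgeVerts]
    exact (ψ _).2
  · obtain ⟨e, he⟩ := ψ.surjective ⟨_, hs⟩
    have h1 : φ '' s = K.edgeVerts (ψ e) := by
      rw [he]
      exact Subtype.val_injective.image_injective (image_edgeVerts K ⟨_, hs⟩).symm
    rw [← himg, φ.injective.image_injective.eq_iff] at h1
    rw [h1, image_edgeVerts]
    exact e.2

theorem IsIsomorphic.exists_equiv (h : H.IsIsomorphic K) :
    ∃ (φ : ↥H.vertexSet ≃ ↥K.vertexSet) (ψ : ↥H.edgeSet ≃ ↥K.edgeSet),
      ∀ v e, φ v ∈ K.edgeVerts (ψ e) ↔ v ∈ H.edgeVerts e := by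
  obtain ⟨φ, hφ⟩ := h
  have hmem : ∀ e, Subtype.val '' (φ '' (H.edgeVerts e : Set ↥H.vertexSet)) ∈ K.edgeSet := by
    intro e
    rw [← hφ, image_edgeVerts]
    exact e.2
  let g : ↥H.edgeSet → ↥K.edgeSet := fun e => ⟨_, hmem e⟩
  have hg : Function.Bijective g := by
    constructor
    · intro e e' hee
      apply edgeVerts_injective
      exact Finset.coe_injective (φ.injective.image_injective
        (Subtype.val_injective.image_injective (congrArg Subtype.val hee)))
    · intro e
      have h1 : φ '' (φ.symm '' (K.edgeVerts e : Set ↥K.vertexSet)) = K.edgeVerts e := by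
        rw [← Set.image_comp, Equiv.self_comp_symm, Set.image_id]
      have h2 : Subtype.val '' (φ.symm '' (K.edgeVerts e : Set ↥K.vertexSet)) ∈ H.edgeSet := by
        rw [hφ, h1, image_edgeVerts]
        exact e.2
      refine ⟨⟨_, h2⟩, Subtype.ext ?_⟩
      have h3 : (H.edgeVerts ⟨_, h2⟩ : Set ↥H.vertexSet) = φ.symm '' K.edgeVerts e :=
        Subtype.val_injective.image_injective (image_edgeVerts H ⟨_, h2⟩)
      change Subtype.val '' (φ '' (H.edgeVerts ⟨_, h2⟩ : Set ↥H.vertexSet)) = (e : Set W)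
      rw [h3, h1, image_edgeVerts]
  refine ⟨φ, Equiv.ofBijective g hg, fun v e => ?_⟩
  have h1 : (K.edgeVerts (g e) : Set ↥K.vertexSet) = φ '' (H.edgeVerts e) :=
    Subtype.val_injective.image_injective (image_edgeVerts K (g e))
  rw [Equiv.ofBijective_apply, ← Finset.mem_coe, h1, φ.injective.mem_set_image, Finset.mem_coe]

theorem IsIsomorphic.symm (h : H.IsIsomorphic K) : K.IsIsomorphic H := by
  obtain ⟨φ, ψ, hφ⟩ := h.exists_equiv
  refine isIsomorphic_of_equiv φ.symm ψ.symm fun v e => ?_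
  rw [← hφ, φ.apply_symm_apply, ψ.apply_symm_apply]

theorem IsUniformHypertree.alphaEq_of_isIsomorphic {k m : ℕ} (hk : 2 ≤ k)
    (hH : H.IsUniformHypertree k m) (hK : K.IsUniformHypertree k m) (h : H.IsIsomorphic K)
    (a : ℝ) : AlphaEq k a H K := by
  classical
  have : Fintype ↥H.vertexSet := Fintype.ofFinite _
  have : Fintype ↥K.vertexSet := Fintype.ofFinite _
  have : Fintype ↥H.edgeSet := Fintype.ofFinite _
  have : Fintype ↥K.edgeSet := Fintype.ofFinite _
  obtain ⟨φ, ψ, hφ⟩ := h.exists_equiv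
  refine ⟨by rw [← Nat.card_coe_set_eq, ← Nat.card_coe_set_eq, Nat.card_congr φ], fun t _ => ?_⟩
  rw [hH.alphaMoment_eq, hK.alphaMoment_eq, momentSum_eq_of_equiv hk φ ψ hφ, Fintype.card_congr φ]

theorem IsUniformHypertree.isIsomorphic_of_iso_lineGraph {k m : ℕ} [Fintype ↥H.vertexSet]
    [DecidableEq ↥H.vertexSet] [Fintype ↥H.edgeSet] [DecidableEq ↥H.edgeSet]
    [Fintype ↥K.vertexSet] [DecidableEq ↥K.vertexSet] [Fintype ↥K.edgeSet]
    [DecidableEq ↥K.edgeSet] (hm : 1 ≤ m) (hH : H.IsUniformHypertree k m)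
    (hK : K.IsUniformHypertree k m) (h2 : ∀ v, (edgesAt H.edgeVerts v).card ≤ 2)
    (h2' : ∀ v, (edgesAt K.edgeVerts v).card ≤ 2)
    (ψ : lineGraph H.edgeVerts ≃g lineGraph K.edgeVerts) : H.IsIsomorphic K := by
  obtain ⟨φ, hφ⟩ := (hH.isEdgeTree hm).exists_vertex_equiv (hK.isEdgeTree hm) h2 h2' ψ
  exact isIsomorphic_of_equiv φ ψ.toEquiv hφ

end Hypergraph

end

/-! ### The hyperpath and the hypertree `F` -/

section

open HTensor

namespace SimpleGraph

theorem degree_pathGraph_le {n : ℕ} (i : Fin n) [Fintype ((pathGraph n).neighborSet i)] :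
    (pathGraph n).degree i ≤ 2 := by
  rw [← card_neighborFinset_eq_degree]
  by_contra! h
  obtain ⟨x, y, z, hx, hy, hz, hxy, hxz, hyz⟩ := Finset.two_lt_card_iff.mp h
  rw [mem_neighborFinset, pathGraph_adj] at hx hy hz
  rw [ne_eq, Fin.ext_iff] at hxy hxz hyz
  omega

theorem connected_forkGraph {n : ℕ} (hn : 2 ≤ n) : (forkGraph n).Connected := by
  obtain ⟨n, rfl⟩ := Nat.exists_eq_add_of_le' hn
  let f : pathGraph (n + 2) →g forkGraph (n + 2) := ⟨some, fun h => pathGraph_adj.mp h⟩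
  have h1 : ∀ o, (forkGraph (n + 2)).Reachable (some 1) o := by
    rintro (_ | i)
    · exact Adj.reachable (show ((1 : Fin (n + 2)) : ℕ) = 1 from rfl)
    · exact (pathGraph_preconnected _ 1 i).map f
  exact (connected_iff _).mpr ⟨fun o o' => (h1 o).symm.trans (h1 o'), ⟨none⟩⟩

theorem degree_forkGraph_none {n : ℕ} (hn : 2 ≤ n) [Fintype ((forkGraph n).neighborSet none)] :
    (forkGraph n).degree none = 1 := by
  rw [degree_eq_one_iff_existsUnique_adj]
  refine ⟨some ⟨1, hn⟩, rfl, ?_⟩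
  rintro (_ | i) h
  · exact h.elim
  · exact congrArg some (Fin.ext h)

theorem degree_forkGraph_zero {n : ℕ} (hn : 2 ≤ n)
    [Fintype ((forkGraph n).neighborSet (some ⟨0, by omega⟩))] :
    (forkGraph n).degree (some ⟨0, _⟩) = 1 := by
  rw [degree_eq_one_iff_existsUnique_adj]
  refine ⟨some ⟨1, hn⟩, Or.inl rfl, ?_⟩
  rintro (_ | i) h
  · exact absurd (show (0 : ℕ) = 1 from h) (by omega)
  · have h' : 0 + 1 = (i : ℕ) ∨ (i : ℕ) + 1 = 0 := h
    exact congrArg some (Fin.ext (show (i : ℕ) = 1 by omega))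

theorem degree_forkGraph_one {n : ℕ} (hn : 3 ≤ n)
    [Fintype ((forkGraph n).neighborSet (some ⟨1, by omega⟩))] :
    (forkGraph n).degree (some ⟨1, _⟩) = 3 := by
  classical
  have h : (forkGraph n).neighborFinset (some ⟨1, _⟩) =
      {none, some ⟨0, by omega⟩, some ⟨2, by omega⟩} := by
    ext o
    rw [mem_neighborFinset]
    rcases o with _ | i
    · exact iff_of_true rfl (by simp)
    · simp only [Finset.mem_insert, Finset.mem_singleton, Option.some.injEq, Fin.ext_iff]
      change 1 + 1 = (i : ℕ) ∨ (i : ℕ) + 1 = 1 ↔ _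
      simp only [reduceCtorEq, false_or]
      omega
  rw [← card_neighborFinset_eq_degree, h]
  rfl

theorem degree_forkGraph_le {n : ℕ} {o : Option (Fin n)} (ho : ∀ i, o = some i → (i : ℕ) ≠ 1)
    [Fintype ((forkGraph n).neighborSet o)] : (forkGraph n).degree o ≤ 2 := by
  rw [← card_neighborFinset_eq_degree]
  by_contra! h
  obtain ⟨x, y, z, hx, hy, hz, hxy, hxz, hyz⟩ := Finset.two_lt_card_iff.mp h
  rw [mem_neighborFinset] at hx hy hz
  rcases o with _ | i
  · rcases x with _ | x
    · exact hx
    rcases y with _ | y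
    · exact hy
    exact hxy (congrArg some (Fin.ext (Eq.trans hx (Eq.symm hy))))
  · have hi := ho i rfl
    rcases x with _ | x
    · exact hi hx
    rcases y with _ | y
    · exact hi hy
    rcases z with _ | z
    · exact hi hz
    rw [ne_eq, Option.some.injEq, Fin.ext_iff] at hxy hxz hyz
    change (i : ℕ) + 1 = x ∨ (x : ℕ) + 1 = i at hx
    change (i : ℕ) + 1 = y ∨ (y : ℕ) + 1 = i at hy
    change (i : ℕ) + 1 = z ∨ (z : ℕ) + 1 = i at hz
    omega

end SimpleGraph

theorem Function.Injective.encard_range_eq_card {α β : Type*} [Fintype α] {f : α → β}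
    (h : Function.Injective f) : (Set.range f).encard = Fintype.card α := by
  rw [← Set.image_univ, h.encard_image, Set.encard_univ, ENat.card_eq_coe_fintype_card]

namespace Hypergraph

section

variable {U I : Type*} [Finite U] {H : Hypergraph U} [Fintype ↥H.vertexSet]
  [DecidableEq ↥H.vertexSet] [Fintype ↥H.edgeSet] [DecidableEq ↥H.edgeSet] {ed : I → Set U}

theorem exists_iso_lineGraph (hinj : Function.Injective ed) (hr : H.edgeSet = Set.range ed)
    {G : SimpleGraph I} (hG : ∀ i j, G.Adj i j ↔ i ≠ j ∧ ∃ v, v ∈ ed i ∧ v ∈ ed j) :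
    ∃ g : G ≃g lineGraph H.edgeVerts, ∀ i, (g i : Set U) = ed i := by
  let g : I ≃ ↥H.edgeSet := (Equiv.ofInjective ed hinj).trans (Equiv.setCongr hr.symm)
  refine ⟨⟨g, fun {i j} => ?_⟩, fun i => rfl⟩
  rw [hG]
  refine and_congr g.injective.ne_iff ⟨?_, ?_⟩
  · rintro ⟨v, hv, hv'⟩
    exact ⟨v, mem_edgeVerts.mp hv, mem_edgeVerts.mp hv'⟩
  · rintro ⟨v, hv, hv'⟩
    exact ⟨⟨v, H.subset_vertexSet_of_mem_edgeSet (g i).2 hv⟩, mem_edgeVerts.mpr hv,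
      mem_edgeVerts.mpr hv'⟩

theorem card_edgesAt_le_two (hr : H.edgeSet = Set.range ed)
    (h : ∀ v i j l, v ∈ ed i → v ∈ ed j → v ∈ ed l → i = j ∨ i = l ∨ j = l) (v : ↥H.vertexSet) :
    (edgesAt H.edgeVerts v).card ≤ 2 := by
  by_contra! hc
  obtain ⟨x, y, z, hx, hy, hz, hxy, hxz, hyz⟩ := Finset.two_lt_card_iff.mp hc
  rw [mem_edgesAt, mem_edgeVerts] at hx hy hz
  obtain ⟨i, hi⟩ : (x : Set U) ∈ Set.range ed := hr ▸ x.2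
  obtain ⟨j, hj⟩ : (y : Set U) ∈ Set.range ed := hr ▸ y.2
  obtain ⟨l, hl⟩ : (z : Set U) ∈ Set.range ed := hr ▸ z.2
  rw [← hi] at hx
  rw [← hj] at hy
  rw [← hl] at hz
  rcases h v i j l hx hy hz with rfl | rfl | rfl
  · exact hxy (Subtype.ext (hi.symm.trans hj))
  · exact hxz (Subtype.ext (hi.symm.trans hl))
  · exact hyz (Subtype.ext (hj.symm.trans hl))

/-- The incidence graph is connected through the line graph and the covering of the vertices; with
`k * m` incidences on `k * m + 1` nodes it is a tree. Acyclicity needs no direct check. -/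
theorem isUniformHypertree_of_connected_lineGraph {k m : ℕ} (hu : H.IsUniform k)
    (hm : H.edgeSet.encard = m) (hc : (lineGraph H.edgeVerts).Connected)
    (hcov : ∀ v ∈ H.vertexSet, ∃ e ∈ H.edgeSet, v ∈ e)
    (hn : Fintype.card ↥H.vertexSet + m = k * m + 1) : H.IsUniformHypertree k m := by
  classical
  have hm' : Fintype.card ↥H.edgeSet = m := by
    rw [Set.encard_eq_coe_toFinset_card, Set.toFinset_card] at hm
    exact_mod_cast hm
  refine ⟨hu, hm, SimpleGraph.isTree_iff_connected_and_card.mpr ⟨?_, ?_⟩⟩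
  · have key : ∀ e e', H.incidenceGraph.Reachable (.inr e) (.inr e') := by
      intro e e'
      have h := hc.preconnected e e'
      rw [SimpleGraph.reachable_iff_reflTransGen] at h
      induction h with
      | refl => exact SimpleGraph.Reachable.refl _
      | tail _ hbc ih =>
        obtain ⟨-, v, hv, hv'⟩ := hbc
        exact (ih.trans (incidenceGraph_adj_inr_inl.mpr hv).reachable).trans
          (incidenceGraph_adj_inl_inr.mpr hv').reachable
    have hv : ∀ v, ∃ e, H.incidenceGraph.Reachable (.inl v) (.inr e) := by
      intro v
      obtain ⟨e, he, hve⟩ := hcov v v.2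
      exact ⟨⟨e, he⟩, SimpleGraph.Adj.reachable hve⟩
    have hp : ∀ p, ∃ e, H.incidenceGraph.Reachable p (.inr e) := by
      rintro (v | e)
      · exact hv v
      · exact ⟨e, SimpleGraph.Reachable.refl _⟩
    refine (SimpleGraph.connected_iff _).mpr ⟨fun p q => ?_, ⟨.inr hc.nonempty.some⟩⟩
    obtain ⟨e, he⟩ := hp p
    obtain ⟨e', he'⟩ := hp q
    exact (he.trans (key e e')).trans he'.symm
  · rw [Nat.card_eq_fintype_card, Nat.card_eq_fintype_card, ← SimpleGraph.edgeFinset_card,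
      card_edgeFinset_incidenceGraph, Fintype.card_sum,
      Finset.sum_congr rfl fun e _ => card_edgeVerts hu e, Finset.sum_const, smul_eq_mul,
      Finset.card_univ, hm', mul_comm, hn]

end

section

variable {k m : ℕ}

theorem inl_mem_hyperpathEdge {i : Fin m} {x : Fin (m + 1)} :
    Sum.inl x ∈ hyperpathEdge k m i ↔ (x : ℕ) = i ∨ (x : ℕ) = i + 1 := by
  simp [hyperpathEdge, Fin.ext_iff]

theorem inr_mem_hyperpathEdge {i : Fin m} {p : Fin m × Fin (k - 2)} :
    Sum.inr p ∈ hyperpathEdge k m i ↔ p.1 = i := by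
  obtain ⟨j, t⟩ := p
  simp [hyperpathEdge, eq_comm]

theorem hyperpathEdge_injective : Function.Injective (hyperpathEdge k m) := by
  intro i j h
  have h1 : Sum.inl i.castSucc ∈ hyperpathEdge k m j := h ▸ inl_mem_hyperpathEdge.mpr (Or.inl rfl)
  have h2 : Sum.inl j.castSucc ∈ hyperpathEdge k m i := h ▸ inl_mem_hyperpathEdge.mpr (Or.inl rfl)
  rw [inl_mem_hyperpathEdge, Fin.val_castSucc] at h1 h2
  exact Fin.ext (by omega)

theorem encard_hyperpathEdge (hk : 2 ≤ k) (i : Fin m) : (hyperpathEdge k m i).encard = k := by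
  rw [hyperpathEdge, Set.encard_union_eq, Set.encard_pair, Function.Injective.encard_range_eq_card]
  · rw [Fintype.card_fin]
    exact_mod_cast Nat.add_sub_of_le hk
  · intro t t' h
    exact (Prod.ext_iff.mp (Sum.inr_injective h)).2
  · simp [Fin.ext_iff]
  · rw [Set.disjoint_left]
    rintro _ (rfl | rfl) ⟨t, ht⟩ <;> simp at ht

theorem pathGraph_adj_iff_hyperpathEdge {i j : Fin m} : (SimpleGraph.pathGraph m).Adj i j ↔
    i ≠ j ∧ ∃ v, v ∈ hyperpathEdge k m i ∧ v ∈ hyperpathEdge k m j := by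
  rw [SimpleGraph.pathGraph_adj]
  constructor
  · intro h
    refine ⟨fun h' => by subst h'; omega, ?_⟩
    rcases h with h | h
    · exact ⟨Sum.inl i.succ, inl_mem_hyperpathEdge.mpr (Or.inr rfl),
        inl_mem_hyperpathEdge.mpr (Or.inl h)⟩
    · exact ⟨Sum.inl j.succ, inl_mem_hyperpathEdge.mpr (Or.inl h),
        inl_mem_hyperpathEdge.mpr (Or.inr rfl)⟩
  · rintro ⟨hne, x | p, hi, hj⟩
    · rw [inl_mem_hyperpathEdge] at hi hj
      rw [ne_eq, Fin.ext_iff] at hne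
      omega
    · rw [inr_mem_hyperpathEdge] at hi hj
      exact absurd (hi.symm.trans hj) hne

theorem eq_or_eq_or_eq_of_mem_hyperpathEdge {v : Fin (m + 1) ⊕ Fin m × Fin (k - 2)} {i j l : Fin m}
    (hi : v ∈ hyperpathEdge k m i) (hj : v ∈ hyperpathEdge k m j) (hl : v ∈ hyperpathEdge k m l) :
    i = j ∨ i = l ∨ j = l := by
  rcases v with x | p
  · rw [inl_mem_hyperpathEdge] at hi hj hl
    simp only [Fin.ext_iff]
    omega
  · rw [inr_mem_hyperpathEdge] at hi hj
    exact Or.inl (hi.symm.trans hj)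

theorem exists_mem_hyperpathEdge (hm : 1 ≤ m) (v : Fin (m + 1) ⊕ Fin m × Fin (k - 2)) :
    ∃ i, v ∈ hyperpathEdge k m i := by
  rcases v with x | p
  · by_cases hx : (x : ℕ) < m
    · exact ⟨⟨x, hx⟩, inl_mem_hyperpathEdge.mpr (Or.inl rfl)⟩
    · exact ⟨⟨m - 1, by omega⟩, inl_mem_hyperpathEdge.mpr (Or.inr (by
        have := x.2
        change (x : ℕ) = m - 1 + 1
        omega))⟩
  · exact ⟨p.1, inr_mem_hyperpathEdge.mpr rfl⟩

theorem card_hyperpath (hk : 2 ≤ k) :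
    Fintype.card (Fin (m + 1) ⊕ Fin m × Fin (k - 2)) + m = k * m + 1 := by
  obtain ⟨k, rfl⟩ := Nat.exists_eq_add_of_le' hk
  simp only [Fintype.card_sum, Fintype.card_prod, Fintype.card_fin, Nat.add_sub_cancel]
  ring

theorem isUniformHypertree_hyperpath (hk : 2 ≤ k) (hm : 1 ≤ m) :
    (hyperpath k m).IsUniformHypertree k m := by
  classical
  have : Fintype ↥(hyperpath k m).vertexSet := Fintype.ofFinite _
  have : Fintype ↥(hyperpath k m).edgeSet := Fintype.ofFinite _
  obtain ⟨g, -⟩ := exists_iso_lineGraph (H := hyperpath k m) hyperpathEdge_injective rfl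
    fun i j => pathGraph_adj_iff_hyperpathEdge (k := k)
  refine isUniformHypertree_of_connected_lineGraph ?_ ?_ ?_ ?_ ?_
  · rintro _ ⟨i, rfl⟩
    exact encard_hyperpathEdge hk i
  · exact (hyperpathEdge_injective.encard_range_eq_card).trans (by rw [Fintype.card_fin])
  · obtain ⟨m, rfl⟩ := Nat.exists_eq_add_of_le' hm
    exact g.connected_iff.mp (SimpleGraph.pathGraph_connected m)
  · intro v _
    obtain ⟨i, hi⟩ := exists_mem_hyperpathEdge hm v
    exact ⟨_, ⟨i, rfl⟩, hi⟩
  · rw [← card_hyperpath hk]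
    congr 1
    exact Fintype.card_congr (Equiv.Set.univ _)

end

section

variable {U I : Type*} {k : ℕ}

/-- The hyperedges of a hypergraph with a pendant hyperedge attached at `v`. -/
def attachPendantEdge (k : ℕ) (ed : I → Set U) (v : U) : Option I → Set (U ⊕ Fin (k - 1))
  | none => insert (Sum.inl v) (Set.range Sum.inr)
  | some i => Sum.inl '' ed i

variable {ed : I → Set U} {v : U}

theorem edgeSet_attachPendant {H : Hypergraph U} (hv : v ∈ H.vertexSet)
    (hr : H.edgeSet = Set.range ed) :
    (attachPendant k H v hv).edgeSet = Set.range (attachPendantEdge k ed v) := by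
  change insert _ _ = _
  rw [hr]
  ext s
  constructor
  · rintro (rfl | ⟨_, ⟨i, rfl⟩, rfl⟩)
    · exact ⟨none, rfl⟩
    · exact ⟨some i, rfl⟩
  · rintro ⟨_ | i, rfl⟩
    · exact Or.inl rfl
    · exact Or.inr ⟨_, ⟨i, rfl⟩, rfl⟩

theorem inl_mem_attachPendantEdge_none {u : U} :
    Sum.inl u ∈ attachPendantEdge k ed v none ↔ u = v := by
  simp [attachPendantEdge]

theorem inr_mem_attachPendantEdge_none (t : Fin (k - 1)) :
    Sum.inr t ∈ attachPendantEdge k ed v none := Or.inr ⟨t, rfl⟩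

theorem inl_mem_attachPendantEdge_some {u : U} {i : I} :
    Sum.inl u ∈ attachPendantEdge k ed v (some i) ↔ u ∈ ed i := by
  simp [attachPendantEdge]

theorem inr_notMem_attachPendantEdge_some {t : Fin (k - 1)} {i : I} :
    Sum.inr t ∉ attachPendantEdge k ed v (some i) := by
  simp [attachPendantEdge]

theorem attachPendantEdge_injective (hk : 2 ≤ k) (h : Function.Injective ed) :
    Function.Injective (attachPendantEdge k ed v) := by
  have hn : ∀ i, attachPendantEdge k ed v none ≠ attachPendantEdge k ed v (some i) := fun i hi =>
    inr_notMem_attachPendantEdge_some (hi ▸ inr_mem_attachPendantEdge_none ⟨0, by omega⟩)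
  rintro (_ | i) (_ | j) hij
  · rfl
  · exact absurd hij (hn j)
  · exact absurd hij.symm (hn i)
  · exact congrArg some (h (Sum.inl_injective.image_injective hij))

theorem encard_attachPendantEdge (hk : 1 ≤ k) (h : ∀ i, (ed i).encard = k) (o : Option I) :
    (attachPendantEdge k ed v o).encard = k := by
  rcases o with _ | i
  · rw [attachPendantEdge, Set.encard_insert_of_notMem (by simp), 
      Sum.inr_injective.encard_range_eq_card, Fintype.card_fin]
    exact_mod_cast Nat.sub_add_cancel hk
  · rw [attachPendantEdge, Sum.inl_injective.encard_image, h]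

end

section

variable {k m : ℕ}

/-- The hyperedges of `hypertreeF`. -/
def hypertreeFEdge (k m : ℕ) (hk : 3 ≤ k) (hm : 4 ≤ m) : Option (Fin (m - 1)) →
    Set ((Fin (m - 1 + 1) ⊕ Fin (m - 1) × Fin (k - 2)) ⊕ Fin (k - 1)) :=
  attachPendantEdge k (hyperpathEdge k (m - 1)) (Sum.inr (⟨1, by omega⟩, ⟨0, by omega⟩))

variable (hk : 3 ≤ k) (hm : 4 ≤ m)

theorem hypertreeFEdge_injective : Function.Injective (hypertreeFEdge k m hk hm) :=
  attachPendantEdge_injective (by omega) hyperpathEdge_injective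

theorem edgeSet_hypertreeF :
    (hypertreeF k m hk hm).edgeSet = Set.range (hypertreeFEdge k m hk hm) :=
  edgeSet_attachPendant _ rfl

theorem forkGraph_adj_iff_hypertreeFEdge {o o' : Option (Fin (m - 1))} :
    (SimpleGraph.forkGraph (m - 1)).Adj o o' ↔
      o ≠ o' ∧ ∃ v, v ∈ hypertreeFEdge k m hk hm o ∧ v ∈ hypertreeFEdge k m hk hm o' := by
  have key : ∀ i : Fin (m - 1), (i : ℕ) = 1 ↔
      ∃ v, v ∈ hypertreeFEdge k m hk hm none ∧ v ∈ hypertreeFEdge k m hk hm (some i) := by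
    intro i
    constructor
    · intro hi
      exact ⟨_, inl_mem_attachPendantEdge_none.mpr rfl, inl_mem_attachPendantEdge_some.mpr
        (inr_mem_hyperpathEdge.mpr (Fin.ext hi.symm))⟩
    · rintro ⟨u | t, h1, h2⟩
      · obtain rfl := inl_mem_attachPendantEdge_none.mp h1
        exact (congrArg Fin.val (inr_mem_hyperpathEdge.mp
          (inl_mem_attachPendantEdge_some.mp h2))).symm
      · exact absurd h2 inr_notMem_attachPendantEdge_some
  rcases o with _ | i <;> rcases o' with _ | j
  · exact iff_of_false id fun h => h.1 rfl
  · exact (key j).trans (by simp)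
  · refine (key i).trans ?_
    simp only [ne_eq, reduceCtorEq, not_false_eq_true, true_and, and_comm]
  · refine SimpleGraph.pathGraph_adj.symm.trans
      ((pathGraph_adj_iff_hyperpathEdge (k := k)).trans ?_)
    refine and_congr (Option.some_injective _).ne_iff.symm ⟨?_, ?_⟩
    · rintro ⟨v, h1, h2⟩
      exact ⟨Sum.inl v, inl_mem_attachPendantEdge_some.mpr h1,
        inl_mem_attachPendantEdge_some.mpr h2⟩
    · rintro ⟨u | t, h1, h2⟩
      · exact ⟨u, inl_mem_attachPendantEdge_some.mp h1, inl_mem_attachPendantEdge_some.mp h2⟩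
      · exact absurd h2 inr_notMem_attachPendantEdge_some

theorem eq_or_eq_or_eq_of_mem_hypertreeFEdge
    {v : (Fin (m - 1 + 1) ⊕ Fin (m - 1) × Fin (k - 2)) ⊕ Fin (k - 1)}
    {i j l : Option (Fin (m - 1))} (hi : v ∈ hypertreeFEdge k m hk hm i)
    (hj : v ∈ hypertreeFEdge k m hk hm j) (hl : v ∈ hypertreeFEdge k m hk hm l) :
    i = j ∨ i = l ∨ j = l := by
  rcases v with u | t
  · have key : ∀ i j, Sum.inl u ∈ hypertreeFEdge k m hk hm none →
        Sum.inl u ∈ hypertreeFEdge k m hk hm (some i) →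
        Sum.inl u ∈ hypertreeFEdge k m hk hm (some j) → some i = some j := by
      intro i j h0 h1 h2
      obtain rfl := inl_mem_attachPendantEdge_none.mp h0
      exact congrArg some ((inr_mem_hyperpathEdge.mp (inl_mem_attachPendantEdge_some.mp
        h1)).symm.trans
        (inr_mem_hyperpathEdge.mp (inl_mem_attachPendantEdge_some.mp h2)))
    rcases i with _ | i <;> rcases j with _ | j <;> rcases l with _ | l
    · exact Or.inl rfl
    · exact Or.inl rfl
    · exact Or.inr (Or.inl rfl)
    · exact Or.inr (Or.inr (key j l hi hj hl))
    · exact Or.inr (Or.inr rfl)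
    · exact Or.inr (Or.inl (key i l hj hi hl))
    · exact Or.inl (key i j hl hi hj)
    · simpa using eq_or_eq_or_eq_of_mem_hyperpathEdge (inl_mem_attachPendantEdge_some.mp hi)
        (inl_mem_attachPendantEdge_some.mp hj) (inl_mem_attachPendantEdge_some.mp hl)
  · rcases i with _ | i
    · rcases j with _ | j
      · exact Or.inl rfl
      · exact absurd hj inr_notMem_attachPendantEdge_some
    · exact absurd hi inr_notMem_attachPendantEdge_some

theorem isUniformHypertree_hypertreeF : (hypertreeF k m hk hm).IsUniformHypertree k m := by
  classical
  have : Fintype ↥(hypertreeF k m hk hm).vertexSet := Fintype.ofFinite _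
  have : Fintype ↥(hypertreeF k m hk hm).edgeSet := Fintype.ofFinite _
  obtain ⟨g, -⟩ := exists_iso_lineGraph (hypertreeFEdge_injective hk hm)
    (edgeSet_hypertreeF hk hm) fun i j => forkGraph_adj_iff_hypertreeFEdge hk hm
  have huniv : (hypertreeF k m hk hm).vertexSet = Set.univ := by
    refine Set.eq_univ_of_forall ?_
    rintro (u | t)
    · exact Or.inl ⟨u, Set.mem_univ u, rfl⟩
    · exact Or.inr ⟨t, rfl⟩
  refine isUniformHypertree_of_connected_lineGraph ?_ ?_ ?_ ?_ ?_
  · intro e he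
    rw [edgeSet_hypertreeF] at he
    obtain ⟨o, rfl⟩ := he
    exact encard_attachPendantEdge (by omega) (encard_hyperpathEdge (by omega)) o
  · rw [edgeSet_hypertreeF, (hypertreeFEdge_injective hk hm).encard_range_eq_card,
      Fintype.card_option, Fintype.card_fin, Nat.sub_add_cancel (by omega)]
  · exact g.connected_iff.mp (SimpleGraph.connected_forkGraph (by omega))
  · rw [edgeSet_hypertreeF]
    rintro (u | t) _
    · obtain ⟨i, hi⟩ := exists_mem_hyperpathEdge (by omega) u
      exact ⟨_, ⟨some i, rfl⟩, inl_mem_attachPendantEdge_some.mpr hi⟩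
    · exact ⟨_, ⟨none, rfl⟩, inr_mem_attachPendantEdge_none t⟩
  · have h1 := card_hyperpath (k := k) (m := m - 1) (by omega)
    rw [← Nat.card_eq_fintype_card, huniv, Nat.card_congr (Equiv.Set.univ _),
      Nat.card_eq_fintype_card, Fintype.card_sum, Fintype.card_fin]
    obtain ⟨m, rfl⟩ := Nat.exists_eq_add_of_le' (show 1 ≤ m by omega)
    rw [Nat.add_sub_cancel] at h1 ⊢
    rw [Nat.mul_succ]
    omega

end

section

variable {k m : ℕ} [Fintype ↥(hyperpath k m).vertexSet] [DecidableEq ↥(hyperpath k m).vertexSet]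
  [Fintype ↥(hyperpath k m).edgeSet] [DecidableEq ↥(hyperpath k m).edgeSet]

theorem card_edgesAt_hyperpath_le (v : ↥(hyperpath k m).vertexSet) :
    (edgesAt (hyperpath k m).edgeVerts v).card ≤ 2 :=
  card_edgesAt_le_two (ed := hyperpathEdge k m) rfl
    (fun _ _ _ _ hi hj hl => eq_or_eq_or_eq_of_mem_hyperpathEdge hi hj hl) v

theorem nonempty_iso_lineGraph_hyperpath :
    Nonempty (SimpleGraph.pathGraph m ≃g lineGraph (hyperpath k m).edgeVerts) :=
  let ⟨g, _⟩ := exists_iso_lineGraph (H := hyperpath k m) hyperpathEdge_injective rfl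
    fun _ _ => pathGraph_adj_iff_hyperpathEdge (k := k)
  ⟨g⟩

theorem excess_hyperpath (hk : 2 ≤ k) (hm : 1 ≤ m) :
    excess (jointDegree (hyperpath k m).edgeVerts) = 0 := by
  classical
  obtain ⟨g⟩ := nonempty_iso_lineGraph_hyperpath (k := k) (m := m)
  refine Finset.sum_eq_zero fun e _ => ?_
  rw [((isUniformHypertree_hyperpath hk hm).isEdgeTree hm).jointDegree_eq_degree
    card_edgesAt_hyperpath_le, ← g.symm.degree_eq]
  have := SimpleGraph.degree_pathGraph_le (g.symm e)
  omega

end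

section

variable {k m : ℕ} (hk : 3 ≤ k) (hm : 4 ≤ m) [Fintype ↥(hypertreeF k m hk hm).vertexSet]
  [DecidableEq ↥(hypertreeF k m hk hm).vertexSet]
  [Fintype ↥(hypertreeF k m hk hm).edgeSet] [DecidableEq ↥(hypertreeF k m hk hm).edgeSet]

theorem card_edgesAt_hypertreeF_le (v : ↥(hypertreeF k m hk hm).vertexSet) :
    (edgesAt (hypertreeF k m hk hm).edgeVerts v).card ≤ 2 :=
  card_edgesAt_le_two (edgeSet_hypertreeF hk hm)
    (fun _ _ _ _ hi hj hl => eq_or_eq_or_eq_of_mem_hypertreeFEdge hk hm hi hj hl) v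

theorem exists_iso_lineGraph_hypertreeF :
    ∃ g : SimpleGraph.forkGraph (m - 1) ≃g lineGraph (hypertreeF k m hk hm).edgeVerts,
      ∀ o, (g o : Set _) = hypertreeFEdge k m hk hm o :=
  exists_iso_lineGraph (hypertreeFEdge_injective hk hm) (edgeSet_hypertreeF hk hm)
    fun _ _ => forkGraph_adj_iff_hypertreeFEdge hk hm

theorem excess_hypertreeF : excess (jointDegree (hypertreeF k m hk hm).edgeVerts) = 1 := by
  classical
  obtain ⟨g, -⟩ := exists_iso_lineGraph_hypertreeF hk hm
  have h : ∀ o, jointDegree (hypertreeF k m hk hm).edgeVerts (g o) =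
      (SimpleGraph.forkGraph (m - 1)).degree o := fun o => by
    rw [((isUniformHypertree_hypertreeF hk hm).isEdgeTree (by omega)).jointDegree_eq_degree
      (card_edgesAt_hypertreeF_le hk hm), g.degree_eq]
  rw [excess, ← g.toEquiv.sum_comp, Fintype.sum_eq_single (some ⟨1, by omega⟩)]
  · refine (congrArg (· - 2) (h _)).trans ?_
    rw [SimpleGraph.degree_forkGraph_one (by omega)]
  · intro o ho
    refine (congrArg (· - 2) (h o)).trans (Nat.sub_eq_zero_of_le
      (SimpleGraph.degree_forkGraph_le ?_))
    rintro i rfl hi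
    exact ho (congrArg some (Fin.ext hi))

/-- The leaves are the first edge of the path and the pendant edge, both meeting the second edge of
the path. For `m = 4` the last edge is a third one, so only an inequality is claimed. -/
theorem two_le_card_centralLeafVerts_hypertreeF :
    2 ≤ (centralLeafVerts (hypertreeF k m hk hm).edgeVerts).card := by
  classical
  obtain ⟨g, hg⟩ := exists_iso_lineGraph_hypertreeF hk hm
  have h : ∀ o, jointDegree (hypertreeF k m hk hm).edgeVerts (g o) =
      (SimpleGraph.forkGraph (m - 1)).degree o := fun o => by
    rw [((isUniformHypertree_hypertreeF hk hm).isEdgeTree (by omega)).jointDegree_eq_degree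
      (card_edgesAt_hypertreeF_le hk hm), g.degree_eq]
  have hmem : ∀ (u : ↥(hypertreeF k m hk hm).vertexSet) o, u.1 ∈ hypertreeFEdge k m hk hm o →
      u ∈ (hypertreeF k m hk hm).edgeVerts (g o) := fun u o hu => by
    rw [mem_edgeVerts, hg]
    exact hu
  let v : ↥(hypertreeF k m hk hm).vertexSet :=
    ⟨Sum.inl (Sum.inl ⟨1, by omega⟩), Or.inl ⟨_, Set.mem_univ _, rfl⟩⟩
  let w : ↥(hypertreeF k m hk hm).vertexSet :=
    ⟨Sum.inl (Sum.inr (⟨1, by omega⟩, ⟨0, by omega⟩)), Or.inl ⟨_, Set.mem_univ _, rfl⟩⟩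
  refine Finset.one_lt_card.mpr ⟨v, ?_, w, ?_, ?_⟩
  · refine Finset.mem_filter.mpr ⟨Finset.mem_univ _, g (some ⟨1, by omega⟩),
      g (some ⟨0, by omega⟩), hmem _ _ ?_, hmem _ _ ?_, ?_, ?_⟩
    · exact inl_mem_attachPendantEdge_some.mpr (inl_mem_hyperpathEdge.mpr (Or.inl rfl))
    · exact inl_mem_attachPendantEdge_some.mpr (inl_mem_hyperpathEdge.mpr (Or.inr rfl))
    · rw [h, SimpleGraph.degree_forkGraph_one (by omega)]
    · rw [h, SimpleGraph.degree_forkGraph_zero (by omega)]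
  · refine Finset.mem_filter.mpr ⟨Finset.mem_univ _, g (some ⟨1, by omega⟩), g none,
      hmem _ _ ?_, hmem _ _ ?_, ?_, ?_⟩
    · exact inl_mem_attachPendantEdge_some.mpr (inr_mem_hyperpathEdge.mpr rfl)
    · exact inl_mem_attachPendantEdge_none.mpr rfl
    · rw [h, SimpleGraph.degree_forkGraph_one (by omega)]
    · rw [h, SimpleGraph.degree_forkGraph_none (by omega)]
  · intro hvw
    have := Sum.inl_injective (congrArg Subtype.val hvw)
    simp at this

end

end Hypergraph

end

/-! ### The second hypertree in the order -/

theorem mainTheorem5 (k m : ℕ) (hk : 3 ≤ k) (hm : 4 ≤ m) (a : ℝ) (ha0 : 0 < a) (ha1 : a < 1) :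
    (Hypergraph.hyperpath k m).IsUniformHypertree k m ∧
    (Hypergraph.hypertreeF k m hk hm).IsUniformHypertree k m ∧
    Hypergraph.AlphaLT k a (Hypergraph.hyperpath k m) (Hypergraph.hypertreeF k m hk hm) ∧
    ∀ (U : Type*) [Finite U] (T : Hypergraph U), T.IsUniformHypertree k m →
      ¬ T.IsIsomorphic (Hypergraph.hyperpath k m) →
        Hypergraph.AlphaLE k a (Hypergraph.hypertreeF k m hk hm) T ∧
        (Hypergraph.AlphaEq k a (Hypergraph.hypertreeF k m hk hm) T ↔
          T.IsIsomorphic (Hypergraph.hypertreeF k m hk hm)) := by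
  classical
  let P := Hypergraph.hyperpath k m
  let F := Hypergraph.hypertreeF k m hk hm
  have : Fintype ↥P.vertexSet := Fintype.ofFinite _
  have : Fintype ↥P.edgeSet := Fintype.ofFinite _
  have : Fintype ↥F.vertexSet := Fintype.ofFinite _
  have : Fintype ↥F.edgeSet := Fintype.ofFinite _
  have hP : P.IsUniformHypertree k m :=
    Hypergraph.isUniformHypertree_hyperpath (by omega) (by omega)
  have hF : F.IsUniformHypertree k m := Hypergraph.isUniformHypertree_hypertreeF hk hm
  have hPt := hP.isEdgeTree (by omega)
  have hFt := hF.isEdgeTree (by omega)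
  have hP2 : ∀ v, (edgesAt P.edgeVerts v).card ≤ 2 := Hypergraph.card_edgesAt_hyperpath_le
  have hF2 : ∀ v, (edgesAt F.edgeVerts v).card ≤ 2 := Hypergraph.card_edgesAt_hypertreeF_le hk hm
  have hPX : excess (jointDegree P.edgeVerts) = 0 :=
    Hypergraph.excess_hyperpath (by omega) (by omega)
  have hFX : excess (jointDegree F.edgeVerts) = 1 := Hypergraph.excess_hypertreeF hk hm
  have hFc : 2 ≤ (centralLeafVerts F.edgeVerts).card :=
    Hypergraph.two_le_card_centralLeafVerts_hypertreeF hk hm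
  refine ⟨hP, hF, hP.alphaLT hk hm hF (d := k + 2) (by omega) (by omega)
    (hPt.momentSum_lt_of_excess_lt hk hFt (by rw [hP.card_edgeSet, hF.card_edgeSet])
      (by rw [hP.card_edgeSet]; omega) hP2 hF2 (by omega) (by omega) ha0 ha1), ?_⟩
  intro U _ T hT hTP
  have : Fintype ↥T.vertexSet := Fintype.ofFinite _
  have : Fintype ↥T.edgeSet := Fintype.ofFinite _
  have hTt := hT.isEdgeTree (by omega)
  have hE : Fintype.card ↥F.edgeSet = Fintype.card ↥T.edgeSet := by
    rw [hF.card_edgeSet, hT.card_edgeSet]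
  -- The comparison is decided at order `2` if some degree exceeds two, at order `k + 2` if the
  -- excess exceeds one, and at order `2k + 2` if the excess is one; excess zero is the excluded
  -- hyperpath.
  have key : Hypergraph.AlphaLT k a F T ∨ T.IsIsomorphic F := by
    by_cases hT2 : ∀ v, (edgesAt T.edgeVerts v).card ≤ 2
    · rcases Nat.lt_trichotomy (excess (jointDegree T.edgeVerts)) 1 with hX | hX | hX
      · obtain ⟨f⟩ := hTt.nonempty_iso_pathGraph hT2 (by omega)
        rw [hT.card_edgeSet] at f
        obtain ⟨g⟩ := Hypergraph.nonempty_iso_lineGraph_hyperpath (k := k) (m := m)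
        exact absurd (hT.isIsomorphic_of_iso_lineGraph (by omega) hP hT2 hP2 (f.trans g)) hTP
      · have hn : Fintype.card ↥T.edgeSet = m - 1 + 1 := by
          rw [hT.card_edgeSet]
          omega
        rcases Nat.lt_or_ge (centralLeafVerts T.edgeVerts).card
          (centralLeafVerts F.edgeVerts).card with hc | hc
        · exact Or.inl (hF.alphaLT hk hm hT (d := 2 * k + 2) (by omega) le_rfl
            (hFt.momentSum_lt_of_centralLeafVerts_lt hk hTt hE (by rw [hF.card_edgeSet]; omega)
              hF2 hT2 hFX hX hc ha0 ha1))
        -- Here `T` has at least as many central leaves as `F`, hence at least two, and its line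
        -- graph is the fork.
        · obtain ⟨f⟩ := hTt.nonempty_iso_forkGraph hT2 hX (hFc.trans hc) hn
          obtain ⟨g, -⟩ := Hypergraph.exists_iso_lineGraph_hypertreeF hk hm
          exact Or.inr (hT.isIsomorphic_of_iso_lineGraph (by omega) hF hT2 hF2 (f.symm.trans g))
      · exact Or.inl (hF.alphaLT hk hm hT (d := k + 2) (by omega) (by omega)
          (hFt.momentSum_lt_of_excess_lt hk hTt hE (by rw [hF.card_edgeSet]; omega) hF2 hT2
            hFX.le (by omega) ha0 ha1))
    · push Not at hT2
      exact Or.inl (hF.alphaLT hk hm hT (d := 2) (by omega) (by omega)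
        (hFt.momentSum_lt_of_three_le hk hTt hE hF2 hT2 ha0))
  have heq : T.IsIsomorphic F → Hypergraph.AlphaEq k a F T := fun h =>
    hF.alphaEq_of_isIsomorphic (by omega) hT h.symm a
  exact ⟨key.imp_right heq, fun h => key.resolve_left fun h' => h'.not_alphaEq h, heq⟩
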